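/- All simplicial polytopes are considered up to combinatorial equivalence (isomorphism of boundary complexes). Let $\mathbf k$ be an arbitrary field. For a simplicial polytope $P$ with vertex set $V(P)$ and boundary complex $\Delta(P)$, the graded Betti numbers of $P$ are $$\beta_{i,j}(P)=\sum_{W\subset V(P),\ |W|=j}\dim_{\mathbf k}\widetilde H_{j-i-1}(P|_W;\mathbf k)\qquad(i,j\ge 0),$$ where $P|_W$ is the simplicial complex $\{F\cap W: F\in\Delta(P)\}$. The polytope $P$ is *combinatorially rigid* if every simplicial polytope $P'$ (of any dimension) with $\beta_{i,j}(P')=\beta_{i,j}(P)$ for all $i,j\ge 0$ is combinatorially equivalent to $P$. A *connected sum* of two simplicial $3$-polytopes $P_1,P_2$ is a simplicial $3$-polytope whose boundary complex is obtained from $\Delta(P_1)$ and $\Delta(P_2)$ by choosing a facet $F_1$ of $P_1$ and a facet $F_2$ of $P_2$, identifying the vertices of $F_1$ with those of $F_2$ by some bijection, and removing the face $F_1=F_2$. A simplicial $3$-polytope is *irreducible* if it is not a connected sum of two simplicial $3$-polytopes. $T_4$ denotes the tetrahedron; $T_4\# T_4\# T_4$ is unique up to combinatorial equivalence. **Proposition.**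 Let $P_1,\dots,P_\ell$ be irreducible simplicial $3$-polytopes, $\ell\ge 3$, and let $P$ be an (iterated) connected sum of $P_1,\dots,P_\ell$, in any order, with any bracketing, and with any choices of facets and of identifications of their vertices. If $P\ne T_4\# T_4\# T_4$, then $P$ is not combinatorially rigid. -/

import Mathlib

/-- `S` is the vertex set of a face of the polytope `conv {v i}`: some linear inequality `l x ≤ c`
is valid on the polytope, and `S` is the set of vertices at which it is an equality.
(The choices `l = 0, c = 1` and `l = 0, c = 0` give the empty face and the whole polytope.) -/
def IsPolytopeFace {d n : ℕ} (v : Fin n → (Fin d → ℝ)) (S : Finset (Fin n)) : Prop :=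
  ∃ (l : (Fin d → ℝ) →ₗ[ℝ] ℝ) (c : ℝ), (∀ i, l (v i) ≤ c) ∧ ∀ i, i ∈ S ↔ l (v i) = c

/-- A `d`-dimensional simplicial polytope in `ℝ^d`, i.e. the convex hull of the `n` points
`vertex i`, which are its vertices (no one is in the convex hull of the others), enumerated in some
order. It is full-dimensional, and each of its proper faces is a simplex. -/
structure SimplicialPolytope (d : ℕ) where
  n : ℕ
  vertex : Fin n → (Fin d → ℝ)
  convexIndependent : ConvexIndependent ℝ vertex
  affineSpan_eq_top : affineSpan ℝ (Set.range vertex) = ⊤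
  simplicial : ∀ S : Finset (Fin n), IsPolytopeFace vertex S → S ≠ Finset.univ →
    AffineIndependent ℝ (fun i : S => vertex i)

/-! ### Reduced simplicial homology of a finite complex, through oriented chains

A complex is given by its set `Δ` of faces, the empty face included. -/

section Homology

/-- The set `{F ∩ W : F ∈ Δ}`. -/
def restrictComplex {V : Type*} [DecidableEq V] (Δ : Set (Finset V)) (W : Finset V) :
    Set (Finset V) :=
  {G | ∃ F ∈ Δ, F ∩ W = G}

/-- The `k`-dimensional faces, `k ≥ -1`; the empty face has dimension `-1`. -/
def facesOfDim {V : Type*} (Δ : Set (Finset V)) (k : ℤ) : Set (Finset V) :=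
  {F | F ∈ Δ ∧ (F.card : ℤ) = k + 1}

/-- `K`-linear combinations of the `k`-dimensional faces, written as functions of the face. -/
abbrev SimplicialChain (K : Type*) [Field K] {V : Type*} (Δ : Set (Finset V)) (k : ℤ) : Type _ :=
  facesOfDim Δ k → K

open Classical in
/-- The simplicial boundary map `C_k → C_l`, which is of interest for `l = k - 1` (for all other
`l` it is zero): a face `{v_0 < ⋯ < v_k}` is sent to the sum over `p` of `(-1)^p` times the face
without `v_p`. So the coefficient of `∂ c` at a face `G` is the sum of the coefficients of `c` at
the faces `G ∪ {v}` with `v ∉ G`, with sign `(-1)^p` if `p` elements of `G` come before `v`. -/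
noncomputable def simplicialBoundary (K : Type*) [Field K] {V : Type*} [Fintype V] [LinearOrder V]
    (Δ : Set (Finset V)) (k l : ℤ) : SimplicialChain K Δ k →ₗ[K] SimplicialChain K Δ l :=
  LinearMap.pi fun G : facesOfDim Δ l =>
    ∑ v ∈ Finset.univ \ G.1, if h : insert v G.1 ∈ facesOfDim Δ k then
      ((-1 : K) ^ (G.1.filter (· < v)).card) • LinearMap.proj ⟨insert v G.1, h⟩ else 0

/-- The `k`-cycles. -/
noncomputable def simplicialCycles (K : Type*) [Field K] {V : Type*} [Fintype V] [LinearOrder V]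
    (Δ : Set (Finset V)) (k : ℤ) : Submodule K (SimplicialChain K Δ k) :=
  LinearMap.ker (simplicialBoundary K Δ k (k - 1))

/-- The `k`-boundaries. -/
noncomputable def simplicialBoundaries (K : Type*) [Field K] {V : Type*} [Fintype V] [LinearOrder V]
    (Δ : Set (Finset V)) (k : ℤ) : Submodule K (SimplicialChain K Δ k) :=
  LinearMap.range (simplicialBoundary K Δ (k + 1) k)

/-- The reduced simplicial homology of `Δ` in degree `k`: cycles modulo boundaries. -/
abbrev ReducedHomology (K : Type*) [Field K] {V : Type*} [Fintype V] [LinearOrder V]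
    (Δ : Set (Finset V)) (k : ℤ) : Type _ :=
  simplicialCycles K Δ k ⧸ (simplicialBoundaries K Δ k).submoduleOf (simplicialCycles K Δ k)

end Homology

namespace SimplicialPolytope

/-- The boundary complex: vertex sets of the proper faces, the empty one included. -/
def boundaryComplex {d : ℕ} (P : SimplicialPolytope d) : Set (Finset (Fin P.n)) :=
  {S | IsPolytopeFace P.vertex S ∧ S ≠ Finset.univ}

/-- The vertex sets of the facets, i.e. of the faces of dimension `d - 1`. -/
def facets {d : ℕ} (P : SimplicialPolytope d) : Set (Finset (Fin P.n)) :=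
  {S | S ∈ P.boundaryComplex ∧ S.card = d}

/-- Combinatorial equivalence: the boundary complexes are isomorphic. -/
def Iso {d e : ℕ} (P : SimplicialPolytope d) (Q : SimplicialPolytope e) : Prop :=
  ∃ f : Fin P.n ≃ Fin Q.n, ∀ S : Finset (Fin P.n),
    S ∈ P.boundaryComplex ↔ S.map f.toEmbedding ∈ Q.boundaryComplex

/-- The graded Betti number `β_{i,j}(P)` over `K`, by Hochster's formula. -/
noncomputable def gradedBetti (K : Type*) [Field K] {d : ℕ} (P : SimplicialPolytope d)
    (i j : ℕ) : ℕ :=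
  ∑ W ∈ (Finset.univ : Finset (Fin P.n)).powersetCard j,
    Module.finrank K (ReducedHomology K (restrictComplex P.boundaryComplex W) ((j : ℤ) - i - 1))

/-- `P` is combinatorially rigid: every simplicial polytope, of any dimension, with the same graded
Betti numbers is combinatorially equivalent to `P`. -/
def IsRigid (K : Type*) [Field K] {d : ℕ} (P : SimplicialPolytope d) : Prop :=
  ∀ (e : ℕ) (Q : SimplicialPolytope e),
    (∀ i j : ℕ, gradedBetti K P i j = gradedBetti K Q i j) → P.Iso Q

/-- `P` is, up to combinatorial equivalence, a connected sum of `P₁` and `P₂` (for `d ≥ 2`): it is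
obtained from them by attaching a facet `F₁` of `P₁` to a facet `F₂` of `P₂` along some
identification of their vertices. The maps `f₁`, `f₂` place the vertices of `P₁`, `P₂` in `P`; the
attached facets become one set of vertices, which is not a face any more, all others survive. -/
def IsConnectedSum {d : ℕ} (P₁ P₂ P : SimplicialPolytope d) : Prop :=
  ∃ (f₁ : Fin P₁.n ↪ Fin P.n) (f₂ : Fin P₂.n ↪ Fin P.n),
    ∃ F₁ ∈ P₁.facets, ∃ F₂ ∈ P₂.facets,
      F₁.map f₁ = F₂.map f₂ ∧
      Finset.univ.map f₁ ∩ Finset.univ.map f₂ = F₁.map f₁ ∧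
      Finset.univ.map f₁ ∪ Finset.univ.map f₂ = Finset.univ ∧
      ∀ S : Finset (Fin P.n), S ∈ P.boundaryComplex ↔
        (∃ T ∈ P₁.boundaryComplex, T ≠ F₁ ∧ T.map f₁ = S) ∨
        (∃ T ∈ P₂.boundaryComplex, T ≠ F₂ ∧ T.map f₂ = S)

/-- `P` is not a connected sum of two simplicial polytopes. -/
def IsIrreducible {d : ℕ} (P : SimplicialPolytope d) : Prop :=
  ¬ ∃ P₁ P₂ : SimplicialPolytope d, IsConnectedSum P₁ P₂ P

/-- `P` is, up to combinatorial equivalence, an iterated connected sum `P₁ # ⋯ # P_ℓ` of the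
members of the multiset `{P₁, …, P_ℓ}`, in some order, with some bracketing, and with some choices
of facets and of identifications of their vertices. -/
inductive IsIteratedConnectedSum {d : ℕ} :
    Multiset (SimplicialPolytope d) → SimplicialPolytope d → Prop
  | single {Q P : SimplicialPolytope d} (h : Q.Iso P) : IsIteratedConnectedSum {Q} P
  | sum {s t : Multiset (SimplicialPolytope d)} {A B P : SimplicialPolytope d}
      (hA : IsIteratedConnectedSum s A) (hB : IsIteratedConnectedSum t B)
      (hP : IsConnectedSum A B P) : IsIteratedConnectedSum (s + t) P

end SimplicialPolytope

/-- The vertices of a regular tetrahedron. -/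
def tetrahedronVertex : Fin 4 → (Fin 3 → ℝ) :=
  ![![1, 1, 1], ![1, -1, -1], ![-1, 1, -1], ![-1, -1, 1]]

theorem affineIndependent_tetrahedronVertex : AffineIndependent ℝ tetrahedronVertex := by
  rw [affineIndependent_iff_of_fintype]
  intro w hw h
  rw [Finset.weightedVSub_eq_linear_combination Finset.univ hw] at h
  have h0 := congrFun h 0
  have h1 := congrFun h 1
  have h2 := congrFun h 2
  simp [Fin.sum_univ_four, tetrahedronVertex] at hw h0 h1 h2
  intro i
  fin_cases i <;> simp <;> linarith

theorem convexIndependent_tetrahedronVertex : ConvexIndependent ℝ tetrahedronVertex :=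
  fun s x hx => (affineIndependent_tetrahedronVertex.mem_affineSpan_iff x s).1
    (convexHull_subset_affineSpan _ hx)

/-- The tetrahedron `T₄`. -/
def tetrahedron : SimplicialPolytope 3 where
  n := 4
  vertex := tetrahedronVertex
  convexIndependent := convexIndependent_tetrahedronVertex
  affineSpan_eq_top := by
    rw [affineIndependent_tetrahedronVertex.affineSpan_eq_top_iff_card_eq_finrank_add_one]
    simp
  simplicial := fun S _ _ =>
    affineIndependent_tetrahedronVertex.comp_embedding (Function.Embedding.subtype (· ∈ S))

/-! Fix the summands and vary the way they are glued. The graded Betti numbers do not notice the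
gluing, but the sum of the squared vertex degrees does. If `P` is rigid, all iterated connected sums
of the same summands are equivalent, so they share this degree sum, and that leaves only three
tetrahedra.

Betti numbers. By rank-nullity, the dimension of the reduced homology of an induced subcomplex on
`W` is a combination of face counts and ranks of boundary maps. The boundary of `P` is a strongly
connected, coherently oriented pseudomanifold, so there are no nonzero 2-cycles on a proper `W` and
exactly one, up to scalars, on the full vertex set. The rank of the edge boundary is the number of
vertices minus the dimension of the space of functions constant along the edges in `W`. Face counts
and this dimension are additive under gluing, up to a correction that depends only on the part of
`W` in the glued triangle. Weighting `W` by `x ^ |W|` and dividing by `(1 + x) ^ (n - 3)` turns them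
into additive invariants of the whole polytope; this gives
`gradedBetti_eq_of_isIteratedConnectedSum`.

Realization. The argument needs every facet and every identification of vertices to be available. A
projective transformation places each polytope as a roof over a standard triangle, and the second
roof is reflected below the first (`exists_isGluing`). Cones over polytopes make projective
transformations linear.

Degrees. Identified vertices of degrees `p`, `q` acquire degree `p + q - 2`. Exchanging two
identifications changes the sum of squares by twice a product of degree differences, so two
polytopes that are both not degree-regular have sums that differ
(`exists_isConnectedSum_degreeSq_ne`). Any two polytopes have a connected sum that is not
degree-regular. Hence four or more summands can be split into two irregular halves, and among three
summands each must be regular. In that case attaching the third to different facets of the sum of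
the other two shows that all facets there have equal degree sum, which forces each summand to have
four vertices (`card_eq_three_and_n_eq_four`). -/

section Cone

/-! ### Faces, ridges and strong connectedness of a simplicial cone. -/

variable {E : Type*} [AddCommGroup E] [Module ℝ E] {ι : Type*}

/-- `S` is the set of those generators of the cone spanned by the `u i` that lie on a face. -/
def IsConeFace (u : ι → E) (S : Finset ι) : Prop :=
  ∃ φ : E →ₗ[ℝ] ℝ, (∀ i, φ (u i) ≤ 0) ∧ ∀ i, i ∈ S ↔ φ (u i) = 0

/-- The `u i` generate the extreme rays of a four-dimensional cone whose proper faces are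
simplicial. -/
structure IsSimplicialCone [Fintype ι] (u : ι → E) : Prop where
  finrank_eq : Module.finrank ℝ E = 4
  span_eq_top : Submodule.span ℝ (Set.range u) = ⊤
  isConeFace_singleton : ∀ i, IsConeFace u {i}
  linearIndependent : ∀ S : Finset ι, IsConeFace u S → S ≠ Finset.univ →
    LinearIndependent ℝ (fun i : S => u i)

theorem exists_linearMap_eq_on {u : ι → E} {S : Finset ι}
    (h : LinearIndependent ℝ (fun i : S => u i)) (g : ι → ℝ) :
    ∃ ψ : E →ₗ[ℝ] ℝ, ∀ i ∈ S, ψ (u i) = g i := by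
  obtain ⟨ψ, hψ⟩ := LinearMap.exists_extend ((Module.Basis.span h).constr ℝ fun i : S => g i)
  refine ⟨ψ, fun i hi => ?_⟩
  have h1 := LinearMap.congr_fun hψ (Module.Basis.span h ⟨i, hi⟩)
  rw [Module.Basis.constr_basis] at h1
  simpa [Module.Basis.span_apply] using h1

/-- Perturb a large multiple of the functional of `S` by one that is `0` on `T` and `-1` on the rest
of `S`; off `S` the large multiple wins. -/
theorem IsConeFace.mono [Finite ι] {u : ι → E} {S T : Finset ι} (hS : IsConeFace u S)
    (hli : LinearIndependent ℝ (fun i : S => u i)) (hTS : T ⊆ S) : IsConeFace u T := by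
  classical
  obtain ⟨φ, hφ, hφS⟩ := hS
  obtain ⟨ψ, hψ⟩ := exists_linearMap_eq_on hli fun i => if i ∈ T then 0 else -1
  have hev : ∀ᶠ N : ℝ in Filter.atTop, ∀ i, i ∉ S → N * φ (u i) + ψ (u i) < 0 := by
    rw [Filter.eventually_all]
    intro i
    by_cases hi : i ∈ S
    · exact Filter.Eventually.of_forall fun N h => absurd hi h
    · have hneg : 0 < -φ (u i) := by
        have := lt_of_le_of_ne (hφ i) (fun h => hi ((hφS i).2 h))
        linarith
      filter_upwards [Filter.eventually_gt_atTop (ψ (u i) / -φ (u i))] with N hN _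
      rw [div_lt_iff₀ hneg] at hN
      linarith
  obtain ⟨N, hN⟩ := hev.exists
  have key : ∀ i, i ∈ S → (N • φ + ψ) (u i) = if i ∈ T then 0 else -1 := by
    intro i hi
    simp [(hφS i).1 hi, hψ i hi]
  refine ⟨N • φ + ψ, fun i => ?_, fun i => ?_⟩
  · by_cases hi : i ∈ S
    · rw [key i hi]
      split_ifs <;> norm_num
    · simpa using (hN i hi).le
  · by_cases hi : i ∈ S
    · rw [key i hi]
      split_ifs with h <;> simp [h]
    · have := hN i hi
      simp only [LinearMap.add_apply, LinearMap.smul_apply, smul_eq_mul]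
      exact ⟨fun h => absurd (hTS h) hi, fun h => absurd h this.ne⟩

/-- Tilting the supporting functional `φ` in the direction `ψ` until a new generator is hit. -/
theorem exists_pivot [Finite ι] {u : ι → E} {φ ψ : E →ₗ[ℝ] ℝ} (hφ : ∀ i, φ (u i) ≤ 0)
    (hψ : ∀ i, φ (u i) = 0 → ψ (u i) ≤ 0) (hpos : ∃ i, 0 < ψ (u i)) :
    ∃ t : ℝ, 0 < t ∧ (∀ i, φ (u i) + t * ψ (u i) ≤ 0) ∧
      ∃ i, 0 < ψ (u i) ∧ φ (u i) + t * ψ (u i) = 0 := by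
  classical
  have := Fintype.ofFinite ι
  obtain ⟨i₀, hi₀⟩ := hpos
  -- The ratio test of the simplex method finds the first generator that blocks the tilting.
  obtain ⟨j, hj, hmin⟩ := Finset.exists_min_image
    (Finset.univ.filter fun i => 0 < ψ (u i)) (fun i => -φ (u i) / ψ (u i)) ⟨i₀, by simpa⟩
  simp only [Finset.mem_filter, Finset.mem_univ, true_and] at hj hmin
  have hneg : φ (u j) < 0 := lt_of_le_of_ne (hφ j) fun h => absurd (hψ j h) (not_le.2 hj)
  have ht : 0 < -φ (u j) / ψ (u j) := div_pos (by linarith) hj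
  refine ⟨-φ (u j) / ψ (u j), ht, fun i => ?_, j, hj, by field_simp; ring⟩
  rcases le_or_gt (ψ (u i)) 0 with hi | hi
  · have := mul_nonpos_of_nonneg_of_nonpos ht.le hi
    linarith [hφ i]
  · have := (le_div_iff₀ hi).1 (hmin i hi)
    linarith

namespace IsSimplicialCone

variable [Fintype ι] {u : ι → E}

theorem finiteDimensional (hu : IsSimplicialCone u) : FiniteDimensional ℝ E :=
  FiniteDimensional.of_finrank_pos (by rw [hu.finrank_eq]; norm_num)

theorem linearMap_ext (hu : IsSimplicialCone u) {φ ψ : E →ₗ[ℝ] ℝ} (h : ∀ i, φ (u i) = ψ (u i)) :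
    φ = ψ :=
  LinearMap.ext_on_range hu.span_eq_top h

theorem mono (hu : IsSimplicialCone u) {S T : Finset ι} (hS : IsConeFace u S)
    (hne : S ≠ Finset.univ) (hTS : T ⊆ S) : IsConeFace u T :=
  hS.mono (hu.linearIndependent S hS hne) hTS

theorem four_le_card (hu : IsSimplicialCone u) : 4 ≤ Fintype.card ι := by
  have := finrank_range_le_card (R := ℝ) u
  rwa [Set.finrank, hu.span_eq_top, finrank_top, hu.finrank_eq] at this

theorem card_le_three (hu : IsSimplicialCone u) {S : Finset ι} (hS : IsConeFace u S)
    (hne : S ≠ Finset.univ) : S.card ≤ 3 := by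
  have := hu.finiteDimensional
  have hli := hu.linearIndependent S hS hne
  obtain ⟨φ, hφ, hφS⟩ := hS
  have hφ0 : φ ≠ 0 := fun h => hne (by ext i; simp [hφS i, h])
  have h1 := Module.Dual.finrank_ker_add_one_of_ne_zero (f := φ) hφ0
  rw [hu.finrank_eq] at h1
  have hli' : LinearIndependent ℝ
      (fun i : S => (⟨u i, LinearMap.mem_ker.2 ((hφS i).1 i.2)⟩ : LinearMap.ker φ)) :=
    LinearIndependent.of_comp (LinearMap.ker φ).subtype hli
  have := hli'.fintype_card_le_finrank
  rw [Fintype.card_coe] at this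
  omega

theorem ne_univ (hu : IsSimplicialCone u) {S : Finset ι} (h : S.card ≤ 3) : S ≠ Finset.univ := by
  rintro rfl
  have := hu.four_le_card
  rw [Finset.card_univ] at h
  omega

/-- With fewer than three generators in `S`, adding one generator `i` off the face still leaves a
proper subspace. Tilting by a functional that vanishes on it keeps `S`, gains a new generator, and
cannot reach `i`, so the larger face is again proper. -/
theorem exists_ssubset_face (hu : IsSimplicialCone u) {S : Finset ι} (hS : IsConeFace u S)
    (hne : S ≠ Finset.univ) (hcard : S.card < 3) :
    ∃ T, IsConeFace u T ∧ T ≠ Finset.univ ∧ S ⊂ T := by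
  classical
  have := hu.finiteDimensional
  obtain ⟨φ, hφ, hφS⟩ := hS
  obtain ⟨i, hi⟩ : ∃ i, i ∉ S := by
    by_contra! h
    exact hne (Finset.eq_univ_iff_forall.2 h)
  have hlt : Submodule.span ℝ (((insert i S).image u : Finset E) : Set E) < ⊤ := by
    refine lt_top_iff_ne_top.2 fun h => ?_
    have h1 := finrank_span_finset_le_card (R := ℝ) ((insert i S).image u)
    rw [Set.finrank, h, finrank_top, hu.finrank_eq] at h1
    have h2 := Finset.card_image_le (s := insert i S) (f := u)
    have h3 := Finset.card_insert_le i S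
    omega
  obtain ⟨ψ₀, hψ₀, hker₀⟩ := Submodule.exists_le_ker_of_lt_top _ hlt
  obtain ⟨ψ, hker, hpos⟩ : ∃ ψ : E →ₗ[ℝ] ℝ, (∀ j ∈ insert i S, ψ (u j) = 0) ∧
      ∃ j, 0 < ψ (u j) := by
    have hz : ∀ j ∈ insert i S, ψ₀ (u j) = 0 := fun j hj =>
      LinearMap.mem_ker.1 (hker₀ (Submodule.subset_span (by
        simpa using Finset.mem_image_of_mem u hj)))
    obtain ⟨j, hj⟩ : ∃ j, ψ₀ (u j) ≠ 0 := by
      by_contra! h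
      exact hψ₀ (hu.linearMap_ext (by simpa using h))
    rcases lt_or_gt_of_ne hj with h | h
    · exact ⟨-ψ₀, fun j hj => by simp [hz j hj], j, by simpa using h⟩
    · exact ⟨ψ₀, hz, j, h⟩
  obtain ⟨t, ht, hle, j, hj, hj0⟩ := exists_pivot hφ
    (fun j hj => (hker j (Finset.mem_insert_of_mem ((hφS j).2 hj))).le) hpos
  refine ⟨Finset.univ.filter fun k => φ (u k) + t * ψ (u k) = 0,
    ⟨φ + t • ψ, fun k => by simpa using hle k, fun k => by simp⟩, fun h => ?_, ?_⟩
  · have := (Finset.mem_filter.1 (h ▸ Finset.mem_univ i)).2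
    rw [hker i (Finset.mem_insert_self i S), mul_zero, add_zero] at this
    exact hi ((hφS i).2 this)
  · refine (Finset.ssubset_iff_of_subset fun k hk => ?_).2 ⟨j, by simpa using hj0, fun h => ?_⟩
    · simp [(hφS k).1 hk, hker k (Finset.mem_insert_of_mem hk)]
    · rw [hker j (Finset.mem_insert_of_mem h)] at hj
      exact lt_irrefl _ hj

/-- The sets of generators of the facets. -/
def _root_.IsConeFacet (u : ι → E) (H : Finset ι) : Prop :=
  IsConeFace u H ∧ H ≠ Finset.univ ∧ H.card = 3

theorem exists_facet (hu : IsSimplicialCone u) {S : Finset ι} (hS : IsConeFace u S)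
    (hne : S ≠ Finset.univ) : ∃ H, IsConeFacet u H ∧ S ⊆ H := by
  induction hk : 3 - S.card using Nat.strong_induction_on generalizing S with
  | _ k ih =>
    rcases (hu.card_le_three hS hne).eq_or_lt with h | h
    · exact ⟨S, ⟨hS, hne, h⟩, subset_rfl⟩
    · obtain ⟨T, hT, hTne, hST⟩ := hu.exists_ssubset_face hS hne h
      obtain ⟨H, hH, hTH⟩ := ih _ (by have := Finset.card_lt_card hST; omega) hT hTne rfl
      exact ⟨H, hH, hST.1.trans hTH⟩

/-- A facet has a unique supporting functional that is `-1` at the sum of the generators. -/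
theorem exists_normalized (_hu : IsSimplicialCone u) {S : Finset ι} (hS : IsConeFace u S)
    (hne : S ≠ Finset.univ) : ∃ φ : E →ₗ[ℝ] ℝ, (∀ i, φ (u i) ≤ 0) ∧ (∀ i, i ∈ S ↔ φ (u i) = 0) ∧
      φ (∑ i, u i) = -1 := by
  obtain ⟨φ, hφ, hφS⟩ := hS
  obtain ⟨i, hi⟩ : ∃ i, i ∉ S := by
    by_contra! h
    exact hne (Finset.eq_univ_iff_forall.2 h)
  have hneg : φ (∑ i, u i) < 0 := by
    rw [map_sum]
    exact Finset.sum_neg' (fun i _ => hφ i)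
      ⟨i, Finset.mem_univ i, lt_of_le_of_ne (hφ i) fun h => hi ((hφS i).2 h)⟩
  have hp : 0 < (-φ (∑ i, u i))⁻¹ := inv_pos.2 (by linarith)
  refine ⟨(-φ (∑ i, u i))⁻¹ • φ, fun i => ?_, fun i => ?_, ?_⟩
  · exact mul_nonpos_of_nonneg_of_nonpos hp.le (hφ i)
  · rw [hφS i, LinearMap.smul_apply, smul_eq_mul, mul_eq_zero]
    exact ⟨Or.inr, fun h => h.resolve_left hp.ne'⟩
  · rw [LinearMap.smul_apply, smul_eq_mul, inv_neg, neg_mul, inv_mul_cancel₀ hneg.ne]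

/-- The three generators of a facet span the kernel of `φ`, a hyperplane, and the sum of all
generators spans a complement. -/
theorem eq_smul_of_vanish (hu : IsSimplicialCone u) {H : Finset ι} (hH : IsConeFacet u H)
    {φ ψ : E →ₗ[ℝ] ℝ} (hφ : ∀ i ∈ H, φ (u i) = 0) (hn : φ (∑ i, u i) = -1)
    (hψ : ∀ i ∈ H, ψ (u i) = 0) : ψ = (-ψ (∑ i, u i)) • φ := by
  have := hu.finiteDimensional
  have hli := hu.linearIndependent H hH.1 hH.2.1
  have hφ0 : φ ≠ 0 := fun h => by simp [h] at hn
  have h1 := Module.Dual.finrank_ker_add_one_of_ne_zero (f := φ) hφ0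
  rw [hu.finrank_eq] at h1
  have hle : ∀ χ : E →ₗ[ℝ] ℝ, (∀ i ∈ H, χ (u i) = 0) →
      Submodule.span ℝ (Set.range fun i : H => u i) ≤ LinearMap.ker χ := fun χ hχ =>
    Submodule.span_le.2 (by rintro _ ⟨i, rfl⟩; exact hχ i i.2)
  have heq : Submodule.span ℝ (Set.range fun i : H => u i) = LinearMap.ker φ := by
    refine Submodule.eq_of_le_of_finrank_eq (hle φ hφ) ?_
    rw [finrank_span_eq_card hli, Fintype.card_coe, hH.2.2]
    omega
  ext e
  have h2 : e + φ e • ∑ i, u i ∈ LinearMap.ker φ := by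
    rw [LinearMap.mem_ker, map_add, map_smul, hn]
    simp
  rw [← heq] at h2
  have h3 := LinearMap.mem_ker.1 (hle ψ hψ h2)
  rw [map_add, map_smul, smul_eq_mul] at h3
  rw [LinearMap.smul_apply, smul_eq_mul]
  linarith

theorem eq_zero_of_vanish (hu : IsSimplicialCone u) {H : Finset ι} (hH : IsConeFacet u H)
    {ψ : E →ₗ[ℝ] ℝ} (hψ : ∀ i ∈ H, ψ (u i) = 0) (hψ0 : ψ (∑ i, u i) = 0) : ψ = 0 := by
  obtain ⟨φ, -, hφ, hn⟩ := hu.exists_normalized hH.1 hH.2.1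
  rw [hu.eq_smul_of_vanish hH (fun i hi => (hφ i).1 hi) hn hψ, hψ0]
  simp

/-- The generators of a facet together with the interior vector `∑ i, u i` form a basis; vanishing
at the latter means that adding `ψ` preserves the normalization of facet functionals. -/
theorem exists_dual (hu : IsSimplicialCone u) {H : Finset ι} (hH : IsConeFacet u H) (g : ι → ℝ) :
    ∃ ψ : E →ₗ[ℝ] ℝ, (∀ i ∈ H, ψ (u i) = g i) ∧ ψ (∑ i, u i) = 0 := by
  obtain ⟨φ, -, hφ, hn⟩ := hu.exists_normalized hH.1 hH.2.1
  obtain ⟨ψ, hψ⟩ := exists_linearMap_eq_on (hu.linearIndependent H hH.1 hH.2.1) g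
  refine ⟨ψ + ψ (∑ i, u i) • φ, fun i hi => ?_, ?_⟩
  · simp [hψ i hi, (hφ i).1 hi]
  · rw [LinearMap.add_apply, LinearMap.smul_apply, hn]
    simp

/-- The facet on the other side of the ridge `H \ {x}`. -/
theorem exists_adjacent [DecidableEq ι] (hu : IsSimplicialCone u) {H : Finset ι}
    (hH : IsConeFacet u H)
    {φ : E →ₗ[ℝ] ℝ} (hφ : ∀ i, φ (u i) ≤ 0) (hφH : ∀ i, i ∈ H ↔ φ (u i) = 0)
    (hn : φ (∑ i, u i) = -1) {x : ι} (hx : x ∈ H) {ψ : E →ₗ[ℝ] ℝ} (hψx : ψ (u x) = -1)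
    (hψ : ∀ i ∈ H, i ≠ x → ψ (u i) = 0) (hψ0 : ψ (∑ i, u i) = 0) :
    ∃ t : ℝ, 0 < t ∧ ∃ y, y ∉ H ∧ 0 < ψ (u y) ∧ IsConeFacet u (insert y (H.erase x)) ∧
      (∀ i, (φ + t • ψ) (u i) ≤ 0) ∧
      (∀ i, i ∈ insert y (H.erase x) ↔ (φ + t • ψ) (u i) = 0) := by
  -- The values of `ψ` at the generators sum to zero, and the one at `x` is negative.
  have hpos : ∃ i, 0 < ψ (u i) := by
    by_contra! h
    rw [map_sum] at hψ0
    have := (Finset.sum_eq_zero_iff_of_nonpos fun i _ => h i).1 hψ0 x (Finset.mem_univ x)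
    linarith
  have hψH : ∀ i, φ (u i) = 0 → ψ (u i) ≤ 0 := by
    intro i hi
    by_cases h : i = x
    · rw [h, hψx]; norm_num
    · exact (hψ i ((hφH i).2 hi) h).le
  obtain ⟨t, ht, hle, y, hy, hy0⟩ := exists_pivot hφ hψH hpos
  have hyH : y ∉ H := fun h => absurd (hψH y ((hφH y).1 h)) (not_le.2 hy)
  set Z := Finset.univ.filter fun i => φ (u i) + t * ψ (u i) = 0 with hZ
  have hZface : IsConeFace u Z := ⟨φ + t • ψ, fun k => by simpa using hle k, fun k => by simp [hZ]⟩
  have hZne : Z ≠ Finset.univ := by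
    intro h
    have h0 : φ + t • ψ = 0 := hu.linearMap_ext fun i => by
      have h2 : i ∈ Z := by rw [h]; exact Finset.mem_univ i
      simpa using (Finset.mem_filter.1 h2).2
    have := LinearMap.congr_fun h0 (∑ i, u i)
    rw [LinearMap.add_apply, LinearMap.smul_apply, hn, hψ0] at this
    norm_num at this
  have hsub : insert y (H.erase x) ⊆ Z := by
    intro i hi
    rw [Finset.mem_insert, Finset.mem_erase] at hi
    rcases hi with rfl | ⟨h1, h2⟩
    · simpa [hZ] using hy0
    · simp [hZ, (hφH i).1 h2, hψ i h2 h1]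
  have hcard : (insert y (H.erase x)).card = 3 := by
    rw [Finset.card_insert_of_notMem (fun h => hyH (Finset.mem_of_mem_erase h)),
      Finset.card_erase_of_mem hx, hH.2.2]
  have hZeq : insert y (H.erase x) = Z :=
    Finset.eq_of_subset_of_card_le hsub (by rw [hcard]; exact hu.card_le_three hZface hZne)
  refine ⟨t, ht, y, hyH, hy, ?_, fun i => by simpa using hle i, fun i => ?_⟩
  · rw [hZeq]
    exact ⟨hZface, hZne, hZeq ▸ hcard⟩
  · rw [hZeq]
    simp [hZ]

/-- Normalized functionals vanishing on a ridge form a line through `φ` in direction `ψ`; the value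
at `x` is the parameter. -/
theorem adjacent_functional [DecidableEq ι] (hu : IsSimplicialCone u) {H : Finset ι}
    (hH : IsConeFacet u H) {φ : E →ₗ[ℝ] ℝ} (hφH : ∀ i, i ∈ H ↔ φ (u i) = 0)
    (hn : φ (∑ i, u i) = -1) {x : ι} (hx : x ∈ H) {ψ : E →ₗ[ℝ] ℝ} (hψx : ψ (u x) = -1)
    (hψ : ∀ i ∈ H, i ≠ x → ψ (u i) = 0) (hψ0 : ψ (∑ i, u i) = 0) {φ' : E →ₗ[ℝ] ℝ}
    (hφ' : ∀ i ∈ H, i ≠ x → φ' (u i) = 0) (hn' : φ' (∑ i, u i) = -1) :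
    φ' = φ + (-φ' (u x)) • ψ := by
  have := hu.eq_zero_of_vanish hH (ψ := φ' - φ + φ' (u x) • ψ) (fun i hi => ?_) ?_
  · ext e
    have h := LinearMap.congr_fun this e
    simp only [LinearMap.add_apply, LinearMap.sub_apply, LinearMap.smul_apply, smul_eq_mul,
      LinearMap.zero_apply] at h ⊢
    linarith
  · by_cases h : i = x
    · subst h
      simp [hψx, (hφH i).1 hx]
    · simp [hφ' i hi h, (hφH i).1 hi, hψ i hi h]
  · rw [LinearMap.add_apply, LinearMap.sub_apply, LinearMap.smul_apply, hn, hn', hψ0]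
    simp

/-- Two facets beyond the same ridge have functionals `φ + t • ψ` and `φ + c • ψ`. Each one is
nonpositive at the new generator of the other, where the other one vanishes, so `t = c`. -/
theorem adjacent_pos_and_unique [DecidableEq ι] (hu : IsSimplicialCone u) {H : Finset ι}
    (hH : IsConeFacet u H) {x : ι} (hx : x ∈ H) {ψ : E →ₗ[ℝ] ℝ} (hψx : ψ (u x) = -1)
    (hψ : ∀ i ∈ H, i ≠ x → ψ (u i) = 0) (hψ0 : ψ (∑ i, u i) = 0) :
    ∃ y, y ∉ H ∧ IsConeFacet u (insert y (H.erase x)) ∧ 0 < ψ (u y) ∧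
      ∀ z, z ∉ H → IsConeFacet u (insert z (H.erase x)) → z = y := by
  obtain ⟨φ, hφ, hφH, hn⟩ := hu.exists_normalized hH.1 hH.2.1
  obtain ⟨t, ht, y, hyH, hy, hfac, hle, hzero⟩ :=
    hu.exists_adjacent hH hφ hφH hn hx hψx hψ hψ0
  refine ⟨y, hyH, hfac, hy, fun z hz hzfac => ?_⟩
  obtain ⟨φ', hφ', hφH', hn'⟩ := hu.exists_normalized hzfac.1 hzfac.2.1
  have heq := hu.adjacent_functional hH hφH hn hx hψx hψ hψ0 (φ' := φ')
    (fun i hi h => (hφH' i).1 (by simp [h, hi])) hn'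
  set c := -φ' (u x) with hc
  have hx' : x ∉ insert z (H.erase x) := by
    simp only [Finset.mem_insert, Finset.mem_erase, ne_eq, not_true_eq_false, false_and, or_false]
    rintro rfl
    exact hz hx
  have hcpos : 0 < c := by
    have := lt_of_le_of_ne (hφ' x) fun h => hx' ((hφH' x).2 h)
    linarith
  have hz0 : φ (u z) + c * ψ (u z) = 0 := by
    have := (hφH' z).1 (Finset.mem_insert_self _ _)
    rw [heq] at this
    simpa using this
  have hzneg : φ (u z) < 0 := lt_of_le_of_ne (hφ z) fun h => hz ((hφH z).2 h)
  have hzpos : 0 < ψ (u z) := by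
    by_contra! h
    have := mul_nonpos_of_nonneg_of_nonpos hcpos.le h
    linarith
  have h1 : φ (u z) + t * ψ (u z) ≤ 0 := by simpa using hle z
  have h2 : φ (u y) + c * ψ (u y) ≤ 0 := by
    have := hφ' y
    rw [heq] at this
    simpa using this
  have h3 : φ (u y) + t * ψ (u y) = 0 := by
    simpa using (hzero y).1 (Finset.mem_insert_self _ _)
  have h4 : t ≤ c := le_of_mul_le_mul_right (by linarith) hzpos
  have h5 : c ≤ t := le_of_mul_le_mul_right (by linarith) hy
  have h6 : t = c := le_antisymm h4 h5
  have h7 : z ∈ insert y (H.erase x) := (hzero z).2 (by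
    rw [h6, ← heq]
    exact (hφH' z).1 (Finset.mem_insert_self _ _))
  rw [Finset.mem_insert] at h7
  exact h7.resolve_right fun h => hz (Finset.mem_of_mem_erase h)

theorem existsUnique_adjacent [DecidableEq ι] (hu : IsSimplicialCone u) {H : Finset ι}
    (hH : IsConeFacet u H) {x : ι} (hx : x ∈ H) :
    ∃ y, y ∉ H ∧ IsConeFacet u (insert y (H.erase x)) ∧
      ∀ z, z ∉ H → IsConeFacet u (insert z (H.erase x)) → z = y := by
  obtain ⟨ψ, hψ, hψ0⟩ := hu.exists_dual hH fun i => if i = x then -1 else 0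
  obtain ⟨y, h1, h2, -, h3⟩ := hu.adjacent_pos_and_unique hH hx (ψ := ψ) (by simp [hψ x hx])
    (fun i hi h => by simp [hψ i hi, h]) hψ0
  exact ⟨y, h1, h2, h3⟩

/-- Any two facets are joined by a path of facets, consecutive ones sharing a ridge. -/
theorem strongly_connected [DecidableEq ι] (hu : IsSimplicialCone u) (𝓢 : Set (Finset ι))
    (hfac : ∀ H ∈ 𝓢, IsConeFacet u H) (hne : 𝓢.Nonempty)
    (hcl : ∀ H ∈ 𝓢, ∀ x ∈ H, ∀ y, y ∉ H → IsConeFacet u (insert y (H.erase x)) →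
      insert y (H.erase x) ∈ 𝓢) {G : Finset ι} (hG : IsConeFacet u G) : G ∈ 𝓢 := by
  classical
  -- The simplex method with target `G`: among the facets in `𝓢`, maximize the normalized functional
  -- at the sum of the generators of `G`. The value is nonpositive, and it is zero only at `G`.
  choose f hf hfS hfn using fun H : {H // IsConeFacet u H} =>
    hu.exists_normalized H.2.1 H.2.2.1
  obtain ⟨H, hHS, hmax⟩ := Set.exists_max_image (α := {H // IsConeFacet u H}) {H | H.1 ∈ 𝓢}
    (fun H => f H (∑ g ∈ G, u g)) (Set.toFinite _)
    (by obtain ⟨H, hH⟩ := hne; exact ⟨⟨H, hfac H hH⟩, hH⟩)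
  have hval : ∀ K : {H // IsConeFacet u H}, f K (∑ g ∈ G, u g) ≤ 0 := fun K => by
    rw [map_sum]
    exact Finset.sum_nonpos fun i _ => hf K i
  by_cases h0 : f H (∑ g ∈ G, u g) = 0
  · rw [map_sum] at h0
    have hsub : G ⊆ H.1 := fun g hg =>
      (hfS H g).2 ((Finset.sum_eq_zero_iff_of_nonpos fun i _ => hf H i).1 h0 g hg)
    rw [Finset.eq_of_subset_of_card_le hsub (by rw [hG.2.2, H.2.2.2])]
    exact hHS
  · exfalso
    have hlt := lt_of_le_of_ne (hval H) h0
    choose ψ hψ hψ0 using fun x => hu.exists_dual H.2 fun i => if i = x then -1 else 0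
    let γ := f ⟨G, hG⟩
    -- The functional of `G` is that of `H` plus a nonnegative combination of the pivot directions.
    -- At the target point it vanishes while `f H` is negative, so some direction increases the
    -- objective there; crossing that ridge contradicts maximality.
    have hexp : γ - f H - ∑ x ∈ H.1, (-γ (u x)) • ψ x = 0 := by
      refine hu.eq_zero_of_vanish H.2 (fun i hi => ?_) ?_
      · have : ∀ x ∈ H.1, ((-γ (u x)) • ψ x) (u i) = if i = x then γ (u i) else 0 := by
          intro x _
          rw [LinearMap.smul_apply, hψ x i hi]
          split_ifs with h
          · simp [h]
          · simp
        rw [LinearMap.sub_apply, LinearMap.sub_apply, LinearMap.sum_apply,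
          Finset.sum_congr rfl this, (hfS H i).1 hi]
        simp [hi]
      · rw [LinearMap.sub_apply, LinearMap.sub_apply, LinearMap.sum_apply]
        simp only [LinearMap.smul_apply, hψ0, smul_zero, Finset.sum_const_zero]
        rw [hfn, hfn]
        simp
    have hγ0 : γ (∑ g ∈ G, u g) = 0 := by
      rw [map_sum]
      exact Finset.sum_eq_zero fun g hg => (hfS ⟨G, hG⟩ g).1 hg
    have h1 := LinearMap.congr_fun hexp (∑ g ∈ G, u g)
    rw [LinearMap.sub_apply, LinearMap.sub_apply, LinearMap.sum_apply, hγ0] at h1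
    obtain ⟨x, hx, hxpos⟩ : ∃ x ∈ H.1, 0 < ((-γ (u x)) • ψ x) (∑ g ∈ G, u g) := by
      by_contra! h
      have := Finset.sum_nonpos h
      rw [LinearMap.zero_apply] at h1
      linarith
    rw [LinearMap.smul_apply, smul_eq_mul] at hxpos
    have hψpos : 0 < ψ x (∑ g ∈ G, u g) := by
      by_contra! h
      have := mul_nonpos_of_nonneg_of_nonpos (neg_nonneg.2 (hf ⟨G, hG⟩ x)) h
      linarith
    obtain ⟨t, ht, y, hy, -, hfac', hle, hzero⟩ := hu.exists_adjacent H.2 (hf H) (hfS H) (hfn H) hx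
      (ψ := ψ x) (by simp [hψ x x hx]) (fun i hi h => by simp [hψ x i hi, h]) (hψ0 x)
    have hmem := hcl H.1 hHS x hx y hy hfac'
    have h2 := hmax ⟨_, hfac'⟩ hmem
    have hn2 : (f H + t • ψ x) (∑ i, u i) = -1 := by
      rw [LinearMap.add_apply, LinearMap.smul_apply, hfn, hψ0]
      simp
    have h3 := hu.eq_smul_of_vanish hfac' (φ := f H + t • ψ x) (fun i hi => (hzero i).1 hi) hn2
      (ψ := f ⟨_, hfac'⟩) (fun i hi => (hfS ⟨_, hfac'⟩ i).1 hi)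
    rw [hfn, neg_neg, one_smul] at h3
    rw [h3, LinearMap.add_apply, LinearMap.smul_apply, smul_eq_mul] at h2
    have := mul_pos ht hψpos
    linarith

end IsSimplicialCone

end Cone


/-! ### Coherent orientation by determinants. -/

section Orientation

theorem ne_of_card_eq_three {α : Type*} [DecidableEq α] {a b c : α}
    (h : ({a, b, c} : Finset α).card = 3) : a ≠ b ∧ a ≠ c ∧ b ≠ c := by
  have hle : ∀ x y : α, ({x, y} : Finset α).card ≠ 3 := fun x y h => by
    have := Finset.card_le_two (a := x) (b := y)
    omega
  refine ⟨?_, ?_, ?_⟩ <;> rintro rfl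
  · exact hle a c (by simpa using h)
  · exact hle a b (by simpa [Finset.pair_comm] using h)
  · exact hle a b (by simpa using h)

variable {E : Type*} [AddCommGroup E] [Module ℝ E] {ι : Type*} [Fintype ι] {u : ι → E}

namespace IsSimplicialCone

theorem linearIndependent_facet (hu : IsSimplicialCone u) {a b x : ι} (hab : a ≠ b)
    (hax : a ≠ x) (hbx : b ≠ x) {H : Finset ι} (hH : IsConeFacet u H) (ha : a ∈ H) (hb : b ∈ H)
    (hx : x ∈ H) : LinearIndependent ℝ ![u a, u b, u x, ∑ i, u i] := by
  classical
  rw [Fintype.linearIndependent_iff]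
  intro g hg
  rw [Fin.sum_univ_four] at hg
  simp only [Matrix.cons_val_zero, Matrix.cons_val_one, Matrix.cons_val] at hg
  have h3 : g 3 = 0 := by
    obtain ⟨φ, -, hφ, hn⟩ := hu.exists_normalized hH.1 hH.2.1
    have := congrArg φ hg
    rw [map_add, map_add, map_add, map_smul, map_smul, map_smul, map_smul, hn,
      (hφ a).1 ha, (hφ b).1 hb, (hφ x).1 hx] at this
    simpa using this
  have hk : ∀ v ∈ H, (if a = v then g 0 else 0) + (if b = v then g 1 else 0) +
      (if x = v then g 2 else 0) = 0 := by
    intro v _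
    obtain ⟨ψ, hψ, -⟩ := hu.exists_dual hH fun i => if i = v then 1 else 0
    have := congrArg ψ hg
    rw [h3, map_add, map_add, map_add, map_smul, map_smul, map_smul, hψ a ha, hψ b hb,
      hψ x hx] at this
    simpa using this
  have h0 := hk a ha
  have h1 := hk b hb
  have h2 := hk x hx
  simp [hab, hax, hbx, hab.symm, hax.symm, hbx.symm] at h0 h1 h2
  intro i
  fin_cases i <;> assumption

/-- An orientation of the triples of generators, for which the boundary of the cone is coherently
oriented. -/
theorem exists_orientation [DecidableEq ι] (hu : IsSimplicialCone u) :
    ∃ o : ι → ι → ι → ℝ, (∀ x y z, o y x z = -o x y z) ∧ (∀ x y z, o x z y = -o x y z) ∧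
      ∀ a b x y, IsConeFacet u {a, b, x} → IsConeFacet u {a, b, y} → x ≠ y →
        o a b x * o a b y < 0 := by
  have := hu.finiteDimensional
  obtain ⟨B⟩ : Nonempty (Module.Basis (Fin 4) ℝ E) :=
    ⟨Module.finBasisOfFinrankEq ℝ E hu.finrank_eq⟩
  obtain ⟨ω, hω⟩ : ∃ ω : E [⋀^Fin 4]→ₗ[ℝ] ℝ, ω = B.det := ⟨_, rfl⟩
  -- The orientation of a triple is its determinant completed by the interior vector `∑ i, u i`.
  refine ⟨fun x y z => ω ![u x, u y, u z, ∑ i, u i], fun x y z => ?_, fun x y z => ?_, ?_⟩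
  · have h := ω.map_swap ![u x, u y, u z, ∑ i, u i] (show (0 : Fin 4) ≠ 1 by decide)
    rw [← h]
    refine congrArg ω (funext fun i => ?_)
    fin_cases i <;> rfl
  · have h := ω.map_swap ![u x, u y, u z, ∑ i, u i] (show (1 : Fin 4) ≠ 2 by decide)
    rw [← h]
    refine congrArg ω (funext fun i => ?_)
    fin_cases i <;> rfl
  · intro a b x y hx hy hxy
    obtain ⟨hab, hax, hbx⟩ : a ≠ b ∧ a ≠ x ∧ b ≠ x := ne_of_card_eq_three hx.2.2
    obtain ⟨-, hay, hby⟩ : a ≠ b ∧ a ≠ y ∧ b ≠ y := ne_of_card_eq_three hy.2.2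
    let χ : E →ₗ[ℝ] ℝ := ω.toMultilinearMap.toLinearMap ![u a, u b, 0, ∑ i, u i] 2
    have hχ : ∀ e, χ e = ω ![u a, u b, e, ∑ i, u i] := by
      intro e
      change ω (Function.update ![u a, u b, 0, ∑ i, u i] 2 e) = _
      refine congrArg ω (funext fun i => ?_)
      fin_cases i <;> rfl
    have hχa : χ (u a) = 0 := by
      rw [hχ]
      exact ω.map_eq_zero_of_eq _ (i := 0) (j := 2) rfl (by decide)
    have hχb : χ (u b) = 0 := by
      rw [hχ]
      exact ω.map_eq_zero_of_eq _ (i := 1) (j := 2) rfl (by decide)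
    have hχ0 : χ (∑ i, u i) = 0 := by
      rw [hχ]
      exact ω.map_eq_zero_of_eq _ (i := 3) (j := 2) rfl (by decide)
    have hχx : χ (u x) ≠ 0 := by
      have hli := hu.linearIndependent_facet hab hax hbx hx (by simp) (by simp) (by simp)
      have hsp := hli.span_eq_top_of_card_eq_finrank' (by simp [hu.finrank_eq])
      rw [hχ, hω]
      exact (B.is_basis_iff_det.1 ⟨hli, hsp⟩).ne_zero
    obtain ⟨ψ, hψ, hψ0⟩ := hu.exists_dual hx fun i => if i = x then -1 else 0
    have hψx : ψ (u x) = -1 := by simp [hψ x]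
    have hψa : ψ (u a) = 0 := by simp [hψ a, hax]
    have hψb : ψ (u b) = 0 := by simp [hψ b, hbx]
    have herase : ({a, b, x} : Finset ι).erase x = {a, b} := by
      ext i
      simp only [Finset.mem_erase, Finset.mem_insert, Finset.mem_singleton]
      grind
    obtain ⟨z, -, -, hz, huniq⟩ := hu.adjacent_pos_and_unique hx (x := x) (by simp) hψx
      (fun i hi h => by simp [hψ i hi, h]) hψ0
    have hyz : y = z := huniq y (by simp [hay.symm, hby.symm, hxy.symm]) (by
      rw [herase]
      convert hy using 1
      ext i
      simp only [Finset.mem_insert, Finset.mem_singleton]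
      tauto)
    -- As a function of the third vertex the determinant vanishes on the ridge and at the interior
    -- vector, so it is a multiple of `ψ`, which is `-1` at `x` and positive at the opposite vertex
    -- `y`.
    have heq : χ + χ (u x) • ψ = 0 := by
      refine hu.eq_zero_of_vanish hx (fun i hi => ?_) ?_
      swap
      · rw [LinearMap.add_apply, LinearMap.smul_apply, hχ0, hψ0, smul_zero, add_zero]
      simp only [Finset.mem_insert, Finset.mem_singleton] at hi
      rcases hi with rfl | rfl | rfl
      · simp [hχa, hψa]
      · simp [hχb, hψb]
      · simp [hψx]
    have h1 := LinearMap.congr_fun heq (u y)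
    simp only [LinearMap.add_apply, LinearMap.smul_apply, smul_eq_mul, LinearMap.zero_apply] at h1
    rw [← hyz] at hz
    change ω ![u a, u b, u x, ∑ i, u i] * ω ![u a, u b, u y, ∑ i, u i] < 0
    rw [← hχ, ← hχ, eq_neg_of_add_eq_zero_left h1]
    have := mul_pos (mul_self_pos.2 hχx) hz
    linarith

end IsSimplicialCone

end Orientation

/-! ### Passing between polytopes and cones. -/

section Homogenization

variable {ι : Type*} {d : ℕ}

/-- Homogeneous coordinates. -/
def homogenize (v : ι → Fin d → ℝ) (i : ι) : ℝ × (Fin d → ℝ) := (1, v i)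

theorem isPolytopeFace_iff {n : ℕ} (v : Fin n → Fin d → ℝ) (S : Finset (Fin n)) :
    IsPolytopeFace v S ↔ IsConeFace (homogenize v) S := by
  constructor
  · rintro ⟨l, c, h, hS⟩
    refine ⟨l.comp (LinearMap.snd ℝ ℝ _) - c • LinearMap.fst ℝ ℝ _, fun i => ?_, fun i => ?_⟩
    · simpa [homogenize] using h i
    · simp [homogenize, hS i, sub_eq_zero]
  · rintro ⟨φ, h, hS⟩
    have hφ : ∀ i, φ (homogenize v i) = φ (1, 0) + φ (0, v i) := fun i => by
      rw [← map_add]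
      simp [homogenize]
    refine ⟨φ.comp (LinearMap.inr ℝ ℝ _), -φ (1, 0), fun i => ?_, fun i => ?_⟩
    · have := h i
      rw [hφ] at this
      simp only [LinearMap.comp_apply, LinearMap.inr_apply]
      linarith
    · rw [hS i, hφ]
      simp only [LinearMap.comp_apply, LinearMap.inr_apply]
      constructor <;> intro h <;> linarith

theorem affineIndependent_iff_homogenize (v : ι → Fin d → ℝ) :
    AffineIndependent ℝ v ↔ LinearIndependent ℝ (homogenize v) := by
  rw [affineIndependent_iff, linearIndependent_iff']
  have key : ∀ (s : Finset ι) (w : ι → ℝ), ∑ i ∈ s, w i • homogenize v i =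
      (∑ i ∈ s, w i, ∑ i ∈ s, w i • v i) := fun s w => by
    rw [Prod.ext_iff]
    simp [homogenize, Prod.fst_sum, Prod.snd_sum]
  refine forall₂_congr fun s w => ?_
  rw [key, Prod.mk_eq_zero, and_imp]

theorem span_homogenize_eq_top [Fintype ι] {v : ι → Fin d → ℝ} :
    Submodule.span ℝ (Set.range (homogenize v)) = ⊤ ↔ affineSpan ℝ (Set.range v) = ⊤ := by
  constructor
  · intro h
    refine eq_top_iff.2 fun p _ => ?_
    have hp : ((1 : ℝ), p) ∈ Submodule.span ℝ (Set.range (homogenize v)) := h ▸ trivial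
    obtain ⟨c, hc⟩ := (Submodule.mem_span_range_iff_exists_fun ℝ).1 hp
    have h1 : ∑ i, c i = 1 := by
      simpa [homogenize, Prod.fst_sum] using congrArg Prod.fst hc
    have h2 : ∑ i, c i • v i = p := by
      simpa [homogenize, Prod.snd_sum] using congrArg Prod.snd hc
    rw [← h2, ← Finset.univ.affineCombination_eq_linear_combination v c h1]
    exact affineCombination_mem_affineSpan h1 v
  · intro h
    have key : ∀ p : Fin d → ℝ, ((1 : ℝ), p) ∈ Submodule.span ℝ (Set.range (homogenize v)) := by
      intro p
      obtain ⟨w, hw, hp⟩ := eq_affineCombination_of_mem_affineSpan_of_fintype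
        (show p ∈ affineSpan ℝ (Set.range v) from h ▸ trivial)
      rw [Finset.univ.affineCombination_eq_linear_combination v w hw] at hp
      rw [Submodule.mem_span_range_iff_exists_fun]
      refine ⟨w, ?_⟩
      rw [Prod.ext_iff]
      simp [homogenize, Prod.fst_sum, Prod.snd_sum, hw, hp]
    refine eq_top_iff.2 fun q _ => ?_
    have : q = ((1 : ℝ), q.2) + (q.1 - 1) • ((1 : ℝ), (0 : Fin d → ℝ)) := by
      rw [Prod.ext_iff]
      simp
    rw [this]
    exact add_mem (key _) (Submodule.smul_mem _ _ (key 0))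

/-- Faces depend only on the rays, so a cone may be cut by any hyperplane that meets all of them. -/
theorem isConeFace_smul {E : Type*} [AddCommGroup E] [Module ℝ E] {u : ι → E} {c : ι → ℝ}
    (hc : ∀ i, 0 < c i) {S : Finset ι} : IsConeFace (fun i => c i • u i) S ↔ IsConeFace u S := by
  refine exists_congr fun φ => and_congr (forall_congr' fun i => ?_) (forall_congr' fun i => ?_)
  · rw [map_smul, smul_eq_mul]
    exact ⟨fun h => by by_contra! h'; exact absurd (mul_pos (hc i) h') (not_lt.2 h),
      fun h => mul_nonpos_of_nonneg_of_nonpos (hc i).le h⟩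
  · rw [map_smul, smul_eq_mul, mul_eq_zero]
    simp [(hc i).ne']

theorem isConeFace_equiv {E E' : Type*} [AddCommGroup E] [Module ℝ E] [AddCommGroup E']
    [Module ℝ E'] {u : ι → E} (L : E ≃ₗ[ℝ] E') {S : Finset ι} :
    IsConeFace (fun i => L (u i)) S ↔ IsConeFace u S := by
  constructor
  · rintro ⟨φ, h, hS⟩
    exact ⟨φ.comp L.toLinearMap, h, hS⟩
  · rintro ⟨φ, h, hS⟩
    exact ⟨φ.comp L.symm.toLinearMap, by simpa using h, by simpa using hS⟩

theorem IsSimplicialCone.map_equiv [Fintype ι] {E E' : Type*} [AddCommGroup E] [Module ℝ E]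
    [AddCommGroup E'] [Module ℝ E'] {u : ι → E} (hu : IsSimplicialCone u) (L : E ≃ₗ[ℝ] E') :
    IsSimplicialCone fun i => L (u i) where
  finrank_eq := by rw [← L.finrank_eq, hu.finrank_eq]
  span_eq_top := by
    have h : (Set.range fun i => L (u i)) = L.toLinearMap '' Set.range u := by
      rw [← Set.range_comp]
      rfl
    rw [h, Submodule.span_image, hu.span_eq_top, Submodule.map_top, LinearEquiv.range]
  isConeFace_singleton i := (isConeFace_equiv L).2 (hu.isConeFace_singleton i)
  linearIndependent S hS hne :=
    (hu.linearIndependent S ((isConeFace_equiv L).1 hS) hne).map' L.toLinearMap L.ker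

theorem IsSimplicialCone.smul [Fintype ι] {E : Type*} [AddCommGroup E] [Module ℝ E] {u : ι → E}
    (hu : IsSimplicialCone u) {c : ι → ℝ} (hc : ∀ i, 0 < c i) :
    IsSimplicialCone fun i => c i • u i where
  finrank_eq := hu.finrank_eq
  span_eq_top := by
    rw [eq_top_iff, ← hu.span_eq_top, Submodule.span_le]
    rintro _ ⟨i, rfl⟩
    have := Submodule.smul_mem (Submodule.span ℝ (Set.range fun i => c i • u i)) (c i)⁻¹
      (Submodule.subset_span ⟨i, rfl⟩)
    rwa [smul_smul, inv_mul_cancel₀ (hc i).ne', one_smul] at this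
  isConeFace_singleton i := (isConeFace_smul hc).2 (hu.isConeFace_singleton i)
  linearIndependent S hS hne :=
    (hu.linearIndependent S ((isConeFace_smul hc).1 hS) hne).units_smul
      fun i => Units.mk0 (c i) (hc i).ne'

/-- A vertex is strictly separated from the compact convex hull of the other vertices. -/
theorem isPolytopeFace_singleton {n : ℕ} {v : Fin n → Fin d → ℝ} (hv : ConvexIndependent ℝ v)
    (i : Fin n) : IsPolytopeFace v {i} := by
  have hcl : IsClosed (convexHull ℝ (v '' {i}ᶜ)) :=
    (Set.Finite.isCompact_convexHull ℝ (Set.toFinite _)).isClosed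
  have hnot : v i ∉ convexHull ℝ (v '' {i}ᶜ) := fun h => by simpa using hv _ i h
  obtain ⟨f, c, hf, hc⟩ := geometric_hahn_banach_closed_point (convex_convexHull ℝ _) hcl hnot
  have hlt : ∀ j, j ≠ i → f (v j) < f (v i) := fun j hj =>
    (hf _ (subset_convexHull ℝ _ ⟨j, hj, rfl⟩)).trans hc
  refine ⟨f.toLinearMap, f (v i), fun j => ?_, fun j => ?_⟩
  · by_cases h : j = i
    · simp [h]
    · exact (hlt j h).le
  · rw [Finset.mem_singleton]
    exact ⟨fun h => by simp [h], fun h => by_contra fun hj => (hlt j hj).ne h⟩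

theorem convexIndependent_of_faces {n : ℕ} {v : Fin n → Fin d → ℝ}
    (h : ∀ i, IsPolytopeFace v {i}) : ConvexIndependent ℝ v := by
  intro s i hi
  by_contra his
  obtain ⟨l, c, hl, hS⟩ := h i
  have hsub : convexHull ℝ (v '' s) ⊆ {x | l x < c} := by
    refine convexHull_min ?_ (convex_halfSpace_lt l.isLinear c)
    rintro _ ⟨j, hj, rfl⟩
    refine lt_of_le_of_ne (hl j) fun h => ?_
    rw [Finset.mem_singleton.1 ((hS j).2 h)] at hj
    exact his hj
  have := hsub hi
  rw [Set.mem_ofPred_eq, (hS i).1 (Finset.mem_singleton_self i)] at this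
  exact lt_irrefl _ this

namespace SimplicialPolytope

theorem isSimplicialCone (P : SimplicialPolytope 3) : IsSimplicialCone (homogenize P.vertex) where
  finrank_eq := by simp
  span_eq_top := span_homogenize_eq_top.2 P.affineSpan_eq_top
  isConeFace_singleton i :=
    (isPolytopeFace_iff _ _).1 (isPolytopeFace_singleton P.convexIndependent i)
  linearIndependent S hS hne :=
    (affineIndependent_iff_homogenize _).1 (P.simplicial S ((isPolytopeFace_iff _ _).2 hS) hne)

theorem mem_boundaryComplex_iff (P : SimplicialPolytope 3) {S : Finset (Fin P.n)} :
    S ∈ P.boundaryComplex ↔ IsConeFace (homogenize P.vertex) S ∧ S ≠ Finset.univ := by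
  rw [← isPolytopeFace_iff]
  rfl

theorem mem_facets_iff (P : SimplicialPolytope 3) {S : Finset (Fin P.n)} :
    S ∈ P.facets ↔ IsConeFacet (homogenize P.vertex) S := by
  rw [IsConeFacet, ← and_assoc, ← mem_boundaryComplex_iff]
  rfl

/-- The polytope cut out of a cone by an affine hyperplane. -/
theorem exists_of_isSimplicialCone {n : ℕ} {u : Fin n → ℝ × (Fin 3 → ℝ)} (hu : IsSimplicialCone u)
    (hpos : ∀ i, 0 < (u i).1) : ∃ v : Fin n → Fin 3 → ℝ, ∃ hv₁ hv₂ hv₃,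
      ∀ S, S ∈ (SimplicialPolytope.mk n v hv₁ hv₂ hv₃).boundaryComplex ↔
        IsConeFace u S ∧ S ≠ Finset.univ := by
  set v : Fin n → Fin 3 → ℝ := fun i => (u i).1⁻¹ • (u i).2 with hv
  have hvu : homogenize v = fun i => (u i).1⁻¹ • u i := by
    funext i
    rw [Prod.ext_iff]
    simp [homogenize, hv, (hpos i).ne']
  have hc : ∀ i, 0 < (u i).1⁻¹ := fun i => inv_pos.2 (hpos i)
  have hcone : IsSimplicialCone (homogenize v) := hvu ▸ hu.smul hc
  refine ⟨v, convexIndependent_of_faces fun i =>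
      (isPolytopeFace_iff _ _).2 (hcone.isConeFace_singleton i),
    span_homogenize_eq_top.1 hcone.span_eq_top,
    fun S hS hne => (affineIndependent_iff_homogenize _).2
      (hcone.linearIndependent S ((isPolytopeFace_iff _ _).1 hS) hne), fun S => ?_⟩
  rw [mem_boundaryComplex_iff]
  exact and_congr_left fun _ => by
    change IsConeFace (homogenize v) S ↔ _
    rw [hvu]
    exact isConeFace_smul hc

end SimplicialPolytope

end Homogenization


/-! ### Projective normal form over a facet, and gluing by reflection. -/

section Roof

/-- Homogeneous coordinates of `ℝ³` in which a distinguished triangle is the standard one in the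
plane where the last coordinate vanishes. -/
abbrev RoofSpace := (Fin 3 → ℝ) × ℝ

/-- The triangle `a` is the standard one, and all other points lie strictly above its interior. -/
structure IsRoof {ι : Type*} (u : ι → RoofSpace) (a : Fin 3 ↪ ι) : Prop where
  base : ∀ k, u (a k) = (Pi.single k 1, 0)
  fst_pos : ∀ i, (∀ k, a k ≠ i) → ∀ k, 0 < (u i).1 k
  snd_pos : ∀ i, (∀ k, a k ≠ i) → 0 < (u i).2

/-- The reflection in the plane of the distinguished triangle. -/
noncomputable def roofReflection : RoofSpace ≃ₗ[ℝ] RoofSpace :=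
  LinearEquiv.prodCongr (LinearEquiv.refl ℝ _) (LinearEquiv.neg ℝ)

@[simp] theorem roofReflection_apply (p : RoofSpace) : roofReflection p = (p.1, -p.2) := rfl

theorem roof_functional_apply (χ : RoofSpace →ₗ[ℝ] ℝ) (p : RoofSpace) :
    χ p = ∑ k, p.1 k * χ (Pi.single k 1, 0) + p.2 * χ (0, 1) := by
  have : p = ∑ k, p.1 k • ((Pi.single k 1, 0) : RoofSpace) + p.2 • ((0, 1) : RoofSpace) := by
    rw [Prod.ext_iff]
    constructor
    · rw [Prod.fst_add, Prod.fst_sum]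
      funext j
      simp [Finset.sum_apply, Pi.single_apply]
    · rw [Prod.snd_add, Prod.snd_sum]
      simp
  conv_lhs => rw [this]
  rw [map_add, map_sum, map_smul]
  simp only [map_smul, smul_eq_mul]

theorem roof_functional_ext {χ : RoofSpace →ₗ[ℝ] ℝ} (h : ∀ k, χ (Pi.single k 1, 0) = 0)
    (h' : χ (0, 1) = 0) : χ = 0 :=
  LinearMap.ext fun p => by simp [roof_functional_apply χ p, h, h']

theorem roof_sum_neg {χ : RoofSpace →ₗ[ℝ] ℝ} (h : ∀ k, χ (Pi.single k 1, 0) ≤ 0)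
    (hne : ∃ k, χ (Pi.single k 1, 0) ≠ 0) {x : Fin 3 → ℝ} (hx : ∀ k, 0 < x k) :
    ∑ k, x k * χ (Pi.single k 1, 0) < 0 := by
  obtain ⟨k, hk⟩ := hne
  exact Finset.sum_neg' (fun k _ => mul_nonpos_of_nonneg_of_nonpos (hx k).le (h k))
    ⟨k, Finset.mem_univ k, mul_neg_of_pos_of_neg (hx k) (lt_of_le_of_ne (h k) hk)⟩

/-- The reflected point has positive base coordinates and negative height, so every term of `χ`
there is nonpositive, and `χ ≠ 0` makes one of them strict. -/
theorem roof_functional_reflect_neg {χ : RoofSpace →ₗ[ℝ] ℝ} (hχ : χ ≠ 0) (hμ : 0 ≤ χ (0, 1))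
    (h : ∀ k, χ (Pi.single k 1, 0) ≤ 0) {p : RoofSpace} (hp : ∀ k, 0 < p.1 k) (hp' : 0 < p.2) :
    χ (roofReflection p) < 0 := by
  rw [roof_functional_apply]
  simp only [roofReflection_apply]
  by_cases hne : ∃ k, χ (Pi.single k 1, 0) ≠ 0
  · have h1 := roof_sum_neg h hne hp
    have h2 := mul_nonneg hp'.le hμ
    linarith
  · push Not at hne
    have hμ' : 0 < χ (0, 1) := lt_of_le_of_ne hμ fun h0 => hχ (roof_functional_ext hne h0.symm)
    have := mul_pos hp' hμ'
    simp only [hne, mul_zero, Finset.sum_const_zero]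
    linarith

/-- This is the projective transformation that sends the polytope above the interior of one of its
facets. Without it, the union of two polytopes along a facet need not be convex. -/
theorem IsSimplicialCone.exists_roof {E ι : Type*} [AddCommGroup E] [Module ℝ E] [Fintype ι]
    {u : ι → E} (hu : IsSimplicialCone u) {a : Fin 3 ↪ ι}
    (hH : IsConeFacet u (Finset.univ.map a)) :
    ∃ L : E ≃ₗ[ℝ] RoofSpace, IsRoof (fun i => L (u i)) a := by
  classical
  have := hu.finiteDimensional
  obtain ⟨φ, hφ, hφH, hn⟩ := hu.exists_normalized hH.1 hH.2.1
  choose ψ hψ hψ0 using fun k => hu.exists_dual hH fun i => if i = a k then 1 else 0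
  have hφa : ∀ k, φ (u (a k)) = 0 := fun k => (hφH _).1 (by simp)
  have hψa : ∀ k j, ψ k (u (a j)) = if j = k then 1 else 0 := fun k j => by
    simp [hψ k (a j) (by simp)]
  have hneg : ∀ i, (∀ k, a k ≠ i) → φ (u i) < 0 := fun i hi =>
    lt_of_le_of_ne (hφ i) fun h => by simpa [hi] using (hφH i).2 h
  have hev : ∀ᶠ M : ℝ in Filter.atTop, ∀ i, (∀ k, a k ≠ i) → ∀ k,
      0 < ψ k (u i) - M * φ (u i) := by
    rw [Filter.eventually_all]
    intro i
    by_cases hi : ∀ k, a k ≠ i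
    · have hev : ∀ᶠ M : ℝ in Filter.atTop, ∀ k, 0 < ψ k (u i) - M * φ (u i) := by
        rw [Filter.eventually_all]
        intro k
        filter_upwards [Filter.eventually_gt_atTop (-ψ k (u i) / -φ (u i))] with M hM
        rw [div_lt_iff₀ (by linarith [hneg i hi])] at hM
        linarith
      exact hev.mono fun M hM _ => hM
    · exact Filter.Eventually.of_forall fun M h => absurd h hi
  obtain ⟨M, hM⟩ := hev.exists
  -- The height `-φ` is zero exactly on the base. Shearing the base coordinates by a large multiple
  -- `M` of the height makes them positive at every other generator.
  let L₀ : E →ₗ[ℝ] RoofSpace := (LinearMap.pi fun k => ψ k - M • φ).prod (-φ)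
  have hL₀ : ∀ e, L₀ e = (fun k => ψ k e - M * φ e, -φ e) := fun e => rfl
  have hbase : ∀ k, L₀ (u (a k)) = (Pi.single k 1, 0) := by
    intro k
    rw [hL₀, hφa]
    ext j
    · simp [hψa, Pi.single_apply, eq_comm]
    · simp
  have hsurj : Function.Surjective L₀ := by
    rw [← LinearMap.range_eq_top]
    refine (Submodule.eq_top_iff').2 fun p => ?_
    have htop : L₀ (∑ i, u i) = (fun _ => M, 1) := by
      rw [hL₀, hn]
      simp [hψ0]
    have : p = ∑ k, (p.1 k - p.2 * M) • L₀ (u (a k)) + p.2 • L₀ (∑ i, u i) := by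
      rw [htop, Prod.ext_iff]
      constructor
      · rw [Prod.fst_add, Prod.fst_sum]
        funext j
        simp [hbase, Finset.sum_apply, Pi.single_apply]
      · rw [Prod.snd_add, Prod.snd_sum]
        simp [hbase]
    rw [this]
    exact add_mem (sum_mem fun k _ => Submodule.smul_mem _ _ ⟨_, rfl⟩)
      (Submodule.smul_mem _ _ ⟨_, rfl⟩)
  have hinj : Function.Injective L₀ :=
    (LinearMap.injective_iff_surjective_of_finrank_eq_finrank
      (by rw [hu.finrank_eq]; simp)).2 hsurj
  refine ⟨LinearEquiv.ofBijective L₀ ⟨hinj, hsurj⟩, hbase, fun i hi k => ?_, fun i hi => ?_⟩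
  · exact hM i hi k
  · change 0 < -φ (u i)
    linarith [hneg i hi]

theorem IsRoof.le_zero {ι : Type*} {u : ι → RoofSpace} {a : Fin 3 ↪ ι} (ha : IsRoof u a)
    {χ : RoofSpace →ₗ[ℝ] ℝ} (h : ∀ i, χ (u i) ≤ 0) (k : Fin 3) : χ (Pi.single k 1, 0) ≤ 0 := by
  rw [← ha.base]
  exact h _

/-- Supporting functionals with nonnegative vertical coefficient are the ones that remain supporting
after another roof is attached below. A functional with negative coefficient vanishes at base
vertices only, and it can be replaced by one that ignores the height, because the remaining vertices
lie over the interior of the base. -/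
theorem IsRoof.exists_upper {ι : Type*} {u : ι → RoofSpace} {a : Fin 3 ↪ ι} (ha : IsRoof u a)
    {T : Finset ι} (hT : IsConeFace u T) (hne : ∃ i, i ∉ T) (hTF : T ≠ Finset.univ.map a) :
    ∃ χ : RoofSpace →ₗ[ℝ] ℝ, χ ≠ 0 ∧ 0 ≤ χ (0, 1) ∧ (∀ i, χ (u i) ≤ 0) ∧
      ∀ i, i ∈ T ↔ χ (u i) = 0 := by
  classical
  obtain ⟨χ, hχ, hχT⟩ := hT
  obtain ⟨i₀, hi₀⟩ := hne
  have hχ0 : χ ≠ 0 := fun h => hi₀ ((hχT i₀).2 (by simp [h]))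
  by_cases hμ : 0 ≤ χ (0, 1)
  · exact ⟨χ, hχ0, hμ, hχ, hχT⟩
  push Not at hμ
  have hlt : ∀ i, (∀ k, a k ≠ i) → χ (u i) < 0 := by
    intro i hi
    rw [roof_functional_apply]
    have h1 : ∑ k, (u i).1 k * χ (Pi.single k 1, 0) ≤ 0 := Finset.sum_nonpos fun k _ =>
      mul_nonpos_of_nonneg_of_nonpos (ha.fst_pos i hi k).le (ha.le_zero hχ k)
    have h2 := mul_neg_of_pos_of_neg (ha.snd_pos i hi) hμ
    linarith
  have hex : ∃ k, χ (Pi.single k 1, 0) ≠ 0 := by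
    by_contra! h
    refine hTF (Finset.ext fun i => ?_)
    simp only [Finset.mem_map, Finset.mem_univ, true_and]
    constructor
    · intro hi
      by_contra! h'
      exact (hlt i h').ne ((hχT i).1 hi)
    · rintro ⟨k, rfl⟩
      rw [hχT, ha.base, h]
  set χ' : RoofSpace →ₗ[ℝ] ℝ :=
    χ.comp ((LinearMap.inl ℝ _ _).comp (LinearMap.fst ℝ _ _)) with hχ'
  have hχ'a : ∀ p, χ' p = χ (p.1, 0) := fun p => rfl
  have hbase : ∀ k, χ' (u (a k)) = χ (u (a k)) := fun k => by rw [hχ'a, ha.base]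
  have hlt' : ∀ i, (∀ k, a k ≠ i) → χ' (u i) < 0 := by
    intro i hi
    rw [hχ'a, roof_functional_apply]
    have := roof_sum_neg (ha.le_zero hχ) hex (ha.fst_pos i hi)
    simpa using this
  refine ⟨χ', fun h => ?_, ?_, fun i => ?_, fun i => ?_⟩
  · obtain ⟨k, hk⟩ := hex
    rw [← ha.base, ← hbase, h] at hk
    simp at hk
  · rw [hχ'a]
    exact (map_zero χ).ge
  · by_cases hi : ∃ k, a k = i
    · obtain ⟨k, rfl⟩ := hi
      rw [hbase]
      exact hχ _
    · push Not at hi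
      exact (hlt' i hi).le
  · by_cases hi : ∃ k, a k = i
    · obtain ⟨k, rfl⟩ := hi
      rw [hbase, hχT]
    · push Not at hi
      rw [hχT]
      exact ⟨fun h => absurd h (hlt i hi).ne, fun h => absurd h (hlt' i hi).ne⟩

/-- Two roofs, the second one turned upside down, put together along their common base. -/
structure IsRoofGluing {α β γ : Type*} (u₁ : α → RoofSpace) (u₂ : β → RoofSpace)
    (w : γ → RoofSpace) (a : Fin 3 ↪ α) (b : Fin 3 ↪ β) (f₁ : α ↪ γ) (f₂ : β ↪ γ) : Prop where
  roof₁ : IsRoof u₁ a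
  roof₂ : IsRoof u₂ b
  apply₁ : ∀ i, w (f₁ i) = u₁ i
  apply₂ : ∀ j, w (f₂ j) = roofReflection (u₂ j)
  base_eq : ∀ k, f₁ (a k) = f₂ (b k)
  cover : ∀ x, (∃ i, f₁ i = x) ∨ ∃ j, f₂ j = x

namespace IsRoofGluing

variable {α β γ : Type*} {u₁ : α → RoofSpace} {u₂ : β → RoofSpace} {w : γ → RoofSpace}
  {a : Fin 3 ↪ α} {b : Fin 3 ↪ β} {f₁ : α ↪ γ} {f₂ : β ↪ γ}

theorem symm (h : IsRoofGluing u₁ u₂ w a b f₁ f₂) :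
    IsRoofGluing u₂ u₁ (fun x => roofReflection (w x)) b a f₂ f₁ where
  roof₁ := h.roof₂
  roof₂ := h.roof₁
  apply₁ j := by simp [h.apply₂]
  apply₂ i := by rw [h.apply₁]
  base_eq k := (h.base_eq k).symm
  cover x := (h.cover x).symm

theorem cover' (h : IsRoofGluing u₁ u₂ w a b f₁ f₂) (x : γ) :
    (∃ i, f₁ i = x) ∨ ∃ j, (∀ k, b k ≠ j) ∧ f₂ j = x := by
  rcases h.cover x with h1 | ⟨j, rfl⟩
  · exact Or.inl h1
  · by_cases hj : ∃ k, b k = j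
    · obtain ⟨k, rfl⟩ := hj
      exact Or.inl ⟨a k, h.base_eq k⟩
    · push Not at hj
      exact Or.inr ⟨j, hj, rfl⟩

theorem neg₂ (h : IsRoofGluing u₁ u₂ w a b f₁ f₂) {χ : RoofSpace →ₗ[ℝ] ℝ} (hχ : χ ≠ 0)
    (hμ : 0 ≤ χ (0, 1)) (hle : ∀ i, χ (u₁ i) ≤ 0) {j : β} (hj : ∀ k, b k ≠ j) :
    χ (w (f₂ j)) < 0 := by
  rw [h.apply₂]
  exact roof_functional_reflect_neg hχ hμ (h.roof₁.le_zero hle) (h.roof₂.fst_pos j hj)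
    (h.roof₂.snd_pos j hj)

/-- A functional of nonnegative vertical coefficient is negative at the strictly lower vertices, so
its zeros lie in the upper roof. They are not the whole base: otherwise the functional would be a
positive multiple of the height, hence positive at an upper vertex. -/
theorem face_of_upper [Fintype α] (h : IsRoofGluing u₁ u₂ w a b f₁ f₂)
    (hex : ∃ i, ∀ k, a k ≠ i) {S : Finset γ} {χ : RoofSpace →ₗ[ℝ] ℝ} (hχ : χ ≠ 0)
    (hμ : 0 ≤ χ (0, 1)) (hle : ∀ x, χ (w x) ≤ 0) (hS : ∀ x, x ∈ S ↔ χ (w x) = 0) :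
    ∃ T : Finset α, (IsConeFace u₁ T ∧ T ≠ Finset.univ) ∧ T ≠ Finset.univ.map a ∧ T.map f₁ = S := by
  classical
  have hle₁ : ∀ i, χ (u₁ i) ≤ 0 := fun i => by rw [← h.apply₁]; exact hle _
  obtain ⟨i₀, hi₀⟩ := hex
  have hnot : ∀ T : Finset α, (∀ i, i ∈ T ↔ χ (u₁ i) = 0) → ¬ ∀ k, a k ∈ T := by
    intro T hT hk
    have h0 : ∀ k, χ (Pi.single k 1, 0) = 0 := fun k => by
      rw [← h.roof₁.base]
      exact (hT _).1 (hk k)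
    have hμ' : 0 < χ (0, 1) := lt_of_le_of_ne hμ fun h' => hχ (roof_functional_ext h0 h'.symm)
    have h1 := hle₁ i₀
    rw [roof_functional_apply] at h1
    simp only [h0, mul_zero, Finset.sum_const_zero, zero_add] at h1
    exact absurd (mul_pos (h.roof₁.snd_pos i₀ hi₀) hμ') (not_lt.2 h1)
  have hT : ∀ i, i ∈ Finset.univ.filter (fun i => χ (u₁ i) = 0) ↔ χ (u₁ i) = 0 := by simp
  refine ⟨Finset.univ.filter fun i => χ (u₁ i) = 0, ⟨⟨χ, hle₁, hT⟩, fun he => ?_⟩, fun he => ?_,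
    Finset.ext fun x => ?_⟩
  · exact hnot _ hT fun k => by rw [he]; exact Finset.mem_univ _
  · exact hnot _ hT fun k => by rw [he]; simp
  · simp only [Finset.mem_map, Finset.mem_filter, Finset.mem_univ, true_and]
    rw [hS]
    constructor
    · rintro ⟨i, hi, rfl⟩
      rw [h.apply₁, hi]
    · intro hx
      rcases h.cover' x with ⟨i, rfl⟩ | ⟨j, hj, rfl⟩
      · exact ⟨i, by rw [← h.apply₁, hx], rfl⟩
      · exact absurd hx (h.neg₂ hχ hμ hle₁ hj).ne

theorem upper_of_face [Fintype α] [Fintype γ] (h : IsRoofGluing u₁ u₂ w a b f₁ f₂) {T : Finset α}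
    (hT : IsConeFace u₁ T) (hne : T ≠ Finset.univ) (hTF : T ≠ Finset.univ.map a) :
    IsConeFace w (T.map f₁) ∧ T.map f₁ ≠ Finset.univ := by
  obtain ⟨i₀, hi₀⟩ : ∃ i, i ∉ T := by
    by_contra! h
    exact hne (Finset.eq_univ_iff_forall.2 h)
  obtain ⟨χ, hχ, hμ, hle, hχT⟩ := h.roof₁.exists_upper hT ⟨i₀, hi₀⟩ hTF
  refine ⟨⟨χ, fun x => ?_, fun x => ?_⟩, fun he => ?_⟩
  · rcases h.cover' x with ⟨i, rfl⟩ | ⟨j, hj, rfl⟩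
    · rw [h.apply₁]; exact hle i
    · exact (h.neg₂ hχ hμ hle hj).le
  · rcases h.cover' x with ⟨i, rfl⟩ | ⟨j, hj, rfl⟩
    · rw [h.apply₁, ← hχT]
      simp
    · refine ⟨fun hx => ?_, fun hx => absurd hx (h.neg₂ hχ hμ hle hj).ne⟩
      obtain ⟨i, hi, hij⟩ := Finset.mem_map.1 hx
      rw [← hij, h.apply₁, ← hχT]
      exact hi
  · have := he ▸ Finset.mem_univ (f₁ i₀)
    rw [Finset.mem_map'] at this
    exact hi₀ this

/-- The sign of the vertical coefficient of a supporting functional decides which roof the face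
comes from; the reflection exchanges the two cases. -/
theorem isConeFace_iff [Fintype α] [Fintype β] [Fintype γ]
    (h : IsRoofGluing u₁ u₂ w a b f₁ f₂) (hex₁ : ∃ i, ∀ k, a k ≠ i) (hex₂ : ∃ i, ∀ k, b k ≠ i)
    (S : Finset γ) :
    (IsConeFace w S ∧ S ≠ Finset.univ) ↔
      (∃ T, (IsConeFace u₁ T ∧ T ≠ Finset.univ) ∧ T ≠ Finset.univ.map a ∧ T.map f₁ = S) ∨
      (∃ T, (IsConeFace u₂ T ∧ T ≠ Finset.univ) ∧ T ≠ Finset.univ.map b ∧ T.map f₂ = S) := by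
  constructor
  · rintro ⟨⟨χ, hle, hS⟩, hne⟩
    obtain ⟨x, hx⟩ : ∃ x, x ∉ S := by
      by_contra! h
      exact hne (Finset.eq_univ_iff_forall.2 h)
    have hχ : χ ≠ 0 := fun h0 => hx ((hS x).2 (by simp [h0]))
    rcases le_total 0 (χ (0, 1)) with hμ | hμ
    · exact Or.inl (h.face_of_upper hex₁ hχ hμ hle hS)
    · refine Or.inr (h.symm.face_of_upper hex₂ (χ := χ.comp roofReflection.toLinearMap)
        (fun h0 => hχ ?_) ?_ (fun x => ?_) (fun x => ?_))
      · exact LinearMap.ext fun p => by simpa using LinearMap.congr_fun h0 (roofReflection p)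
      · simp only [LinearMap.comp_apply, LinearEquiv.coe_coe, roofReflection_apply]
        have : ((0, -1) : RoofSpace) = -(0, 1) := by simp
        rw [this, map_neg]
        linarith
      · simpa using hle x
      · simpa using hS x
  · rintro (⟨T, ⟨hT, hne⟩, hTF, rfl⟩ | ⟨T, ⟨hT, hne⟩, hTF, rfl⟩)
    · exact h.upper_of_face hT hne hTF
    · have := h.symm.upper_of_face hT hne hTF
      rwa [isConeFace_equiv] at this

theorem linearIndependent_map {T : Finset α} (h : IsRoofGluing u₁ u₂ w a b f₁ f₂)
    (hT : LinearIndependent ℝ fun i : T => u₁ i) :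
    LinearIndependent ℝ fun x : T.map f₁ => w x := by
  have hsurj : Function.Surjective
      (fun i : T => (⟨f₁ i, Finset.mem_map_of_mem f₁ i.2⟩ : T.map f₁)) := by
    rintro ⟨x, hx⟩
    obtain ⟨i, hi, rfl⟩ := Finset.mem_map.1 hx
    exact ⟨⟨i, hi⟩, rfl⟩
  have hinj : Function.Injective
      (fun i : T => (⟨f₁ i, Finset.mem_map_of_mem f₁ i.2⟩ : T.map f₁)) := fun i j hij =>
    Subtype.ext (f₁.injective (congrArg Subtype.val hij))
  rw [← linearIndependent_equiv (Equiv.ofBijective _ ⟨hinj, hsurj⟩)]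
  convert hT using 2 with i
  exact h.apply₁ i

theorem isSimplicialCone [Fintype α] [Fintype β] [Fintype γ]
    (h : IsRoofGluing u₁ u₂ w a b f₁ f₂) (h₁ : IsSimplicialCone u₁) (h₂ : IsSimplicialCone u₂)
    (hex₁ : ∃ i, ∀ k, a k ≠ i) (hex₂ : ∃ i, ∀ k, b k ≠ i) : IsSimplicialCone w where
  finrank_eq := h₁.finrank_eq
  span_eq_top := by
    rw [eq_top_iff, ← h₁.span_eq_top]
    refine Submodule.span_mono ?_
    rintro _ ⟨i, rfl⟩
    exact ⟨f₁ i, h.apply₁ i⟩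
  isConeFace_singleton x := by
    refine And.left ((h.isConeFace_iff hex₁ hex₂ {x}).2 ?_)
    rcases h.cover x with ⟨i, rfl⟩ | ⟨j, rfl⟩
    · exact Or.inl ⟨{i}, ⟨h₁.isConeFace_singleton i, h₁.ne_univ (by simp)⟩, fun he => by simpa using congrArg Finset.card he, by simp⟩
    · exact Or.inr ⟨{j}, ⟨h₂.isConeFace_singleton j, h₂.ne_univ (by simp)⟩, fun he => by simpa using congrArg Finset.card he, by simp⟩
  linearIndependent S hS hne := by
    rcases (h.isConeFace_iff hex₁ hex₂ S).1 ⟨hS, hne⟩ with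
      ⟨T, ⟨hT, hTne⟩, -, rfl⟩ | ⟨T, ⟨hT, hTne⟩, -, rfl⟩
    · exact h.linearIndependent_map (h₁.linearIndependent T hT hTne)
    · have := h.symm.linearIndependent_map (h₂.linearIndependent T hT hTne)
      exact (LinearMap.linearIndependent_iff roofReflection.toLinearMap roofReflection.ker).1 this

end IsRoofGluing

end Roof


/-! ### Combinatorial gluing and its realization by polytopes. -/

section Gluing

/-- The complex `Δ` is obtained by attaching the triangle `F₁` of `Δ₁` to the triangle `F₂` of `Δ₂`
and removing it. -/
structure IsGluing {α β γ : Type*} [Fintype α] [Fintype β] [Fintype γ] [DecidableEq γ]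
    (Δ₁ : Set (Finset α)) (Δ₂ : Set (Finset β)) (Δ : Set (Finset γ)) (f₁ : α ↪ γ) (f₂ : β ↪ γ)
    (F₁ : Finset α) (F₂ : Finset β) : Prop where
  mem₁ : F₁ ∈ Δ₁
  mem₂ : F₂ ∈ Δ₂
  card₁ : F₁.card = 3
  card₂ : F₂.card = 3
  map_eq : F₁.map f₁ = F₂.map f₂
  inter : Finset.univ.map f₁ ∩ Finset.univ.map f₂ = F₁.map f₁
  union : Finset.univ.map f₁ ∪ Finset.univ.map f₂ = Finset.univ
  mem_iff : ∀ S : Finset γ, S ∈ Δ ↔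
    (∃ T ∈ Δ₁, T ≠ F₁ ∧ T.map f₁ = S) ∨ (∃ T ∈ Δ₂, T ≠ F₂ ∧ T.map f₂ = S)

theorem IsGluing.symm {α β γ : Type*} [Fintype α] [Fintype β] [Fintype γ] [DecidableEq γ]
    {Δ₁ : Set (Finset α)} {Δ₂ : Set (Finset β)} {Δ : Set (Finset γ)} {f₁ : α ↪ γ} {f₂ : β ↪ γ}
    {F₁ : Finset α} {F₂ : Finset β} (h : IsGluing Δ₁ Δ₂ Δ f₁ f₂ F₁ F₂) :
    IsGluing Δ₂ Δ₁ Δ f₂ f₁ F₂ F₁ where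
  mem₁ := h.mem₂
  mem₂ := h.mem₁
  card₁ := h.card₂
  card₂ := h.card₁
  map_eq := h.map_eq.symm
  inter := by rw [Finset.inter_comm, h.inter, h.map_eq]
  union := by rw [Finset.union_comm, h.union]
  mem_iff S := by rw [h.mem_iff, or_comm]

/-- The combinatorial properties of the boundary complex of a simplicial `3`-polytope. -/
structure IsOrientedSphere {V : Type*} [DecidableEq V] (Δ : Set (Finset V)) : Prop where
  mono : ∀ S ∈ Δ, ∀ T ⊆ S, T ∈ Δ
  singleton_mem : ∀ v, {v} ∈ Δ
  exists_facet : ∀ S ∈ Δ, ∃ H ∈ Δ, H.card = 3 ∧ S ⊆ H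
  exists_adjacent : ∀ H ∈ Δ, H.card = 3 → ∀ x ∈ H, ∃ y, y ∉ H ∧ insert y (H.erase x) ∈ Δ ∧
    ∀ z, z ∉ H → insert z (H.erase x) ∈ Δ → z = y
  strongly_connected : ∀ 𝓢 : Set (Finset V), (∀ H ∈ 𝓢, H ∈ Δ ∧ H.card = 3) → 𝓢.Nonempty →
    (∀ H ∈ 𝓢, ∀ x ∈ H, ∀ y, y ∉ H → insert y (H.erase x) ∈ Δ → insert y (H.erase x) ∈ 𝓢) →
    ∀ G ∈ Δ, G.card = 3 → G ∈ 𝓢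
  exists_orientation : ∃ o : V → V → V → ℝ, (∀ x y z, o y x z = -o x y z) ∧
    (∀ x y z, o x z y = -o x y z) ∧ ∀ a b x y, {a, b, x} ∈ Δ → {a, b, y} ∈ Δ →
      ({a, b, x} : Finset V).card = 3 → ({a, b, y} : Finset V).card = 3 → x ≠ y →
        o a b x * o a b y < 0

theorem card_insert_erase {V : Type*} [DecidableEq V] {H : Finset V} {x y : V} (hx : x ∈ H)
    (hy : y ∉ H) : (insert y (H.erase x)).card = H.card := by
  rw [Finset.card_insert_of_notMem fun h => hy (Finset.mem_of_mem_erase h),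
    Finset.card_erase_add_one hx]

namespace SimplicialPolytope

theorem isOrientedSphere (P : SimplicialPolytope 3) : IsOrientedSphere P.boundaryComplex := by
  have hu := P.isSimplicialCone
  have hfac : ∀ S, S ∈ P.boundaryComplex → S.card = 3 →
      IsConeFacet (homogenize P.vertex) S := fun S h h3 =>
    P.mem_facets_iff.1 ⟨h, h3⟩
  have hfac' : ∀ S, IsConeFacet (homogenize P.vertex) S → S ∈ P.boundaryComplex ∧ S.card = 3 :=
    fun S h => P.mem_facets_iff.2 h
  refine ⟨fun S hS T hT => ?_, fun v => ?_, fun S hS => ?_, fun H hH h3 x hx => ?_,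
    fun 𝓢 hf hne hcl G hG h3 => ?_, ?_⟩
  · rw [mem_boundaryComplex_iff] at hS ⊢
    exact ⟨hu.mono hS.1 hS.2 hT, hu.ne_univ ((Finset.card_le_card hT).trans
      (hu.card_le_three hS.1 hS.2))⟩
  · rw [mem_boundaryComplex_iff]
    exact ⟨hu.isConeFace_singleton v, hu.ne_univ (by simp)⟩
  · rw [mem_boundaryComplex_iff] at hS
    obtain ⟨H, hH, hSH⟩ := hu.exists_facet hS.1 hS.2
    exact ⟨H, (hfac' H hH).1, (hfac' H hH).2, hSH⟩
  · obtain ⟨y, h1, h2, h4⟩ := hu.existsUnique_adjacent (hfac H hH h3) hx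
    exact ⟨y, h1, (hfac' _ h2).1, fun z hz hzf =>
      h4 z hz (hfac _ hzf ((card_insert_erase hx hz).trans h3))⟩
  · exact hu.strongly_connected 𝓢 (fun H hH => hfac H (hf H hH).1 (hf H hH).2) hne
      (fun H hH x hx y hy hyf => hcl H hH x hx y hy (hfac' _ hyf).1) (hfac G hG h3)
  · obtain ⟨o, h1, h2, h3⟩ := hu.exists_orientation
    exact ⟨o, h1, h2, fun a b x y hx hy hx3 hy3 hxy => h3 a b x y (hfac _ hx hx3) (hfac _ hy hy3)
      hxy⟩

theorem four_le_n (P : SimplicialPolytope 3) : 4 ≤ P.n := by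
  simpa using P.isSimplicialCone.four_le_card

theorem isConnectedSum_iff {A B P : SimplicialPolytope 3} : IsConnectedSum A B P ↔
    ∃ f₁ f₂ F₁ F₂, IsGluing A.boundaryComplex B.boundaryComplex P.boundaryComplex f₁ f₂ F₁ F₂ := by
  constructor
  · rintro ⟨f₁, f₂, F₁, hF₁, F₂, hF₂, h1, h2, h3, h4⟩
    exact ⟨f₁, f₂, F₁, F₂, ⟨hF₁.1, hF₂.1, hF₁.2, hF₂.2, h1, h2, h3, h4⟩⟩
  · rintro ⟨f₁, f₂, F₁, F₂, h⟩
    exact ⟨f₁, f₂, F₁, ⟨h.mem₁, h.card₁⟩, F₂, ⟨h.mem₂, h.card₂⟩, h.map_eq, h.inter, h.union,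
      h.mem_iff⟩

end SimplicialPolytope

/-- Dehomogenization: the first coordinate becomes the sum of the base coordinates. -/
noncomputable def roofChart : RoofSpace ≃ₗ[ℝ] ℝ × (Fin 3 → ℝ) where
  toFun p := (p.1 0 + p.1 1 + p.1 2, ![p.1 0, p.1 1, p.2])
  invFun q := (![q.2 0, q.2 1, q.1 - q.2 0 - q.2 1], q.2 2)
  map_add' p q := by
    ext i
    · simp; ring
    · fin_cases i <;> simp
  map_smul' c p := by
    ext i
    · simp; ring
    · fin_cases i <;> simp
  left_inv p := by
    ext i
    · fin_cases i <;> simp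
      ring
    · simp
  right_inv q := by
    ext i
    · simp
    · fin_cases i <;> simp

/-- The hyperplane on which the base coordinates sum to one therefore meets every ray of the glued
cone, and the section is a polytope. -/
theorem IsRoof.chart_pos {ι : Type*} {u : ι → RoofSpace} {a : Fin 3 ↪ ι} (ha : IsRoof u a)
    (i : ι) : 0 < (u i).1 0 + (u i).1 1 + (u i).1 2 := by
  by_cases hi : ∃ k, a k = i
  · obtain ⟨k, rfl⟩ := hi
    rw [ha.base]
    fin_cases k <;> simp
  · push Not at hi
    have := ha.fst_pos i hi
    have h0 := this 0
    have h1 := this 1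
    have h2 := this 2
    linarith

/-- Attaching `β` to `α` by identifying `b k` with `a k`. -/
theorem exists_pushout {α β : Type*} [Fintype α] [Fintype β] (a : Fin 3 ↪ α) (b : Fin 3 ↪ β) :
    ∃ (n : ℕ) (f₁ : α ↪ Fin n) (f₂ : β ↪ Fin n), (∀ k, f₁ (a k) = f₂ (b k)) ∧
      (∀ i j, f₁ i = f₂ j → ∃ k, a k = i ∧ b k = j) ∧
      ∀ x, (∃ i, f₁ i = x) ∨ ∃ j, f₂ j = x := by
  classical
  let e := Fintype.equivFin (α ⊕ {j : β // ∀ k, b k ≠ j})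
  let g : β → α ⊕ {j : β // ∀ k, b k ≠ j} := fun j =>
    if h : ∃ k, b k = j then Sum.inl (a h.choose) else Sum.inr ⟨j, fun k hk => h ⟨k, hk⟩⟩
  have hgb : ∀ k, g (b k) = Sum.inl (a k) := by
    intro k
    have h : ∃ k', b k' = b k := ⟨k, rfl⟩
    have : h.choose = k := b.injective h.choose_spec
    simp only [g, dif_pos h, this]
  have hgn : ∀ j (h : ∀ k, b k ≠ j), g j = Sum.inr ⟨j, h⟩ := by
    intro j h
    have h' : ¬ ∃ k, b k = j := by simpa using h
    simp only [g, dif_neg h']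
  have hdich : ∀ j, (∃ k, b k = j) ∨ ∀ k, b k ≠ j := fun j => by
    by_cases h : ∃ k, b k = j
    · exact Or.inl h
    · exact Or.inr (by simpa using h)
  have hg : Function.Injective g := by
    intro j j' h
    rcases hdich j with ⟨k, rfl⟩ | hj <;> rcases hdich j' with ⟨k', rfl⟩ | hj'
    · rw [hgb, hgb] at h
      rw [a.injective (Sum.inl_injective h)]
    · rw [hgb, hgn _ hj'] at h
      cases h
    · rw [hgb, hgn _ hj] at h
      cases h
    · rw [hgn _ hj, hgn _ hj'] at h
      exact congrArg Subtype.val (Sum.inr_injective h)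
  refine ⟨_, ⟨fun i => e (Sum.inl i), e.injective.comp Sum.inl_injective⟩,
    ⟨fun j => e (g j), e.injective.comp hg⟩, fun k => ?_, fun i j h => ?_, fun x => ?_⟩
  · simp [hgb]
  · have h' : Sum.inl i = g j := e.injective h
    rcases hdich j with ⟨k, rfl⟩ | hj
    · rw [hgb] at h'
      exact ⟨k, (Sum.inl_injective h').symm, rfl⟩
    · rw [hgn _ hj] at h'
      cases h'
  · obtain ⟨y, rfl⟩ := e.surjective x
    rcases y with i | ⟨j, hj⟩
    · exact Or.inl ⟨i, rfl⟩
    · exact Or.inr ⟨j, by simp [hgn j hj]⟩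

namespace SimplicialPolytope

/-- Two simplicial polytopes can be glued along any facets, with any identification of their
vertices. -/
theorem exists_isGluing (A B : SimplicialPolytope 3) (a : Fin 3 ↪ Fin A.n) (b : Fin 3 ↪ Fin B.n)
    (ha : Finset.univ.map a ∈ A.boundaryComplex) (hb : Finset.univ.map b ∈ B.boundaryComplex) :
    ∃ (P : SimplicialPolytope 3) (f₁ : Fin A.n ↪ Fin P.n) (f₂ : Fin B.n ↪ Fin P.n),
      IsGluing A.boundaryComplex B.boundaryComplex P.boundaryComplex f₁ f₂
        (Finset.univ.map a) (Finset.univ.map b) ∧ ∀ k, f₁ (a k) = f₂ (b k) := by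
  have hex : ∀ (Q : SimplicialPolytope 3) (c : Fin 3 ↪ Fin Q.n), ∃ i, ∀ k, c k ≠ i := by
    intro Q c
    by_contra! h
    have h1 := Fintype.card_le_of_surjective c h
    have h2 := Q.four_le_n
    simp at h1
    omega
  obtain ⟨L₁, hL₁⟩ := A.isSimplicialCone.exists_roof (a := a)
    (A.mem_facets_iff.1 ⟨ha, by simp⟩)
  obtain ⟨L₂, hL₂⟩ := B.isSimplicialCone.exists_roof (a := b)
    (B.mem_facets_iff.1 ⟨hb, by simp⟩)
  obtain ⟨n, f₁, f₂, hbase, hinter, hcover⟩ := exists_pushout a b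
  -- The two placements agree on common vertices because the reflection fixes the base.
  have hw : ∀ x : Fin n, ∃ p : RoofSpace, (∀ i, f₁ i = x → p = L₁ (homogenize A.vertex i)) ∧
      ∀ j, f₂ j = x → p = roofReflection (L₂ (homogenize B.vertex j)) := by
    intro x
    have hcompat : ∀ i j, f₁ i = f₂ j → L₁ (homogenize A.vertex i) =
        roofReflection (L₂ (homogenize B.vertex j)) := by
      intro i j h
      obtain ⟨k, rfl, rfl⟩ := hinter i j h
      rw [hL₁.base k, hL₂.base k]
      simp
    rcases hcover x with ⟨i, rfl⟩ | ⟨j, rfl⟩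
    · exact ⟨_, fun i' h => by rw [f₁.injective h], fun j h => hcompat i j h.symm⟩
    · exact ⟨_, fun i h => (hcompat i j h).symm, fun j' h => by rw [f₂.injective h]⟩
  choose w hw₁ hw₂ using hw
  have hglue : IsRoofGluing (fun i => L₁ (homogenize A.vertex i))
      (fun j => L₂ (homogenize B.vertex j)) w a b f₁ f₂ :=
    ⟨hL₁, hL₂, fun i => hw₁ _ i rfl, fun j => hw₂ _ j rfl, hbase, hcover⟩
  have hcone := (hglue.isSimplicialCone (A.isSimplicialCone.map_equiv L₁)
    (B.isSimplicialCone.map_equiv L₂) (hex A a) (hex B b)).map_equiv roofChart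
  obtain ⟨v, hv₁, hv₂, hv₃, hface⟩ := exists_of_isSimplicialCone hcone (fun x => by
    change 0 < (w x).1 0 + (w x).1 1 + (w x).1 2
    rcases hcover x with ⟨i, rfl⟩ | ⟨j, rfl⟩
    · rw [hglue.apply₁]
      exact hL₁.chart_pos i
    · rw [hglue.apply₂]
      exact hL₂.chart_pos j)
  refine ⟨⟨n, v, hv₁, hv₂, hv₃⟩, f₁, f₂, ⟨ha, hb, by simp, by simp, ?_, ?_, ?_, fun S => ?_⟩, hbase⟩
  · rw [Finset.map_map, Finset.map_map]
    congr 1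
    ext k
    exact congrArg Fin.val (hbase k)
  · ext x
    simp only [Finset.mem_inter, Finset.mem_map, Finset.mem_univ, true_and]
    constructor
    · rintro ⟨⟨i, rfl⟩, ⟨j, h⟩⟩
      obtain ⟨k, rfl, -⟩ := hinter i j h.symm
      exact ⟨a k, ⟨k, rfl⟩, rfl⟩
    · rintro ⟨_, ⟨k, rfl⟩, rfl⟩
      exact ⟨⟨_, rfl⟩, ⟨_, (hbase k).symm⟩⟩
  · rw [Finset.eq_univ_iff_forall]
    intro x
    simpa using hcover x
  · rw [hface S]
    change IsConeFace (fun x => roofChart (w x)) S ∧ _ ↔ _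
    rw [isConeFace_equiv, hglue.isConeFace_iff (hex A a) (hex B b) S]
    simp only [isConeFace_equiv, ← mem_boundaryComplex_iff]

end SimplicialPolytope

end Gluing


/-! ### Chain complexes and the rank formula for reduced homology. -/

section Chains

set_option linter.unusedSectionVars false

variable {K : Type*} [Field K] {V : Type*} [Fintype V] [LinearOrder V]

theorem mem_restrictComplex {Δ : Set (Finset V)} (hΔ : ∀ S ∈ Δ, ∀ T ⊆ S, T ∈ Δ) {W G : Finset V} :
    G ∈ restrictComplex Δ W ↔ G ∈ Δ ∧ G ⊆ W := by
  constructor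
  · rintro ⟨F, hF, rfl⟩
    exact ⟨hΔ F hF _ Finset.inter_subset_left, Finset.inter_subset_right⟩
  · rintro ⟨h1, h2⟩
    exact ⟨G, h1, Finset.inter_eq_left.2 h2⟩

theorem restrictComplex_mono {Δ : Set (Finset V)} (hΔ : ∀ S ∈ Δ, ∀ T ⊆ S, T ∈ Δ) (W : Finset V) :
    ∀ S ∈ restrictComplex Δ W, ∀ T ⊆ S, T ∈ restrictComplex Δ W := fun S hS T hT => by
  rw [mem_restrictComplex hΔ] at hS ⊢
  exact ⟨hΔ S hS.1 T hT, hT.trans hS.2⟩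

open Classical in
/-- A chain, extended by zero to all sets. -/
noncomputable def chainExtend {Δ : Set (Finset V)} {k : ℤ} (c : SimplicialChain K Δ k)
    (S : Finset V) : K :=
  if h : S ∈ facesOfDim Δ k then c ⟨S, h⟩ else 0

theorem chainExtend_coe {Δ : Set (Finset V)} {k : ℤ} (c : SimplicialChain K Δ k)
    (S : facesOfDim Δ k) : chainExtend c S.1 = c S := by
  simp [chainExtend]

theorem chainExtend_of_notMem {Δ : Set (Finset V)} {k : ℤ} (c : SimplicialChain K Δ k)
    {S : Finset V} (h : S ∉ facesOfDim Δ k) : chainExtend c S = 0 := dif_neg h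

/-- The sign with which `G` occurs in the boundary of `insert v G`. -/
def incidenceSign (K : Type*) [Field K] (G : Finset V) (v : V) : K :=
  (-1) ^ (G.filter (· < v)).card

theorem incidenceSign_ne_zero (G : Finset V) (v : V) : incidenceSign K G v ≠ 0 :=
  pow_ne_zero _ (neg_ne_zero.2 one_ne_zero)

theorem simplicialBoundary_apply {Δ : Set (Finset V)} {k l : ℤ} (c : SimplicialChain K Δ k)
    (G : facesOfDim Δ l) : simplicialBoundary K Δ k l c G =
      ∑ v ∈ Finset.univ \ G.1, incidenceSign K G.1 v * chainExtend c (insert v G.1) := by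
  rw [simplicialBoundary, LinearMap.pi_apply, LinearMap.sum_apply]
  refine Finset.sum_congr rfl fun v _ => ?_
  rw [chainExtend]
  split_ifs with h
  · rfl
  · simp

/-- Exactly one of the two insertions shifts the position of the other vertex; this is the
cancellation behind `∂ ∂ = 0`. -/
theorem incidenceSign_swap {G : Finset V} {v w : V} (hv : v ∉ G) (hw : w ∉ G) (hvw : v ≠ w) :
    incidenceSign K G v * incidenceSign K (insert v G) w +
      incidenceSign K G w * incidenceSign K (insert w G) v = 0 := by
  have key : ∀ {x y : V}, x ∉ G → ((insert x G).filter (· < y)).card =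
      (G.filter (· < y)).card + if x < y then 1 else 0 := by
    intro x y hx
    rw [Finset.filter_insert]
    split_ifs with h
    · rw [Finset.card_insert_of_notMem (fun h' => hx (Finset.mem_filter.1 h').1)]
    · simp
  rw [incidenceSign, incidenceSign, incidenceSign, incidenceSign, key hv, key hw]
  rcases lt_or_gt_of_ne hvw with h | h
  · rw [if_pos h, if_neg h.not_gt, pow_succ]
    ring
  · rw [if_pos h, if_neg h.not_gt, pow_succ]
    ring

theorem simplicialBoundary_comp {Δ : Set (Finset V)} (hΔ : ∀ S ∈ Δ, ∀ T ⊆ S, T ∈ Δ) (k : ℤ)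
    (c : SimplicialChain K Δ (k + 1)) :
    simplicialBoundary K Δ k (k - 1) (simplicialBoundary K Δ (k + 1) k c) = 0 := by
  classical
  funext G
  have hin : ∀ v ∈ Finset.univ \ G.1, incidenceSign K G.1 v *
      chainExtend (simplicialBoundary K Δ (k + 1) k c) (insert v G.1) =
      ∑ w ∈ Finset.univ \ insert v G.1, incidenceSign K G.1 v *
        incidenceSign K (insert v G.1) w * chainExtend c (insert w (insert v G.1)) := by
    intro v hv
    by_cases h : insert v G.1 ∈ facesOfDim Δ k
    · rw [chainExtend_coe _ ⟨_, h⟩, simplicialBoundary_apply, Finset.mul_sum]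
      exact Finset.sum_congr rfl fun w _ => (mul_assoc _ _ _).symm
    · rw [chainExtend_of_notMem _ h, mul_zero]
      refine (Finset.sum_eq_zero fun w _ => ?_).symm
      rw [chainExtend_of_notMem, mul_zero]
      intro h'
      refine h ⟨hΔ _ h'.1 _ (Finset.subset_insert _ _), ?_⟩
      have hG := G.2.2
      rw [Finset.card_insert_of_notMem (Finset.mem_sdiff.1 hv).2]
      push_cast
      linarith
  rw [simplicialBoundary_apply, Finset.sum_congr rfl hin, Pi.zero_apply]
  rw [Finset.sum_sigma']
  -- The terms cancel in pairs, according to the order in which the two vertices are added.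
  refine Finset.sum_involution (fun p _ => ⟨p.2, p.1⟩) ?_ ?_ ?_ ?_
  · rintro ⟨v, w⟩ hp
    simp only [Finset.mem_sigma, Finset.mem_sdiff, Finset.mem_univ, true_and,
      Finset.mem_insert, not_or] at hp
    have := incidenceSign_swap (K := K) hp.1 hp.2.2 (Ne.symm hp.2.1)
    simp only
    rw [Finset.insert_comm v w, ← add_mul, this, zero_mul]
  · rintro ⟨v, w⟩ hp - h
    simp only [Finset.mem_sigma, Finset.mem_sdiff, Finset.mem_univ, true_and,
      Finset.mem_insert, not_or] at hp
    rw [Sigma.mk.injEq] at h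
    exact hp.2.1 h.1
  · rintro ⟨v, w⟩ hp
    simp only [Finset.mem_sigma, Finset.mem_sdiff, Finset.mem_univ, true_and,
      Finset.mem_insert, not_or] at hp ⊢
    exact ⟨hp.2.2, Ne.symm hp.2.1, hp.1⟩
  · rintro ⟨v, w⟩ hp
    rfl

/-- The rank of the boundary map `C_k → C_{k-1}`. -/
noncomputable def boundaryRank (K : Type*) [Field K] (Δ : Set (Finset V)) (k : ℤ) : ℕ :=
  Module.finrank K (LinearMap.range (simplicialBoundary K Δ k (k - 1)))

/-- Rank-nullity reduces homology to face counts and ranks, for which additivity under gluing can be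
checked one subset at a time. -/
theorem finrank_reducedHomology {Δ : Set (Finset V)} (hΔ : ∀ S ∈ Δ, ∀ T ⊆ S, T ∈ Δ) (k : ℤ) :
    (Module.finrank K (ReducedHomology K Δ k) : ℤ) =
      Nat.card (facesOfDim Δ k) - boundaryRank K Δ k - boundaryRank K Δ (k + 1) := by
  classical
  have := Fintype.ofFinite (facesOfDim Δ k)
  have hle : simplicialBoundaries K Δ k ≤ simplicialCycles K Δ k := by
    rintro _ ⟨c, rfl⟩
    exact LinearMap.mem_ker.2 (simplicialBoundary_comp hΔ k c)
  have h1 := Submodule.finrank_quotient_add_finrank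
    ((simplicialBoundaries K Δ k).submoduleOf (simplicialCycles K Δ k))
  rw [(Submodule.submoduleOfEquivOfLe hle).finrank_eq] at h1
  have h2 := LinearMap.finrank_range_add_finrank_ker (simplicialBoundary K Δ k (k - 1))
  rw [Module.finrank_fintype_fun_eq_card, ← Nat.card_eq_fintype_card] at h2
  have h3 : boundaryRank K Δ (k + 1) = Module.finrank K (simplicialBoundaries K Δ k) := by
    rw [boundaryRank, simplicialBoundaries, add_sub_cancel_right]
  rw [h3, boundaryRank]
  change _ + Module.finrank K (simplicialCycles K Δ k) = _ at h2
  change Module.finrank K (ReducedHomology K Δ k) + _ = _ at h1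
  zify at h1 h2
  linarith

theorem facesOfDim_isEmpty {Δ : Set (Finset V)} {k : ℤ} (h : ∀ S ∈ Δ, (S.card : ℤ) ≠ k + 1) :
    IsEmpty (facesOfDim Δ k) :=
  ⟨fun S => h S.1 S.2.1 S.2.2⟩

theorem boundaryRank_eq_zero_of_source {Δ : Set (Finset V)} {k : ℤ}
    (h : ∀ S ∈ Δ, (S.card : ℤ) ≠ k + 1) : boundaryRank K Δ k = 0 := by
  have := facesOfDim_isEmpty h
  rw [boundaryRank, Subsingleton.elim (simplicialBoundary K Δ k (k - 1)) 0, LinearMap.range_zero,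
    finrank_bot]

theorem boundaryRank_eq_zero_of_target {Δ : Set (Finset V)} {k : ℤ}
    (h : ∀ S ∈ Δ, (S.card : ℤ) ≠ k) : boundaryRank K Δ k = 0 := by
  have := facesOfDim_isEmpty (Δ := Δ) (k := k - 1) (by simpa using h)
  rw [boundaryRank, Subsingleton.elim (simplicialBoundary K Δ k (k - 1)) 0, LinearMap.range_zero,
    finrank_bot]

theorem boundaryRank_zero {Δ : Set (Finset V)} (hmem : ∅ ∈ Δ) {v : V} (hv : {v} ∈ Δ) :
    boundaryRank K Δ 0 = 1 := by
  classical
  have huniq : Unique (facesOfDim Δ (0 - 1)) :=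
    ⟨⟨⟨∅, hmem, by simp⟩⟩, fun S => Subtype.ext (by
      have h := S.2.2
      simp only [zero_sub, neg_add_cancel, Nat.cast_eq_zero, Finset.card_eq_zero] at h
      exact h)⟩
  refine le_antisymm ?_ (Nat.one_le_iff_ne_zero.2 fun h0 => ?_)
  · refine (Submodule.finrank_le _).trans ?_
    rw [Module.finrank_fintype_fun_eq_card]
    exact (Fintype.card_unique).le
  · rw [boundaryRank, Submodule.finrank_eq_zero, LinearMap.range_eq_bot] at h0
    have hf : ({v} : Finset V) ∈ facesOfDim Δ 0 := ⟨hv, by simp⟩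
    have h1 := congrFun (LinearMap.congr_fun h0 (Pi.single ⟨{v}, hf⟩ 1)) ⟨∅, hmem, by simp⟩
    rw [simplicialBoundary_apply, Finset.sum_eq_single v] at h1
    · rw [show insert v (∅ : Finset V) = {v} by simp, chainExtend_coe _ ⟨{v}, hf⟩] at h1
      simp [incidenceSign] at h1
    · intro w _ hw
      by_cases h : insert w (∅ : Finset V) ∈ facesOfDim Δ 0
      · rw [chainExtend_coe _ ⟨_, h⟩, Pi.single_eq_of_ne, mul_zero]
        intro he
        simpa [hw] using congrArg Subtype.val he
      · rw [chainExtend_of_notMem _ h, mul_zero]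
    · simp

/-- The functions on the vertices that are constant along the edges inside `W`. -/
def locallyConstant (K : Type*) [Field K] {V : Type*} (Δ : Set (Finset V)) (W : Finset V)
    [DecidableEq V] : Submodule K (V → K) where
  carrier := {f | ∀ u ∈ W, ∀ v ∈ W, {u, v} ∈ Δ → f u = f v}
  add_mem' hf hg u hu v hv h := by simp [hf u hu v hv h, hg u hu v hv h]
  zero_mem' u _ v _ _ := rfl
  smul_mem' c f hf u hu v hv h := by simp [hf u hu v hv h]

theorem mem_locallyConstant {V : Type*} [DecidableEq V] {Δ : Set (Finset V)} {W : Finset V}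
    {f : V → K} : f ∈ locallyConstant K Δ W ↔ ∀ u ∈ W, ∀ v ∈ W, {u, v} ∈ Δ → f u = f v := Iff.rfl

/-- Pairing of functions on the vertices with `0`-chains. -/
noncomputable def vertexPairing (K : Type*) [Field K] (Δ : Set (Finset V)) :
    (V → K) →ₗ[K] Module.Dual K (SimplicialChain K Δ 0) where
  toFun f :=
    { toFun := fun c => ∑ v, f v * chainExtend c {v}
      map_add' := fun c d => by
        rw [← Finset.sum_add_distrib]
        refine Finset.sum_congr rfl fun v _ => ?_
        simp only [chainExtend]
        split_ifs <;> simp [mul_add]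
      map_smul' := fun r c => by
        rw [RingHom.id_apply, Finset.smul_sum]
        refine Finset.sum_congr rfl fun v _ => ?_
        simp only [chainExtend]
        split_ifs <;> simp [mul_left_comm] }
  map_add' f g := by
    ext c
    simp [add_mul, Finset.sum_add_distrib]
  map_smul' r f := by
    ext c
    simp [Finset.mul_sum, mul_assoc]

theorem vertexPairing_apply {Δ : Set (Finset V)} (f : V → K) (c : SimplicialChain K Δ 0) :
    vertexPairing K Δ f c = ∑ v, f v * chainExtend c {v} := rfl

theorem vertexPairing_surjective {Δ : Set (Finset V)} :
    Function.Surjective (vertexPairing K Δ) := by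
  classical
  intro φ
  refine ⟨fun v => φ fun S => if S.1 = {v} then 1 else 0, ?_⟩
  refine LinearMap.pi_ext' fun S => LinearMap.ext_ring ?_
  obtain ⟨v, hv⟩ : ∃ v, S.1 = {v} := Finset.card_eq_one.1 (by
    have := S.2.2
    omega)
  rw [LinearMap.comp_apply, LinearMap.comp_apply, vertexPairing_apply, Finset.sum_eq_single v]
  · rw [← hv, chainExtend_coe]
    simp only [LinearMap.coe_single, Pi.single_eq_same, mul_one]
    congr 1
    funext T
    rw [Pi.single_apply]
    simp only [Subtype.ext_iff]
  · intro w _ hw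
    by_cases h : ({w} : Finset V) ∈ facesOfDim Δ 0
    · rw [chainExtend_coe _ ⟨_, h⟩]
      have : (⟨{w}, h⟩ : facesOfDim Δ 0) ≠ S := fun he => hw (by
        have := congrArg Subtype.val he
        rw [hv] at this
        simpa using this)
      simp [Pi.single_eq_of_ne this]
    · rw [chainExtend_of_notMem _ h, mul_zero]
  · simp

end Chains


/-! ### Ranks of the boundary maps: components and fundamental cycles. -/

section Ranks

set_option linter.unusedSectionVars false

variable {K : Type*} [Field K] {V : Type*} [Fintype V] [LinearOrder V]

theorem chainExtend_boundary {Δ : Set (Finset V)} (hΔ : ∀ S ∈ Δ, ∀ T ⊆ S, T ∈ Δ) {k : ℤ}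
    (c : SimplicialChain K Δ k) {G : Finset V} (hG : (G.card : ℤ) = k - 1 + 1) :
    chainExtend (simplicialBoundary K Δ k (k - 1) c) G =
      ∑ v ∈ Finset.univ \ G, incidenceSign K G v * chainExtend c (insert v G) := by
  by_cases h : G ∈ facesOfDim Δ (k - 1)
  · rw [chainExtend_coe _ ⟨G, h⟩, simplicialBoundary_apply]
  · rw [chainExtend_of_notMem _ h]
    refine (Finset.sum_eq_zero fun v _ => ?_).symm
    rw [chainExtend_of_notMem, mul_zero]
    exact fun h' => h ⟨hΔ _ h'.1 _ (Finset.subset_insert _ _), hG⟩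

theorem chainExtend_single {Δ : Set (Finset V)} {k : ℤ} [DecidableEq (facesOfDim Δ k)] (H : facesOfDim Δ k) (S : Finset V) :
    chainExtend (Pi.single H (1 : K)) S = if S = H.1 then 1 else 0 := by
  by_cases h : S ∈ facesOfDim Δ k
  · rw [chainExtend_coe _ ⟨S, h⟩, Pi.single_apply]
    simp only [Subtype.ext_iff]
  · rw [chainExtend_of_notMem _ h, if_neg]
    rintro rfl
    exact h H.2

theorem vertexPairing_boundary_single {Δ : Set (Finset V)} (hΔ : ∀ S ∈ Δ, ∀ T ⊆ S, T ∈ Δ)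
    [DecidableEq (facesOfDim Δ 1)]
    (f : V → K) {a b : V} (hab : a < b) (H : facesOfDim Δ 1) (hH : H.1 = {a, b}) :
    vertexPairing K Δ f (simplicialBoundary K Δ 1 (1 - 1) (Pi.single H 1)) = f b - f a := by
  classical
  have hne : a ≠ b := hab.ne
  have hpair : ∀ x v : V, ({x, v} : Finset V) = {a, b} → x = a ∧ v = b ∨ x = b ∧ v = a := by
    intro x v h
    have hx : x ∈ ({a, b} : Finset V) := h ▸ by simp
    have hv : v ∈ ({a, b} : Finset V) := h ▸ by simp
    have ha : a ∈ ({x, v} : Finset V) := h ▸ by simp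
    have hb : b ∈ ({x, v} : Finset V) := h ▸ by simp
    simp only [Finset.mem_insert, Finset.mem_singleton] at hx hv ha hb
    grind
  rw [vertexPairing_apply, Finset.sum_eq_add b a hne.symm]
  · have h1 : ∀ u w : V, u ≠ w → ({w, u} : Finset V) = {a, b} →
        chainExtend (simplicialBoundary K Δ 1 (1 - 1) (Pi.single H 1)) {u} =
        incidenceSign K {u} w := by
      intro u w huw hwu
      rw [chainExtend_boundary hΔ _ (by simp), Finset.sum_eq_single w]
      · rw [chainExtend_single, hH, if_pos hwu, mul_one]
      · intro x _ hx
        rw [chainExtend_single, hH, if_neg, mul_zero]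
        intro h
        have h1 := hpair x u h
        have h2 := hpair w u hwu
        grind
      · intro h
        simp at h
        exact absurd h huw.symm
    rw [h1 b a hne.symm rfl, h1 a b hne (Finset.pair_comm b a)]
    simp [incidenceSign, Finset.filter_singleton, hab, hab.not_gt]
    ring
  · intro u _ hu
    rw [chainExtend_boundary hΔ _ (by simp), Finset.sum_eq_zero, mul_zero]
    intro x _
    rw [chainExtend_single, hH, if_neg, mul_zero]
    intro h
    have h1 := hpair x u h
    grind
  · simp
  · simp

/-- The transpose of the edge boundary sends a function to its differences along edges, so its
kernel is `locallyConstant`. Functions live on all of `V`; the free values off `W` are why the total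
is `Fintype.card V`. -/
theorem boundaryRank_one_add {Δ : Set (Finset V)} (hΔ : ∀ S ∈ Δ, ∀ T ⊆ S, T ∈ Δ)
    (W : Finset V) :
    boundaryRank K (restrictComplex Δ W) 1 + Module.finrank K (locallyConstant K Δ W) =
      Fintype.card V := by
  classical
  set X := restrictComplex Δ W with hX
  have hXΔ : ∀ S ∈ X, ∀ T ⊆ S, T ∈ X := restrictComplex_mono hΔ W
  set D := (simplicialBoundary K X 1 (1 - 1)).dualMap.comp (vertexPairing K X) with hD
  have hrange : LinearMap.range D = LinearMap.range (simplicialBoundary K X 1 (1 - 1)).dualMap :=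
    LinearMap.range_comp_of_range_eq_top _ (LinearMap.range_eq_top.2 vertexPairing_surjective)
  have hker : LinearMap.ker D = locallyConstant K Δ W := by
    ext f
    rw [LinearMap.mem_ker, mem_locallyConstant]
    have hDc : ∀ c, D f c = vertexPairing K X f (simplicialBoundary K X 1 (1 - 1) c) := fun c => rfl
    constructor
    · intro h
      have key : ∀ u ∈ W, ∀ v ∈ W, u < v → {u, v} ∈ Δ → f u = f v := by
        intro u hu v hv huv he
        have hmem : ({u, v} : Finset V) ∈ facesOfDim X 1 :=
          ⟨(mem_restrictComplex hΔ).2 ⟨he, by simp [Finset.insert_subset_iff, hu, hv]⟩,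
            by rw [Finset.card_pair huv.ne]; norm_num⟩
        have h1 := hDc (Pi.single ⟨_, hmem⟩ 1)
        rw [vertexPairing_boundary_single hXΔ f huv _ rfl, h, LinearMap.zero_apply] at h1
        exact (sub_eq_zero.1 h1.symm).symm
      intro u hu v hv he
      rcases lt_trichotomy u v with huv | rfl | huv
      · exact key u hu v hv huv he
      · rfl
      · exact (key v hv u hu huv (Finset.pair_comm u v ▸ he)).symm
    · intro h
      refine LinearMap.pi_ext' fun H => LinearMap.ext_ring ?_
      obtain ⟨a, b, hab, hH⟩ : ∃ a b, a < b ∧ H.1 = {a, b} := by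
        obtain ⟨a, b, hab, hH⟩ := Finset.card_eq_two.1 (show H.1.card = 2 by
          have := H.2.2
          omega)
        rcases lt_or_gt_of_ne hab with h | h
        · exact ⟨a, b, h, hH⟩
        · exact ⟨b, a, h, by rw [hH, Finset.pair_comm]⟩
      have hmem := (mem_restrictComplex hΔ).1 H.2.1
      rw [hH] at hmem
      rw [LinearMap.comp_apply, LinearMap.coe_single, hDc,
        vertexPairing_boundary_single hXΔ f hab H hH,
        h a (hmem.2 (by simp)) b (hmem.2 (by simp)) hmem.1]
      simp
  have h := LinearMap.finrank_range_add_finrank_ker D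
  rw [hker, hrange, LinearMap.finrank_range_dualMap_eq_finrank_range,
    Module.finrank_fintype_fun_eq_card] at h
  exact h

namespace IsOrientedSphere

variable {Δ : Set (Finset V)}

/-- In a `2`-cycle the coefficients of the two facets at an edge determine each other. -/
theorem cycle_adjacent (hΔ : IsOrientedSphere Δ) {W : Finset V}
    {z : SimplicialChain K (restrictComplex Δ W) 2}
    (hz : z ∈ simplicialCycles K (restrictComplex Δ W) 2) {H : Finset V} (hH : H ∈ Δ)
    (hcard : H.card = 3) {x y : V} (hx : x ∈ H) (hy : y ∉ H) (hH' : insert y (H.erase x) ∈ Δ) :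
    incidenceSign K (H.erase x) x * chainExtend z H +
      incidenceSign K (H.erase x) y * chainExtend z (insert y (H.erase x)) = 0 := by
  have hxy : x ≠ y := by
    rintro rfl
    exact hy hx
  have h0 := chainExtend_boundary (restrictComplex_mono hΔ.mono W) z (G := H.erase x) (by
    rw [Finset.card_erase_of_mem hx, hcard]; norm_num)
  rw [LinearMap.mem_ker.1 hz] at h0
  have h00 : chainExtend (0 : SimplicialChain K (restrictComplex Δ W) (2 - 1)) (H.erase x) = 0 := by
    rw [chainExtend]
    split_ifs <;> rfl
  rw [h00, Finset.sum_eq_add x y hxy, Finset.insert_erase hx] at h0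
  · exact h0.symm
  · intro v hv hvxy
    rw [chainExtend_of_notMem, mul_zero]
    intro h
    have hvH : v ∉ H := fun hvH => (Finset.mem_sdiff.1 hv).2 (Finset.mem_erase.2 ⟨hvxy.1, hvH⟩)
    obtain ⟨w, -, -, huniq⟩ := hΔ.exists_adjacent H hH hcard x hx
    have h1 := huniq v hvH ((mem_restrictComplex hΔ.mono).1 h.1).1
    have h2 := huniq y hy hH'
    exact hvxy.2 (h1.trans h2.symm)
  · intro h
    simp at h
  · intro h
    simp at h
    exact absurd h.2 hy

/-- A vanishing coefficient propagates across every edge, hence to all facets by strong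
connectedness. -/
theorem cycle_eq_zero (hΔ : IsOrientedSphere Δ) {W : Finset V}
    {z : SimplicialChain K (restrictComplex Δ W) 2}
    (hz : z ∈ simplicialCycles K (restrictComplex Δ W) 2) {H : Finset V} (hH : H ∈ Δ)
    (hcard : H.card = 3) (hzH : chainExtend z H = 0) : z = 0 := by
  funext G
  have hG := (mem_restrictComplex hΔ.mono).1 G.2.1
  have hG3 : G.1.card = 3 := by
    have := G.2.2
    omega
  have := hΔ.strongly_connected {H | (H ∈ Δ ∧ H.card = 3) ∧ chainExtend z H = 0}
    (fun H h => h.1) ⟨H, ⟨hH, hcard⟩, hzH⟩ (fun H h x hx y hy hH' => by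
      refine ⟨⟨hH', (card_insert_erase hx hy).trans h.1.2⟩, ?_⟩
      have h1 := hΔ.cycle_adjacent hz h.1.1 h.1.2 hx hy hH'
      rw [h.2, mul_zero, zero_add] at h1
      exact (mul_eq_zero.1 h1).resolve_left (incidenceSign_ne_zero _ _)) G.1 hG.1 hG3
  rw [← chainExtend_coe z G]
  exact this.2

theorem exists_facet_mem (hΔ : IsOrientedSphere Δ) (v : V) : ∃ H ∈ Δ, H.card = 3 ∧ v ∈ H := by
  obtain ⟨H, hH, h3, hv⟩ := hΔ.exists_facet {v} (hΔ.singleton_mem v)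
  exact ⟨H, hH, h3, hv (by simp)⟩

/-- A facet at a missing vertex is absent from the induced complex, so every 2-cycle has coefficient
zero there. -/
theorem cycles_eq_bot (hΔ : IsOrientedSphere Δ) {W : Finset V} (hW : W ≠ Finset.univ) :
    simplicialCycles K (restrictComplex Δ W) 2 = ⊥ := by
  obtain ⟨v, hv⟩ : ∃ v, v ∉ W := by
    by_contra! h
    exact hW (Finset.eq_univ_iff_forall.2 h)
  obtain ⟨H, hH, h3, hvH⟩ := hΔ.exists_facet_mem v
  refine (Submodule.eq_bot_iff _).2 fun z hz => hΔ.cycle_eq_zero hz hH h3 ?_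
  rw [chainExtend_of_notMem]
  exact fun h => hv (((mem_restrictComplex hΔ.mono).1 h.1).2 hvH)

/-- The sign of a real number, in `K`. -/
noncomputable def realSign (K : Type*) [Field K] (t : ℝ) : K := ((SignType.sign t : ℤ) : K)

theorem realSign_neg (t : ℝ) : realSign K (-t) = -realSign K t := by
  rw [realSign, realSign, Left.sign_neg]
  simp

theorem realSign_ne_zero {t : ℝ} (ht : t ≠ 0) : realSign K t ≠ 0 := by
  rcases lt_or_gt_of_ne ht with h | h
  · simp [realSign, sign_neg h]
  · simp [realSign, sign_pos h]

theorem realSign_add_of_mul_neg {s t : ℝ} (h : s * t < 0) : realSign K s + realSign K t = 0 := by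
  rcases mul_neg_iff.1 h with ⟨h1, h2⟩ | ⟨h1, h2⟩
  · simp [realSign, sign_neg h2, sign_pos h1]
  · simp [realSign, sign_neg h1, sign_pos h2]

theorem orderEmbOfFin_triple {i j k : V} (hij : i < j) (hjk : j < k) {S : Finset V}
    (hS : S = {i, j, k}) (h : S.card = 3) : ⇑(S.orderEmbOfFin h) = ![i, j, k] := by
  refine (Finset.orderEmbOfFin_unique h (fun x => ?_) ?_).symm
  · fin_cases x <;> simp [hS]
  · rw [Fin.strictMono_iff_lt_succ]
    intro x
    fin_cases x
    · exact hij
    · exact hjk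

/-- A fundamental cycle. -/
theorem exists_cycle (hΔ : IsOrientedSphere Δ) :
    ∃ z ∈ simplicialCycles K (restrictComplex Δ Finset.univ) 2,
      ∀ H ∈ Δ, H.card = 3 → chainExtend z H ≠ 0 := by
  obtain ⟨o, h12, h23, ho⟩ := hΔ.exists_orientation
  have hmemX : ∀ S, S ∈ restrictComplex Δ Finset.univ ↔ S ∈ Δ := fun S => by
    rw [mem_restrictComplex hΔ.mono]
    simp
  have h3 : ∀ H : facesOfDim (restrictComplex Δ Finset.univ) 2, H.1.card = 3 := fun H => by
    have := H.2.2
    omega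
  let z : SimplicialChain K (restrictComplex Δ Finset.univ) 2 := fun H =>
    realSign K (o (H.1.orderEmbOfFin (h3 H) 0) (H.1.orderEmbOfFin (h3 H) 1)
      (H.1.orderEmbOfFin (h3 H) 2))
  have hface : ∀ S ∈ Δ, S.card = 3 → S ∈ facesOfDim (restrictComplex Δ Finset.univ) 2 :=
    fun S hS hc => ⟨(hmemX S).2 hS, by rw [hc]; norm_num⟩
  have hzval : ∀ {i j k : V} {S : Finset V}, i < j → j < k → S = {i, j, k} → S ∈ Δ →
      chainExtend z S = realSign K (o i j k) := by
    intro i j k S hij hjk hS hmem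
    have hc : S.card = 3 := by
      rw [hS]
      exact Finset.card_eq_three.2 ⟨i, j, k, hij.ne, (hij.trans hjk).ne, hjk.ne, rfl⟩
    rw [chainExtend_coe z ⟨S, hface S hmem hc⟩]
    simp only [z]
    rw [orderEmbOfFin_triple hij hjk hS]
    rfl
  -- The incidence sign exactly undoes the sorting of `i, j, v`, so the contribution at an edge is
  -- the sign of the alternating function `o`. The two facets at the edge then cancel by coherence.
  have hedge : ∀ {i j v : V}, i < j → v ≠ i → v ≠ j → insert v {i, j} ∈ Δ →
      incidenceSign K {i, j} v * chainExtend z (insert v {i, j}) = realSign K (o i j v) := by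
    intro i j v hij hvi hvj hmem
    have hf : ∀ p : V → Prop, [DecidablePred p] → ({i, j} : Finset V).filter p =
        if p i then (if p j then {i, j} else {i}) else if p j then {j} else ∅ := by
      intro p _
      rw [Finset.filter_insert, Finset.filter_singleton]
      split_ifs <;> simp
    rcases lt_or_gt_of_ne hvi with h1 | h1
    · rw [hzval h1 hij rfl hmem, incidenceSign, hf, if_neg h1.not_gt,
        if_neg (h1.trans hij).not_gt, h12, h23]
      simp
    · rcases lt_or_gt_of_ne hvj with h2 | h2
      · rw [hzval h1 h2 (by ext; simp; tauto) hmem, incidenceSign, hf, if_pos h1,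
          if_neg h2.not_gt, h23, realSign_neg]
        simp
      · rw [hzval hij h2 (by ext; simp; tauto) hmem, incidenceSign, hf, if_pos h1, if_pos h2,
          Finset.card_pair hij.ne]
        simp
  refine ⟨z, ?_, ?_⟩
  · rw [simplicialCycles, LinearMap.mem_ker]
    funext G
    have hG2 : G.1.card = 2 := by
      have := G.2.2
      omega
    obtain ⟨i, j, hij, hG⟩ : ∃ a b, a < b ∧ G.1 = {a, b} := by
      obtain ⟨a, b, hab, hH⟩ := Finset.card_eq_two.1 hG2
      rcases lt_or_gt_of_ne hab with h | h
      · exact ⟨a, b, h, hH⟩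
      · exact ⟨b, a, h, by rw [hH, Finset.pair_comm]⟩
    obtain ⟨H, hH, hc, hGH⟩ := hΔ.exists_facet G.1 ((hmemX _).1 G.2.1)
    obtain ⟨x, hxG, rfl⟩ := Finset.exists_eq_insert_iff.2 ⟨hGH, by rw [hG2, hc]⟩
    obtain ⟨y, hy, hyH, huniq⟩ := hΔ.exists_adjacent _ hH hc x (Finset.mem_insert_self _ _)
    rw [Finset.erase_insert hxG] at hyH huniq
    have hyG : y ∉ G.1 := fun h => hy (Finset.mem_insert_of_mem h)
    have hxy : x ≠ y := by
      rintro rfl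
      exact hy (Finset.mem_insert_self _ _)
    rw [simplicialBoundary_apply, Pi.zero_apply, Finset.sum_eq_add x y hxy]
    · rw [hG] at hxG hyG hH hyH hc ⊢
      simp only [Finset.mem_insert, Finset.mem_singleton, not_or] at hxG hyG
      rw [hedge hij hxG.1 hxG.2 hH, hedge hij hyG.1 hyG.2 hyH]
      have hr : ∀ v, insert v ({i, j} : Finset V) = {i, j, v} := fun v => by
        ext; simp; tauto
      rw [hr] at hH hyH hc
      exact realSign_add_of_mul_neg (ho i j x y hH hyH hc
        (Finset.card_eq_three.2 ⟨i, j, y, hij.ne, Ne.symm hyG.1, Ne.symm hyG.2, rfl⟩) hxy)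
    · intro v hv hvxy
      rw [chainExtend_of_notMem, mul_zero]
      intro h
      refine hvxy.2 (huniq v ?_ ((hmemX _).1 h.1))
      rw [Finset.mem_insert, not_or]
      exact ⟨hvxy.1, (Finset.mem_sdiff.1 hv).2⟩
    · intro h
      simp at h
      exact absurd h hxG
    · intro h
      simp at h
      exact absurd h hyG
  · intro H hH hc
    rw [chainExtend_coe z ⟨H, hface H hH hc⟩]
    refine realSign_ne_zero ?_
    set e := H.orderEmbOfFin hc
    have heq : ({e 0, e 1, e 2} : Finset V) = H := by
      ext v
      rw [← Finset.mem_coe (s := H), ← Finset.range_orderEmbOfFin H hc]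
      simp only [Finset.mem_insert, Finset.mem_singleton]
      constructor
      · rintro (rfl | rfl | rfl) <;> exact ⟨_, rfl⟩
      · rintro ⟨i, rfl⟩
        fin_cases i <;> simp [e]
    -- The orientation is nonzero on a facet, since its product with the value on an adjacent facet
    -- is negative.
    obtain ⟨y, hy, hyH, -⟩ := hΔ.exists_adjacent H hH hc (e 2) (by rw [← heq]; simp)
    have hne := ne_of_card_eq_three (heq ▸ hc : ({e 0, e 1, e 2} : Finset V).card = 3)
    have hyH' : insert y (H.erase (e 2)) = {e 0, e 1, y} := by
      conv_lhs => rw [← heq]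
      ext v
      simp only [Finset.mem_insert, Finset.mem_erase, Finset.mem_singleton]
      grind
    have hcy := (card_insert_erase (x := e 2) (by rw [← heq]; simp) hy).trans hc
    rw [hyH'] at hyH hcy
    have := ho (e 0) (e 1) (e 2) y (heq ▸ hH) hyH (heq ▸ hc) hcy (by
      rintro rfl
      exact hy (by rw [← heq]; simp))
    intro h0
    rw [h0, zero_mul] at this
    exact lt_irrefl _ this

/-- Subtracting the multiple of the fundamental cycle that matches one coefficient kills any cycle,
by `cycle_eq_zero`. -/
theorem finrank_cycles_univ [Nonempty V] (hΔ : IsOrientedSphere Δ) :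
    Module.finrank K (simplicialCycles K (restrictComplex Δ Finset.univ) 2) = 1 := by
  obtain ⟨z, hz, hne⟩ := hΔ.exists_cycle (K := K)
  obtain ⟨H, hH, hc, -⟩ := hΔ.exists_facet_mem (Classical.arbitrary V)
  have hHX : H ∈ facesOfDim (restrictComplex Δ Finset.univ) 2 :=
    ⟨(mem_restrictComplex hΔ.mono).2 ⟨hH, Finset.subset_univ _⟩, by rw [hc]; norm_num⟩
  have hzH : z ⟨H, hHX⟩ ≠ 0 := by
    rw [← chainExtend_coe z ⟨H, hHX⟩]
    exact hne H hH hc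
  refine (finrank_eq_one_iff_of_nonzero' (⟨z, hz⟩ : simplicialCycles K _ 2) ?_).2 fun y => ?_
  · intro h
    have := congrArg Subtype.val h
    simp only [ZeroMemClass.coe_zero] at this
    rw [this] at hzH
    exact hzH rfl
  · refine ⟨y.1 ⟨H, hHX⟩ / z ⟨H, hHX⟩, Subtype.ext ?_⟩
    rw [← sub_eq_zero]
    refine hΔ.cycle_eq_zero (sub_mem (Submodule.smul_mem _ _ hz) y.2) hH hc ?_
    rw [chainExtend_coe _ ⟨H, hHX⟩]
    simp [hzH]

end IsOrientedSphere

end Ranks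


/-! ### Additivity of face counts and of locally constant functions. -/

section Counting

set_option linter.unusedSectionVars false

theorem sum_powerset_pow_card {R γ : Type*} [CommSemiring R] (x : R) (s : Finset γ) :
    ∑ U ∈ s.powerset, x ^ U.card = (1 + x) ^ s.card := by
  rw [← Finset.prod_const, Finset.prod_one_add]
  simp only [Finset.prod_const]

/-- A subset of `γ` is a subset of the image of `α` plus an arbitrary subset of the complement; the
latter choices sum to the power of `1 + x`. -/
theorem sum_preimage_mul_pow_card {R α γ : Type*} [CommSemiring R] [Fintype α] [Fintype γ]
    [DecidableEq γ] (f : α ↪ γ) (g : Finset α → R) (x : R) :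
    ∑ W : Finset γ, g (W.preimage f f.injective.injOn) * x ^ W.card =
      (∑ U : Finset α, g U * x ^ U.card) * (1 + x) ^ (Fintype.card γ - Fintype.card α) := by
  have hcard : ((Finset.univ.map f)ᶜ : Finset γ).card = Fintype.card γ - Fintype.card α := by
    rw [Finset.card_compl, Finset.card_map, Finset.card_univ]
  rw [← hcard, ← sum_powerset_pow_card, Finset.sum_mul_sum, ← Finset.sum_product']
  symm
  have hdisj : ∀ (U : Finset α) (U' : Finset γ), U' ⊆ (Finset.univ.map f)ᶜ →
      Disjoint (U.map f) U' := fun U U' h => by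
    rw [Finset.disjoint_left]
    intro y hy hy'
    obtain ⟨i, -, rfl⟩ := Finset.mem_map.1 hy
    simpa using h hy'
  refine Finset.sum_bij' (fun p _ => p.1.map f ∪ p.2)
    (fun W _ => (W.preimage f f.injective.injOn, W \ Finset.univ.map f)) ?_ ?_ ?_ ?_ ?_
  · intro p _
    exact Finset.mem_univ _
  · intro W _
    rw [Finset.mem_product, Finset.mem_powerset]
    exact ⟨Finset.mem_univ _, fun y hy => by
      rw [Finset.mem_compl]
      exact (Finset.mem_sdiff.1 hy).2⟩
  · rintro ⟨U, U'⟩ hp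
    have hU' : U' ⊆ (Finset.univ.map f)ᶜ := Finset.mem_powerset.1 (Finset.mem_product.1 hp).2
    refine Prod.ext (Finset.ext fun i => ?_) (Finset.ext fun y => ?_)
    · have : f i ∉ U' := fun h => by simpa using hU' h
      simp [this]
    · have : y ∈ U' → ∀ i, f i ≠ y := fun h => by simpa using hU' h
      simp only [Finset.mem_sdiff, Finset.mem_union, Finset.mem_map, Finset.mem_univ, true_and]
      grind
  · intro W _
    ext y
    simp only [Finset.mem_union, Finset.mem_map, Finset.mem_preimage, Finset.mem_sdiff,
      Finset.mem_univ, true_and]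
    grind
  · rintro ⟨U, U'⟩ hp
    have hU' : U' ⊆ (Finset.univ.map f)ᶜ := Finset.mem_powerset.1 (Finset.mem_product.1 hp).2
    have hpre : (U.map f ∪ U').preimage f f.injective.injOn = U := by
      ext i
      have : f i ∉ U' := fun h => by simpa using hU' h
      simp [this]
    simp only
    rw [hpre, Finset.card_union_of_disjoint (hdisj U U' hU'), Finset.card_map, pow_add]
    ring

open Classical in
/-- The number of faces with `m` vertices inside `W`. -/
noncomputable def faceCount {V : Type*} [Fintype V] (Δ : Set (Finset V)) (m : ℕ) (W : Finset V) :
    ℕ :=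
  (Finset.univ.filter fun G : Finset V => G ∈ Δ ∧ G ⊆ W ∧ G.card = m).card

theorem exists_pair_of_map_eq {δ γ : Type*} [DecidableEq δ] [DecidableEq γ] {f : δ ↪ γ}
    {T : Finset δ} {x y : γ} (hT : T.map f = {x, y}) :
    ∃ i j, f i = x ∧ f j = y ∧ {i, j} = T := by
  obtain ⟨i, -, rfl⟩ := Finset.mem_map.1 (hT ▸ Finset.mem_insert_self x {y} : x ∈ T.map f)
  obtain ⟨j, -, rfl⟩ := Finset.mem_map.1 (hT ▸ (by simp) : y ∈ T.map f)
  exact ⟨i, j, rfl, rfl, Finset.map_injective f (by simp [Finset.map_insert, hT])⟩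

namespace IsGluing

variable {α β γ : Type*} [Fintype α] [Fintype β] [Fintype γ] [DecidableEq γ]
  {Δ₁ : Set (Finset α)} {Δ₂ : Set (Finset β)} {Δ : Set (Finset γ)} {f₁ : α ↪ γ} {f₂ : β ↪ γ}
  {F₁ : Finset α} {F₂ : Finset β}

theorem exists_base (h : IsGluing Δ₁ Δ₂ Δ f₁ f₂ F₁ F₂) :
    ∃ (a : Fin 3 ↪ α) (b : Fin 3 ↪ β), Finset.univ.map a = F₁ ∧ Finset.univ.map b = F₂ ∧
      ∀ k, f₁ (a k) = f₂ (b k) := by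
  have e := F₁.equivFinOfCardEq h.card₁
  have key : ∀ k : Fin 3, ∃ j ∈ F₂, f₂ j = f₁ (e.symm k) := fun k => by
    have : f₁ (e.symm k) ∈ F₂.map f₂ := by
      rw [← h.map_eq]
      exact Finset.mem_map_of_mem f₁ (e.symm k).2
    simpa using this
  choose b hbF hb using key
  have hbinj : Function.Injective b := fun k l hkl =>
    e.symm.injective (Subtype.ext (f₁.injective (by rw [← hb, ← hb, hkl])))
  refine ⟨⟨fun k => (e.symm k : α), fun k l hkl => e.symm.injective (Subtype.ext hkl)⟩,
    ⟨b, hbinj⟩, ?_, ?_, fun k => (hb k).symm⟩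
  · refine Finset.eq_of_subset_of_card_le (fun i hi => ?_) (by rw [h.card₁]; simp)
    obtain ⟨k, -, rfl⟩ := Finset.mem_map.1 hi
    exact (e.symm k).2
  · refine Finset.eq_of_subset_of_card_le (fun i hi => ?_) (by rw [h.card₂]; simp)
    obtain ⟨k, -, rfl⟩ := Finset.mem_map.1 hi
    exact hbF k

theorem cover (h : IsGluing Δ₁ Δ₂ Δ f₁ f₂ F₁ F₂) (x : γ) : (∃ i, f₁ i = x) ∨ ∃ j, f₂ j = x := by
  have := h.union ▸ Finset.mem_univ x
  simpa using this

theorem mem_of_eq (h : IsGluing Δ₁ Δ₂ Δ f₁ f₂ F₁ F₂) {i : α} {j : β} (hij : f₁ i = f₂ j) :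
    i ∈ F₁ := by
  have : f₁ i ∈ Finset.univ.map f₁ ∩ Finset.univ.map f₂ := by
    rw [Finset.mem_inter]
    exact ⟨Finset.mem_map_of_mem f₁ (Finset.mem_univ _),
      hij ▸ Finset.mem_map_of_mem f₂ (Finset.mem_univ _)⟩
  rw [h.inter, Finset.mem_map'] at this
  exact this

theorem card_add_three (h : IsGluing Δ₁ Δ₂ Δ f₁ f₂ F₁ F₂) :
    Fintype.card γ + 3 = Fintype.card α + Fintype.card β := by
  have := Finset.card_union_add_card_inter (Finset.univ.map f₁) (Finset.univ.map f₂)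
  rwa [h.union, h.inter, Finset.card_map, Finset.card_map, Finset.card_map, h.card₁,
    Finset.card_univ, Finset.card_univ, Finset.card_univ] at this

/-- Inclusion-exclusion: the faces from both sides are the proper subsets of the glued triangle. The
triangle itself is removed from both families and from their intersection, whence the extra `1` for
`m = 3`. -/
theorem faceCount_eq (h : IsGluing Δ₁ Δ₂ Δ f₁ f₂ F₁ F₂) (h₁ : ∀ S ∈ Δ₁, ∀ T ⊆ S, T ∈ Δ₁)
    (h₂ : ∀ S ∈ Δ₂, ∀ T ⊆ S, T ∈ Δ₂) {a : Fin 3 ↪ α} (ha : Finset.univ.map a = F₁) (m : ℕ)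
    (W : Finset γ) :
    (faceCount Δ m W : ℤ) = faceCount Δ₁ m (W.preimage f₁ f₁.injective.injOn) +
      faceCount Δ₂ m (W.preimage f₂ f₂.injective.injOn) -
      ((W.preimage (a.trans f₁) (a.trans f₁).injective.injOn).card.choose m +
        if m = 3 ∧ W.preimage (a.trans f₁) (a.trans f₁).injective.injOn = Finset.univ
          then 1 else 0) := by
  classical
  set F := F₁.map f₁ with hF
  have hF3 : F.card = 3 := by rw [hF, Finset.card_map, h.card₁]
  have hU : (W.preimage (a.trans f₁) (a.trans f₁).injective.injOn).map (a.trans f₁) = W ∩ F := by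
    rw [hF, ← ha]
    ext x
    simp only [Finset.mem_map, Finset.mem_preimage, Finset.mem_inter, Finset.mem_univ, true_and,
      Function.Embedding.trans_apply]
    grind
  have hUcard : (W.preimage (a.trans f₁) (a.trans f₁).injective.injOn).card = (W ∩ F).card := by
    rw [← hU, Finset.card_map]
  have hUuniv : W.preimage (a.trans f₁) (a.trans f₁).injective.injOn = Finset.univ ↔ F ⊆ W := by
    rw [← Finset.card_eq_iff_eq_univ, hUcard, Fintype.card_fin, ← Finset.inter_eq_right]
    constructor
    · intro h
      exact Finset.eq_of_subset_of_card_le Finset.inter_subset_right (by rw [h, hF3])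
    · intro h
      rw [h, hF3]
  simp only [hUcard, hUuniv]
  set S₁ := Finset.univ.filter fun G : Finset α =>
    G ∈ Δ₁ ∧ G ⊆ W.preimage f₁ f₁.injective.injOn ∧ G.card = m with hS₁
  set S₂ := Finset.univ.filter fun G : Finset β =>
    G ∈ Δ₂ ∧ G ⊆ W.preimage f₂ f₂.injective.injOn ∧ G.card = m with hS₂
  set A := (S₁.erase F₁).map (Finset.mapEmbedding f₁).toEmbedding with hA
  set B := (S₂.erase F₂).map (Finset.mapEmbedding f₂).toEmbedding with hB
  have hsub₁ : ∀ T : Finset α, T ⊆ W.preimage f₁ f₁.injective.injOn ↔ T.map f₁ ⊆ W := fun T => by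
    simp [Finset.subset_iff]
  have hsub₂ : ∀ T : Finset β, T ⊆ W.preimage f₂ f₂.injective.injOn ↔ T.map f₂ ⊆ W := fun T => by
    simp [Finset.subset_iff]
  have hmemA : ∀ G, G ∈ A ↔ (∃ T ∈ Δ₁, T ≠ F₁ ∧ T.map f₁ = G) ∧ G ⊆ W ∧ G.card = m := by
    intro G
    simp only [hA, hS₁, Finset.mem_map, Finset.mem_erase, Finset.mem_filter, Finset.mem_univ,
      true_and, RelEmbedding.coe_toEmbedding, Finset.mapEmbedding_apply]
    constructor
    · rintro ⟨T, ⟨h1, h2, h3, h4⟩, rfl⟩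
      exact ⟨⟨T, h2, h1, rfl⟩, (hsub₁ T).1 h3, by rw [Finset.card_map, h4]⟩
    · rintro ⟨⟨T, h2, h1, rfl⟩, h3, h4⟩
      exact ⟨T, ⟨h1, h2, (hsub₁ T).2 h3, by rwa [Finset.card_map] at h4⟩, rfl⟩
  have hmemB : ∀ G, G ∈ B ↔ (∃ T ∈ Δ₂, T ≠ F₂ ∧ T.map f₂ = G) ∧ G ⊆ W ∧ G.card = m := by
    intro G
    simp only [hB, hS₂, Finset.mem_map, Finset.mem_erase, Finset.mem_filter, Finset.mem_univ,
      true_and, RelEmbedding.coe_toEmbedding, Finset.mapEmbedding_apply]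
    constructor
    · rintro ⟨T, ⟨h1, h2, h3, h4⟩, rfl⟩
      exact ⟨⟨T, h2, h1, rfl⟩, (hsub₂ T).1 h3, by rw [Finset.card_map, h4]⟩
    · rintro ⟨⟨T, h2, h1, rfl⟩, h3, h4⟩
      exact ⟨T, ⟨h1, h2, (hsub₂ T).2 h3, by rwa [Finset.card_map] at h4⟩, rfl⟩
  have hunion : (Finset.univ.filter fun G : Finset γ => G ∈ Δ ∧ G ⊆ W ∧ G.card = m) = A ∪ B := by
    ext G
    rw [Finset.mem_union, hmemA, hmemB, Finset.mem_filter, h.mem_iff, ← or_and_right]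
    exact and_iff_right (Finset.mem_univ G)
  have hinter : A ∩ B = ((W ∩ F).powersetCard m).erase F := by
    ext G
    rw [Finset.mem_inter, hmemA, hmemB, Finset.mem_erase, Finset.mem_powersetCard]
    constructor
    · rintro ⟨⟨⟨T, hT, hTF, rfl⟩, hW, hm⟩, ⟨T', hT', -, hTT'⟩, -⟩
      refine ⟨fun he => hTF (Finset.map_injective f₁ he), Finset.subset_inter hW ?_, hm⟩
      rw [hF, ← h.inter]
      refine Finset.subset_inter (Finset.map_subset_map.2 (Finset.subset_univ _)) ?_
      rw [← hTT']
      exact Finset.map_subset_map.2 (Finset.subset_univ _)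
    · rintro ⟨hGF, hG, hm⟩
      have hGF₁ : G ⊆ F₁.map f₁ := hG.trans Finset.inter_subset_right
      have hGF₂ : G ⊆ F₂.map f₂ := h.map_eq ▸ hGF₁
      obtain ⟨T, hT, rfl⟩ := Finset.subset_map_iff.1 hGF₁
      obtain ⟨T', hT', hTT'⟩ := Finset.subset_map_iff.1 hGF₂
      refine ⟨⟨⟨T, h₁ _ h.mem₁ T hT, ?_, rfl⟩, hG.trans Finset.inter_subset_left, hm⟩,
        ⟨T', h₂ _ h.mem₂ T' hT', ?_, hTT'.symm⟩, hG.trans Finset.inter_subset_left, hm⟩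
      · rintro rfl
        exact hGF rfl
      · rintro rfl
        exact hGF (hTT'.trans h.map_eq.symm)
  have hF₁S : F₁ ∈ S₁ ↔ m = 3 ∧ F ⊆ W := by
    simp only [hS₁, Finset.mem_filter, Finset.mem_univ, true_and]
    rw [hsub₁, h.card₁]
    exact ⟨fun h => ⟨h.2.2.symm, h.2.1⟩, fun h' => ⟨h.mem₁, h'.2, h'.1.symm⟩⟩
  have hF₂S : F₂ ∈ S₂ ↔ m = 3 ∧ F ⊆ W := by
    simp only [hS₂, Finset.mem_filter, Finset.mem_univ, true_and]
    rw [hsub₂, h.card₂, ← h.map_eq]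
    exact ⟨fun h => ⟨h.2.2.symm, h.2.1⟩, fun h' => ⟨h.mem₂, h'.2, h'.1.symm⟩⟩
  have hFS : F ∈ (W ∩ F).powersetCard m ↔ m = 3 ∧ F ⊆ W := by
    rw [Finset.mem_powersetCard, hF3, Finset.subset_inter_iff]
    exact ⟨fun h => ⟨h.2.symm, h.1.1⟩, fun h => ⟨⟨h.2, subset_rfl⟩, h.1.symm⟩⟩
  have hcu := Finset.card_union_add_card_inter A B
  rw [← hunion, hinter, hA, hB, Finset.card_map, Finset.card_map] at hcu
  have hc1 : faceCount Δ₁ m (W.preimage f₁ f₁.injective.injOn) = S₁.card := rfl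
  have hc2 : faceCount Δ₂ m (W.preimage f₂ f₂.injective.injOn) = S₂.card := rfl
  have hc : faceCount Δ m W =
      (Finset.univ.filter fun G : Finset γ => G ∈ Δ ∧ G ⊆ W ∧ G.card = m).card := by
    rw [faceCount]
    congr
  have hp : ((W ∩ F).powersetCard m).card = (W ∩ F).card.choose m := by
    rw [Finset.card_powersetCard]
  rw [← hc] at hcu
  rw [hc1, hc2, ← hp]
  by_cases hc3 : m = 3 ∧ F ⊆ W
  · rw [if_pos hc3]
    have e1 := Finset.card_erase_add_one (hF₁S.2 hc3)
    have e2 := Finset.card_erase_add_one (hF₂S.2 hc3)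
    have e3 := Finset.card_erase_add_one (hFS.2 hc3)
    omega
  · rw [if_neg hc3]
    rw [Finset.erase_eq_of_notMem (mt hF₁S.1 hc3), Finset.erase_eq_of_notMem (mt hF₂S.1 hc3),
      Finset.erase_eq_of_notMem (mt hFS.1 hc3)] at hcu
    omega

variable [DecidableEq α] [DecidableEq β]

theorem pair_mem₁ (h : IsGluing Δ₁ Δ₂ Δ f₁ f₂ F₁ F₂) {i j : α} (hij : {i, j} ∈ Δ₁) :
    {f₁ i, f₁ j} ∈ Δ := by
  refine (h.mem_iff _).2 (Or.inl ⟨_, hij, fun he => ?_, by simp [Finset.map_insert]⟩)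
  have := Finset.card_le_two (a := i) (b := j)
  rw [he, h.card₁] at this
  omega

theorem exists_of_pair_mem (h : IsGluing Δ₁ Δ₂ Δ f₁ f₂ F₁ F₂) {x y : γ} (hxy : {x, y} ∈ Δ) :
    (∃ i j, f₁ i = x ∧ f₁ j = y ∧ {i, j} ∈ Δ₁) ∨ (∃ i j, f₂ i = x ∧ f₂ j = y ∧ {i, j} ∈ Δ₂) := by
  rcases (h.mem_iff _).1 hxy with ⟨T, hT, -, hTe⟩ | ⟨T, hT, -, hTe⟩
  · obtain ⟨i, j, h1, h2, rfl⟩ := exists_pair_of_map_eq hTe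
    exact Or.inl ⟨i, j, h1, h2, hT⟩
  · obtain ⟨i, j, h1, h2, rfl⟩ := exists_pair_of_map_eq hTe
    exact Or.inr ⟨i, j, h1, h2, hT⟩

/-- Mayer-Vietoris in degree zero: restriction to the two sides, followed by the difference on the
common triangle, is a short exact sequence. On the triangle any two vertices are joined, so its term
depends only on `U`. -/
theorem finrank_locallyConstant_add {K : Type*} [Field K] (h : IsGluing Δ₁ Δ₂ Δ f₁ f₂ F₁ F₂)
    (h₁ : ∀ S ∈ Δ₁, ∀ T ⊆ S, T ∈ Δ₁) (h₂ : ∀ S ∈ Δ₂, ∀ T ⊆ S, T ∈ Δ₂)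
    {a : Fin 3 ↪ α} {b : Fin 3 ↪ β} (ha : Finset.univ.map a = F₁) (hb : Finset.univ.map b = F₂)
    (hab : ∀ k, f₁ (a k) = f₂ (b k)) (W : Finset γ) :
    Module.finrank K (locallyConstant K Δ W) +
      Module.finrank K (locallyConstant K (Set.univ : Set (Finset (Fin 3)))
        (W.preimage (a.trans f₁) (a.trans f₁).injective.injOn)) =
    Module.finrank K (locallyConstant K Δ₁ (W.preimage f₁ f₁.injective.injOn)) +
      Module.finrank K (locallyConstant K Δ₂ (W.preimage f₂ f₂.injective.injOn)) := by
  set U := W.preimage (a.trans f₁) (a.trans f₁).injective.injOn with hU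
  set L₁ := locallyConstant K Δ₁ (W.preimage f₁ f₁.injective.injOn) with hL₁
  set L₂ := locallyConstant K Δ₂ (W.preimage f₂ f₂.injective.injOn) with hL₂
  let Ψ : L₁ × L₂ →ₗ[K] (Fin 3 → K) :=
    ((LinearMap.funLeft K K a).comp L₁.subtype).comp (LinearMap.fst K L₁ L₂) -
      ((LinearMap.funLeft K K b).comp L₂.subtype).comp (LinearMap.snd K L₁ L₂)
  have hΨ : ∀ p k, Ψ p k = p.1.1 (a k) - p.2.1 (b k) := fun p k => rfl
  have hmemU : ∀ k, k ∈ U ↔ f₁ (a k) ∈ W := fun k => by simp [hU]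
  have haF : ∀ k, a k ∈ F₁ := fun k => by rw [← ha]; simp
  have hbF : ∀ k, b k ∈ F₂ := fun k => by rw [← hb]; simp
  have hrange : LinearMap.range Ψ = locallyConstant K Set.univ U := by
    apply le_antisymm
    · rintro _ ⟨p, rfl⟩ k hk l hl -
      rw [hmemU] at hk hl
      rw [hΨ, hΨ, p.1.2 (a k) (by simpa using hk) (a l) (by simpa using hl)
        (h₁ _ h.mem₁ _ (by simp [Finset.insert_subset_iff, haF])),
        p.2.2 (b k) (by simpa [← hab] using hk) (b l) (by simpa [← hab] using hl)
        (h₂ _ h.mem₂ _ (by simp [Finset.insert_subset_iff, hbF]))]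
    · intro q hq
      -- The function is constant on `U`; extending it by that same constant makes it constant on
      -- the part of `W` in the first complex.
      obtain ⟨r, hr⟩ : ∃ r, ∀ k ∈ U, q k = r := by
        by_cases hne : U.Nonempty
        · obtain ⟨l, hl⟩ := hne
          exact ⟨q l, fun k hk => hq k hk l hl trivial⟩
        · exact ⟨0, fun k hk => absurd ⟨k, hk⟩ hne⟩
      have hf : Function.extend a q (fun _ => r) ∈ L₁ := by
        have key : ∀ i ∈ W.preimage f₁ f₁.injective.injOn,
            Function.extend a q (fun _ => r) i = r := by
          intro i hi
          by_cases hex : ∃ k, a k = i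
          · obtain ⟨k, rfl⟩ := hex
            rw [a.injective.extend_apply, hr k ((hmemU k).2 (by simpa using hi))]
          · rw [Function.extend_apply' _ _ _ hex]
        intro i hi j hj _
        rw [key i hi, key j hj]
      refine ⟨(⟨_, hf⟩, 0), funext fun k => ?_⟩
      rw [hΨ]
      simp [a.injective.extend_apply]
  let Φ : locallyConstant K Δ W →ₗ[K] L₁ × L₂ :=
    LinearMap.prod
      (LinearMap.codRestrict L₁ ((LinearMap.funLeft K K f₁).comp (Submodule.subtype _))
        fun f i hi j hj hij => f.2 _ (by simpa using hi) _ (by simpa using hj) (h.pair_mem₁ hij))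
      (LinearMap.codRestrict L₂ ((LinearMap.funLeft K K f₂).comp (Submodule.subtype _))
        fun f i hi j hj hij => f.2 _ (by simpa using hi) _ (by simpa using hj)
          (h.symm.pair_mem₁ hij))
  have hΦ₁ : ∀ f i, (Φ f).1.1 i = f.1 (f₁ i) := fun f i => rfl
  have hΦ₂ : ∀ f i, (Φ f).2.1 i = f.1 (f₂ i) := fun f i => rfl
  have hinj : Function.Injective Φ := by
    intro f g hfg
    refine Subtype.ext (funext fun x => ?_)
    rcases h.cover x with ⟨i, rfl⟩ | ⟨j, rfl⟩
    · rw [← hΦ₁, ← hΦ₁, hfg]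
    · rw [← hΦ₂, ← hΦ₂, hfg]
  have hker : LinearMap.ker Ψ = LinearMap.range Φ := by
    apply le_antisymm
    · rintro ⟨f, g⟩ hp
      have hfg : ∀ i j, f₁ i = f₂ j → f.1 i = g.1 j := by
        intro i j hij
        have hi := h.mem_of_eq hij
        rw [← ha] at hi
        obtain ⟨k, -, rfl⟩ := Finset.mem_map.1 hi
        rw [hab] at hij
        rw [← f₂.injective hij]
        have := congrFun (LinearMap.mem_ker.1 hp) k
        rw [hΨ] at this
        exact sub_eq_zero.1 this
      have hex : ∀ x, ∃ r, (∀ i, f₁ i = x → f.1 i = r) ∧ ∀ j, f₂ j = x → g.1 j = r := by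
        intro x
        rcases h.cover x with ⟨i, rfl⟩ | ⟨j, rfl⟩
        · exact ⟨f.1 i, fun i' hi => by rw [f₁.injective hi], fun j hj => (hfg i j hj.symm).symm⟩
        · exact ⟨g.1 j, fun i hi => hfg i j hi, fun j' hj => by rw [f₂.injective hj]⟩
      choose r hr₁ hr₂ using hex
      have hr : r ∈ locallyConstant K Δ W := by
        intro x hx y hy hxy
        rcases h.exists_of_pair_mem hxy with ⟨i, j, rfl, rfl, hij⟩ | ⟨i, j, rfl, rfl, hij⟩
        · rw [← hr₁ _ i rfl, ← hr₁ _ j rfl]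
          exact f.2 i (by simpa using hx) j (by simpa using hy) hij
        · rw [← hr₂ _ i rfl, ← hr₂ _ j rfl]
          exact g.2 i (by simpa using hx) j (by simpa using hy) hij
      exact ⟨⟨r, hr⟩, Prod.ext (Subtype.ext (funext fun i => (hr₁ _ i rfl).symm))
        (Subtype.ext (funext fun j => (hr₂ _ j rfl).symm))⟩
    · rintro _ ⟨f, rfl⟩
      rw [LinearMap.mem_ker]
      funext k
      rw [hΨ, hΦ₁, hΦ₂, hab]
      simp
  have hdim := LinearMap.finrank_range_add_finrank_ker Ψ
  rw [hrange, hker, LinearMap.finrank_range_of_inj hinj, Module.finrank_prod] at hdim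
  omega

end IsGluing

end Counting


/-! ### Additive invariants, and independence of the Betti numbers from the gluing. -/

section Betti

open Polynomial

namespace SimplicialPolytope

/-- A function on the induced subcomplexes of all polytopes that is additive under connected sums,
up to a correction that depends only on the part inside the common triangle. -/
structure IsAdditiveWeight (w : ∀ P : SimplicialPolytope 3, Finset (Fin P.n) → ℤ)
    (g : Finset (Fin 3) → ℤ) : Prop where
  glue : ∀ {A B P : SimplicialPolytope 3} {f₁ : Fin A.n ↪ Fin P.n} {f₂ : Fin B.n ↪ Fin P.n}
    {F₁ : Finset (Fin A.n)} {F₂ : Finset (Fin B.n)},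
    IsGluing A.boundaryComplex B.boundaryComplex P.boundaryComplex f₁ f₂ F₁ F₂ →
    ∀ {a : Fin 3 ↪ Fin A.n} {b : Fin 3 ↪ Fin B.n}, Finset.univ.map a = F₁ →
    Finset.univ.map b = F₂ → (∀ k, f₁ (a k) = f₂ (b k)) → ∀ W : Finset (Fin P.n),
    w P W = w A (W.preimage f₁ f₁.injective.injOn) + w B (W.preimage f₂ f₂.injective.injOn) -
      g (W.preimage (a.trans f₁) (a.trans f₁).injective.injOn)
  iso : ∀ {Q P : SimplicialPolytope 3} (e : Fin Q.n ≃ Fin P.n),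
    (∀ S, S ∈ Q.boundaryComplex ↔ S.map e.toEmbedding ∈ P.boundaryComplex) →
    ∀ W, w P (W.map e.toEmbedding) = w Q W

/-- The generating polynomial of a weight. -/
noncomputable def weightPolynomial {V : Type*} [Fintype V] (w : Finset V → ℤ) : ℚ[X] :=
  ∑ W : Finset V, C (w W : ℚ) * X ^ W.card

theorem coeff_weightPolynomial {V : Type*} [Fintype V] (w : Finset V → ℤ) (j : ℕ) :
    (weightPolynomial w).coeff j =
      ((∑ W ∈ (Finset.univ : Finset V).powersetCard j, w W : ℤ) : ℚ) := by
  rw [weightPolynomial, finsetSum_coeff, Finset.powersetCard_eq_filter, Finset.sum_filter,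
    Finset.powerset_univ]
  push_cast
  refine Finset.sum_congr rfl fun W _ => ?_
  rw [coeff_C_mul, coeff_X_pow]
  split_ifs with h1 h2 h2
  · simp
  · exact absurd h1.symm h2
  · exact absurd h2.symm h1
  · simp

/-- Each term of the pointwise rule depends on `W` only through its trace on one piece; the vertices
outside that piece contribute the power of `1 + X`. -/
theorem IsAdditiveWeight.weightPolynomial_glue
    {w : ∀ P : SimplicialPolytope 3, Finset (Fin P.n) → ℤ} {g : Finset (Fin 3) → ℤ}
    (hw : IsAdditiveWeight w g) {A B P : SimplicialPolytope 3} (h : IsConnectedSum A B P) :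
    P.n - 3 = (A.n - 3) + (B.n - 3) ∧
      weightPolynomial (w P) = weightPolynomial (w A) * (1 + X) ^ (B.n - 3) +
        weightPolynomial (w B) * (1 + X) ^ (A.n - 3) -
        weightPolynomial g * (1 + X) ^ (P.n - 3) := by
  obtain ⟨f₁, f₂, F₁, F₂, h⟩ := isConnectedSum_iff.1 h
  obtain ⟨a, b, ha, hb, hab⟩ := h.exists_base
  have hc := h.card_add_three
  simp only [Fintype.card_fin] at hc
  have hA := A.four_le_n
  have hB := B.four_le_n
  refine ⟨by omega, ?_⟩
  have e1 := sum_preimage_mul_pow_card f₁ (fun U => C (w A U : ℚ)) (X : ℚ[X])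
  have e2 := sum_preimage_mul_pow_card f₂ (fun U => C (w B U : ℚ)) (X : ℚ[X])
  have e3 := sum_preimage_mul_pow_card (a.trans f₁) (fun U => C (g U : ℚ)) (X : ℚ[X])
  simp only [Fintype.card_fin] at e1 e2 e3
  rw [show P.n - A.n = B.n - 3 by omega] at e1
  rw [show P.n - B.n = A.n - 3 by omega] at e2
  rw [weightPolynomial, weightPolynomial, weightPolynomial, weightPolynomial, ← e1, ← e2, ← e3,
    ← Finset.sum_add_distrib, ← Finset.sum_sub_distrib]
  refine Finset.sum_congr rfl fun W _ => ?_
  rw [hw.glue h ha hb hab W]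
  push_cast
  rw [C_sub, C_add]
  ring

theorem IsAdditiveWeight.weightPolynomial_iso
    {w : ∀ P : SimplicialPolytope 3, Finset (Fin P.n) → ℤ} {g : Finset (Fin 3) → ℤ}
    (hw : IsAdditiveWeight w g) {Q P : SimplicialPolytope 3} (h : Q.Iso P) :
    Q.n = P.n ∧ weightPolynomial (w Q) = weightPolynomial (w P) := by
  obtain ⟨e, he⟩ := h
  refine ⟨by simpa using Fintype.card_congr e, ?_⟩
  refine Fintype.sum_equiv e.finsetCongr _ _ fun W => ?_
  rw [Equiv.finsetCongr_apply, hw.iso e he W, Finset.card_map]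

/-- The additive invariant obtained from a weight. -/
noncomputable def weightInvariant (w : ∀ P : SimplicialPolytope 3, Finset (Fin P.n) → ℤ)
    (g : Finset (Fin 3) → ℤ) (P : SimplicialPolytope 3) : FractionRing ℚ[X] :=
  algebraMap ℚ[X] (FractionRing ℚ[X]) (weightPolynomial (w P)) /
      algebraMap ℚ[X] (FractionRing ℚ[X]) (1 + X) ^ (P.n - 3) -
    algebraMap ℚ[X] (FractionRing ℚ[X]) (weightPolynomial g)

theorem algebraMap_one_add_X_ne_zero :
    algebraMap ℚ[X] (FractionRing ℚ[X]) (1 + X) ≠ 0 := by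
  rw [Ne, FaithfulSMul.algebraMap_eq_zero_iff]
  intro h
  have := congrArg (eval 0) h
  simp at this

/-- Since `n - 3` is additive, division by `(1 + X) ^ (n - 3)` removes the powers from the gluing
formula, and subtracting the polynomial of `g` once per polytope absorbs its correction term. Order,
bracketing and identifications then play no role. -/
theorem IsAdditiveWeight.weightInvariant_eq
    {w : ∀ P : SimplicialPolytope 3, Finset (Fin P.n) → ℤ} {g : Finset (Fin 3) → ℤ}
    (hw : IsAdditiveWeight w g) {s : Multiset (SimplicialPolytope 3)} {P : SimplicialPolytope 3}
    (h : IsIteratedConnectedSum s P) :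
    P.n - 3 = (s.map fun Q => Q.n - 3).sum ∧
      weightInvariant w g P = (s.map (weightInvariant w g)).sum := by
  induction h with
  | single h =>
    obtain ⟨h1, h2⟩ := hw.weightPolynomial_iso h
    simp [weightInvariant, h1, h2]
  | @sum s t A B P hA hB hP ihA ihB =>
    obtain ⟨h1, h2⟩ := hw.weightPolynomial_glue hP
    rw [Multiset.map_add, Multiset.sum_add, Multiset.map_add, Multiset.sum_add, ← ihA.1, ← ihA.2,
      ← ihB.1, ← ihB.2]
    refine ⟨h1, ?_⟩
    have hq := algebraMap_one_add_X_ne_zero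
    rw [weightInvariant, weightInvariant, weightInvariant, h2, h1]
    rw [map_sub, map_add, map_mul, map_mul, map_mul, map_pow, map_pow, map_pow, pow_add]
    field_simp
    ring

/-- All iterated connected sums of the same polytopes have the same total weights. -/
theorem IsAdditiveWeight.sum_eq
    {w : ∀ P : SimplicialPolytope 3, Finset (Fin P.n) → ℤ} {g : Finset (Fin 3) → ℤ}
    (hw : IsAdditiveWeight w g) {s : Multiset (SimplicialPolytope 3)} {P Q : SimplicialPolytope 3}
    (hP : IsIteratedConnectedSum s P) (hQ : IsIteratedConnectedSum s Q) :
    P.n = Q.n ∧ ∀ j : ℕ, ∑ W ∈ (Finset.univ : Finset (Fin P.n)).powersetCard j, w P W =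
      ∑ W ∈ (Finset.univ : Finset (Fin Q.n)).powersetCard j, w Q W := by
  obtain ⟨h1, h2⟩ := hw.weightInvariant_eq hP
  obtain ⟨h3, h4⟩ := hw.weightInvariant_eq hQ
  have hP4 := P.four_le_n
  have hQ4 := Q.four_le_n
  have hn : P.n = Q.n := by omega
  refine ⟨hn, fun j => ?_⟩
  have hq := pow_ne_zero (Q.n - 3) algebraMap_one_add_X_ne_zero
  have h5 := h2.trans h4.symm
  have hn3 : P.n - 3 = Q.n - 3 := h1.trans h3.symm
  rw [weightInvariant, weightInvariant, hn3, sub_left_inj, div_left_inj' hq] at h5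
  have h6 := FaithfulSMul.algebraMap_injective _ _ h5
  have h7 := congrArg (fun p => p.coeff j) h6
  simp only [coeff_weightPolynomial] at h7
  exact_mod_cast h7

theorem isAdditiveWeight_faceCount (m : ℕ) :
    IsAdditiveWeight (fun P W => faceCount P.boundaryComplex m W)
      (fun U => U.card.choose m + if m = 3 ∧ U = Finset.univ then 1 else 0) where
  glue h a b ha hb hab W :=
    h.faceCount_eq (isOrientedSphere _).mono (isOrientedSphere _).mono ha m W
  iso e he W := by
    classical
    rw [faceCount, faceCount, Nat.cast_inj]
    symm
    refine Finset.card_bij (fun G _ => G.map e.toEmbedding) (fun G hG => ?_)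
      (fun G _ G' _ h => Finset.map_injective _ h) fun G hG => ?_
    · simp only [Finset.mem_filter, Finset.mem_univ, true_and] at hG ⊢
      exact ⟨(he G).1 hG.1, Finset.map_subset_map.2 hG.2.1, by rw [Finset.card_map, hG.2.2]⟩
    · simp only [Finset.mem_filter, Finset.mem_univ, true_and] at hG
      obtain ⟨G', hG', rfl⟩ := Finset.subset_map_iff.1 hG.2.1
      refine ⟨G', ?_, rfl⟩
      simp only [Finset.mem_filter, Finset.mem_univ, true_and]
      exact ⟨(he G').2 hG.1, hG', by simpa using hG.2.2⟩

theorem isAdditiveWeight_locallyConstant (K : Type*) [Field K] :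
    IsAdditiveWeight (fun P W => Module.finrank K (locallyConstant K P.boundaryComplex W))
      (fun U => Module.finrank K (locallyConstant K (Set.univ : Set (Finset (Fin 3))) U)) where
  glue h a b ha hb hab W := by
    have := h.finrank_locallyConstant_add (K := K) (isOrientedSphere _).mono
      (isOrientedSphere _).mono ha hb hab W
    omega
  iso {Q P} e he W := by
    rw [Nat.cast_inj]
    have hpair : ∀ u v, ({u, v} : Finset (Fin Q.n)) ∈ Q.boundaryComplex ↔
        ({e u, e v} : Finset (Fin P.n)) ∈ P.boundaryComplex := fun u v => by
      rw [he, Finset.map_insert, Finset.map_singleton]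
      rfl
    refine LinearEquiv.finrank_eq (LinearEquiv.ofSubmodules (LinearEquiv.funCongrLeft K K e) _ _ ?_)
    ext f
    rw [Submodule.mem_map]
    constructor
    · rintro ⟨f, hf, rfl⟩ u hu v hv huv
      exact hf (e u) (by simpa using hu) (e v) (by simpa using hv) ((hpair u v).1 huv)
    · intro hf
      refine ⟨f ∘ e.symm, fun u hu v hv huv => ?_, funext fun u => by simp⟩
      refine hf _ ?_ _ ?_ ((hpair _ _).2 (by simpa using huv))
      · simpa using hu
      · simpa using hv

theorem card_le_three (P : SimplicialPolytope 3) {S : Finset (Fin P.n)}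
    (hS : S ∈ P.boundaryComplex) : S.card ≤ 3 := by
  obtain ⟨H, -, hc, hSH⟩ := P.isOrientedSphere.exists_facet S hS
  exact (Finset.card_le_card hSH).trans hc.le

theorem empty_mem (P : SimplicialPolytope 3) : ∅ ∈ P.boundaryComplex :=
  P.isOrientedSphere.mono _
    (P.isOrientedSphere.singleton_mem ⟨0, by have := P.four_le_n; omega⟩) _ (Finset.empty_subset _)

theorem natCard_facesOfDim (P : SimplicialPolytope 3) (W : Finset (Fin P.n)) {k : ℤ} {m : ℕ}
    (hm : k + 1 = m) : Nat.card (facesOfDim (restrictComplex P.boundaryComplex W) k) =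
      faceCount P.boundaryComplex m W := by
  classical
  have := Fintype.ofFinite (facesOfDim (restrictComplex P.boundaryComplex W) k)
  rw [faceCount, Nat.card_eq_fintype_card, ← Set.toFinset_card]
  congr 1
  ext G
  rw [Set.mem_toFinset, facesOfDim, Set.mem_ofPred_eq,
    mem_restrictComplex P.isOrientedSphere.mono, hm, Nat.cast_inj, and_assoc]
  simp

/-- The ranks of the boundary maps of an induced subcomplex. -/
theorem boundaryRank_restrict (K : Type*) [Field K] (P : SimplicialPolytope 3)
    (W : Finset (Fin P.n)) (k : ℤ) :
    (boundaryRank K (restrictComplex P.boundaryComplex W) k : ℤ) =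
      if k = 0 then (if W.card = 0 then (0 : ℤ) else 1)
      else if k = 1 then (P.n : ℤ) - Module.finrank K (locallyConstant K P.boundaryComplex W)
      else if k = 2 then (faceCount P.boundaryComplex 3 W : ℤ) -
        (if W.card = P.n then (1 : ℤ) else 0)
      else (0 : ℤ) := by
  classical
  have hΔ := P.isOrientedSphere
  have hmem : ∀ S, S ∈ restrictComplex P.boundaryComplex W ↔ S ∈ P.boundaryComplex ∧ S ⊆ W :=
    fun S => mem_restrictComplex hΔ.mono
  split_ifs with h0 hW h1 h2 hW
  · subst h0
    rw [Finset.card_eq_zero] at hW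
    subst hW
    rw [boundaryRank_eq_zero_of_source, Nat.cast_zero]
    intro S hS
    rw [Finset.subset_empty.1 ((hmem S).1 hS).2]
    simp
  · subst h0
    obtain ⟨v, hv⟩ := Finset.card_ne_zero.1 hW
    rw [boundaryRank_zero ((hmem _).2 ⟨P.empty_mem, Finset.empty_subset _⟩)
      ((hmem {v}).2 ⟨hΔ.singleton_mem v, by simpa using hv⟩), Nat.cast_one]
  · subst h1
    have := boundaryRank_one_add (K := K) hΔ.mono W
    rw [Fintype.card_fin] at this
    omega
  · subst h2
    have h := LinearMap.finrank_range_add_finrank_ker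
      (simplicialBoundary K (restrictComplex P.boundaryComplex W) 2 (2 - 1))
    have := Fintype.ofFinite (facesOfDim (restrictComplex P.boundaryComplex W) 2)
    rw [Module.finrank_fintype_fun_eq_card, ← Nat.card_eq_fintype_card,
      P.natCard_facesOfDim W (m := 3) (by norm_num)] at h
    have hW' : W = Finset.univ := by
      rw [← Finset.card_eq_iff_eq_univ, hW, Fintype.card_fin]
    have : Nonempty (Fin P.n) := ⟨⟨0, by have := P.four_le_n; omega⟩⟩
    -- The rank of the triangle boundary is the number of triangles minus the dimension of the
    -- 2-cycles, which is one on the whole sphere.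
    have h' : Module.finrank K (LinearMap.ker
      (simplicialBoundary K (restrictComplex P.boundaryComplex W) 2 (2 - 1))) = 1 := by
      rw [hW']
      exact hΔ.finrank_cycles_univ
    rw [h'] at h
    rw [boundaryRank]
    omega
  · subst h2
    have h := LinearMap.finrank_range_add_finrank_ker
      (simplicialBoundary K (restrictComplex P.boundaryComplex W) 2 (2 - 1))
    have := Fintype.ofFinite (facesOfDim (restrictComplex P.boundaryComplex W) 2)
    rw [Module.finrank_fintype_fun_eq_card, ← Nat.card_eq_fintype_card,
      P.natCard_facesOfDim W (m := 3) (by norm_num)] at h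
    have hW' : W ≠ Finset.univ := fun h => hW (by rw [h, Finset.card_univ, Fintype.card_fin])
    have h' : Module.finrank K (LinearMap.ker
      (simplicialBoundary K (restrictComplex P.boundaryComplex W) 2 (2 - 1))) = 0 := by
      have := hΔ.cycles_eq_bot (K := K) hW'
      rw [simplicialCycles] at this
      rw [this, finrank_bot]
    rw [h'] at h
    rw [boundaryRank]
    omega
  · rcases lt_or_ge k 0 with hk | hk
    · rw [boundaryRank_eq_zero_of_target, Nat.cast_zero]
      intro S _
      omega
    · rw [boundaryRank_eq_zero_of_source, Nat.cast_zero]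
      intro S hS
      have := P.card_le_three ((hmem S).1 hS).1
      omega

theorem sum_powersetCard_eq_of_card {n : ℕ} (j : ℕ) (f : ℕ → ℤ) :
    ∑ W ∈ (Finset.univ : Finset (Fin n)).powersetCard j, f W.card = n.choose j * f j := by
  rw [Finset.sum_congr rfl (g := fun _ => f j)
    fun W hW => by rw [(Finset.mem_powersetCard.1 hW).2]]
  rw [Finset.sum_const, Finset.card_powersetCard, Finset.card_univ, Fintype.card_fin, nsmul_eq_mul]

/-- The graded Betti numbers of an iterated connected sum depend only on the summands. -/
theorem gradedBetti_eq_of_isIteratedConnectedSum (K : Type*) [Field K]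
    {s : Multiset (SimplicialPolytope 3)} {P Q : SimplicialPolytope 3}
    (hP : IsIteratedConnectedSum s P) (hQ : IsIteratedConnectedSum s Q) (i j : ℕ) :
    gradedBetti K P i j = gradedBetti K Q i j := by
  have hL := (isAdditiveWeight_locallyConstant K).sum_eq hP hQ
  have hn := hL.1
  have hfc := fun m => ((isAdditiveWeight_faceCount m).sum_eq hP hQ).2 j
  have hL := hL.2 j
  have hcards : ∀ k : ℤ,
      ∑ W ∈ (Finset.univ : Finset (Fin P.n)).powersetCard j,
        (Nat.card (facesOfDim (restrictComplex P.boundaryComplex W) k) : ℤ) =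
      ∑ W ∈ (Finset.univ : Finset (Fin Q.n)).powersetCard j,
        (Nat.card (facesOfDim (restrictComplex Q.boundaryComplex W) k) : ℤ) := by
    intro k
    rcases lt_or_ge (k + 1) 0 with hk | hk
    · have hzero : ∀ (R : SimplicialPolytope 3) (W : Finset (Fin R.n)),
          Nat.card (facesOfDim (restrictComplex R.boundaryComplex W) k) = 0 := by
        intro R W
        have := facesOfDim_isEmpty (Δ := restrictComplex R.boundaryComplex W) (k := k)
          fun S _ => by omega
        exact Nat.card_of_isEmpty
      simp [hzero]
    · obtain ⟨m, hm⟩ := Int.eq_ofNat_of_zero_le hk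
      simp only [natCard_facesOfDim _ _ hm]
      exact hfc m
  -- Each rank is a combination of additive weights and of terms that depend only on `n` and on the
  -- size of `W`.
  have hranks : ∀ k : ℤ,
      ∑ W ∈ (Finset.univ : Finset (Fin P.n)).powersetCard j,
        (boundaryRank K (restrictComplex P.boundaryComplex W) k : ℤ) =
      ∑ W ∈ (Finset.univ : Finset (Fin Q.n)).powersetCard j,
        (boundaryRank K (restrictComplex Q.boundaryComplex W) k : ℤ) := by
    intro k
    simp only [boundaryRank_restrict]
    split_ifs with h0 h1 h2
    · rw [sum_powersetCard_eq_of_card j fun c => if c = 0 then (0 : ℤ) else 1,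
        sum_powersetCard_eq_of_card j fun c => if c = 0 then (0 : ℤ) else 1, hn]
    · rw [Finset.sum_sub_distrib, Finset.sum_sub_distrib, hL,
        sum_powersetCard_eq_of_card j fun _ => (P.n : ℤ),
        sum_powersetCard_eq_of_card j fun _ => (Q.n : ℤ), hn]
    · rw [Finset.sum_sub_distrib, Finset.sum_sub_distrib, hfc 3,
        sum_powersetCard_eq_of_card j fun c => if c = P.n then (1 : ℤ) else 0,
        sum_powersetCard_eq_of_card j fun c => if c = Q.n then (1 : ℤ) else 0, hn]
    · simp
  rw [← Nat.cast_inj (R := ℤ), gradedBetti, gradedBetti]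
  push_cast
  have hfin : ∀ (R : SimplicialPolytope 3) (k : ℤ),
      ∑ W ∈ (Finset.univ : Finset (Fin R.n)).powersetCard j,
        (Module.finrank K (ReducedHomology K (restrictComplex R.boundaryComplex W) k) : ℤ) =
      ∑ W ∈ (Finset.univ : Finset (Fin R.n)).powersetCard j,
          (Nat.card (facesOfDim (restrictComplex R.boundaryComplex W) k) : ℤ) -
        ∑ W ∈ (Finset.univ : Finset (Fin R.n)).powersetCard j,
          (boundaryRank K (restrictComplex R.boundaryComplex W) k : ℤ) -
        ∑ W ∈ (Finset.univ : Finset (Fin R.n)).powersetCard j,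
          (boundaryRank K (restrictComplex R.boundaryComplex W) (k + 1) : ℤ) := by
    intro R k
    rw [← Finset.sum_sub_distrib, ← Finset.sum_sub_distrib]
    refine Finset.sum_congr rfl fun W _ => ?_
    exact finrank_reducedHomology (restrictComplex_mono R.isOrientedSphere.mono W) k
  rw [hfin, hfin, hcards, hranks, hranks]

end SimplicialPolytope

end Betti


/-! ### Vertex degrees as an invariant that detects the gluing. -/

section Degree

set_option linter.unusedSectionVars false

open Classical in
/-- The neighbours of a vertex. -/
noncomputable def neighbors {V : Type*} [Fintype V] (Δ : Set (Finset V)) (v : V) : Finset V :=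
  Finset.univ.filter fun w => w ≠ v ∧ {v, w} ∈ Δ

theorem mem_neighbors {V : Type*} [Fintype V] [DecidableEq V] {Δ : Set (Finset V)} {v w : V} :
    w ∈ neighbors Δ v ↔ w ≠ v ∧ {v, w} ∈ Δ := by
  unfold neighbors
  simp only [Finset.mem_filter, Finset.mem_univ, true_and]
  convert Iff.rfl

/-- The number of neighbours of a vertex. -/
noncomputable def degree {V : Type*} [Fintype V] (Δ : Set (Finset V)) (v : V) : ℕ :=
  (neighbors Δ v).card

/-- The sum of the squares of the degrees. -/
noncomputable def degreeSq {V : Type*} [Fintype V] (Δ : Set (Finset V)) : ℤ :=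
  ∑ v, (degree Δ v : ℤ) ^ 2

/-- All vertices have the same degree. -/
def IsDegreeRegular {V : Type*} [Fintype V] (Δ : Set (Finset V)) : Prop :=
  ∀ u v, degree Δ u = degree Δ v

theorem exists_embedding_of_card {V : Type*} [DecidableEq V] {H : Finset V} (hH : H.card = 3)
    {u v : V} (hu : u ∈ H) (hv : v ∈ H) (huv : u ≠ v) :
    ∃ a : Fin 3 ↪ V, Finset.univ.map a = H ∧ a 0 = u ∧ a 1 = v := by
  have hc : ((H.erase u).erase v).card = 1 := by
    rw [Finset.card_erase_of_mem (Finset.mem_erase.2 ⟨huv.symm, hv⟩), Finset.card_erase_of_mem hu,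
      hH]
  obtain ⟨w, hw⟩ := Finset.card_eq_one.1 hc
  have hw' : w ∈ (H.erase u).erase v := by rw [hw]; simp
  simp only [Finset.mem_erase] at hw'
  have hinj : Function.Injective ![u, v, w] := by
    intro i j hij
    fin_cases i <;> fin_cases j <;> simp_all
  refine ⟨⟨![u, v, w], hinj⟩, ?_, rfl, rfl⟩
  refine Finset.eq_of_subset_of_card_le (fun x hx => ?_) (by rw [hH]; simp)
  obtain ⟨k, -, rfl⟩ := Finset.mem_map.1 hx
  fin_cases k
  · exact hu
  · exact hv
  · exact hw'.2.2

namespace IsOrientedSphere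

variable {V : Type*} [Fintype V] [DecidableEq V] {Δ : Set (Finset V)}

theorem pair_mem (hΔ : IsOrientedSphere Δ) {H : Finset V} (hH : H ∈ Δ) {u v : V} (hu : u ∈ H)
    (hv : v ∈ H) : {u, v} ∈ Δ :=
  hΔ.mono H hH _ (by simp [Finset.insert_subset_iff, hu, hv])

/-- A facet at `v` gives two neighbours, and the facet across an edge through `v` gives a third. -/
theorem three_le_degree (hΔ : IsOrientedSphere Δ) (v : V) : 3 ≤ degree Δ v := by
  obtain ⟨H, hH, h3, hv⟩ : ∃ H ∈ Δ, H.card = 3 ∧ v ∈ H := by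
    obtain ⟨H, hH, h3, hv⟩ := hΔ.exists_facet {v} (hΔ.singleton_mem v)
    exact ⟨H, hH, h3, hv (by simp)⟩
  obtain ⟨x, hx⟩ : (H.erase v).Nonempty := by
    rw [← Finset.card_pos, Finset.card_erase_of_mem hv, h3]
    norm_num
  rw [Finset.mem_erase] at hx
  obtain ⟨y, hy, hyH, -⟩ := hΔ.exists_adjacent H hH h3 x hx.2
  have hvy : y ≠ v := fun h => hy (h ▸ hv)
  have hsub : insert y (H.erase v) ⊆ neighbors Δ v := by
    intro w hw
    rw [mem_neighbors]
    rcases Finset.mem_insert.1 hw with rfl | hw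
    · exact ⟨hvy, hΔ.pair_mem hyH (Finset.mem_insert_of_mem (Finset.mem_erase.2 ⟨hx.1.symm, hv⟩))
        (Finset.mem_insert_self _ _)⟩
    · rw [Finset.mem_erase] at hw
      exact ⟨hw.1, hΔ.pair_mem hH hv hw.2⟩
  have := Finset.card_le_card hsub
  rwa [card_insert_erase hv hy, h3] at this

/-- If degrees were constant on each facet, they would be constant along paths of adjacent facets,
which share vertices. -/
theorem exists_facet_of_not_regular (hΔ : IsOrientedSphere Δ) (h : ¬ IsDegreeRegular Δ) :
    ∃ a : Fin 3 ↪ V, Finset.univ.map a ∈ Δ ∧ degree Δ (a 0) ≠ degree Δ (a 1) := by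
  by_contra! hcon
  have hconst : ∀ H ∈ Δ, H.card = 3 → ∀ u ∈ H, ∀ v ∈ H, degree Δ u = degree Δ v := by
    intro H hH h3 u hu v hv
    by_cases huv : u = v
    · rw [huv]
    · obtain ⟨a, ha, rfl, rfl⟩ := exists_embedding_of_card h3 hu hv huv
      exact hcon a (ha ▸ hH)
  have hfacet : ∀ v, ∃ H ∈ Δ, H.card = 3 ∧ v ∈ H := fun v => by
    obtain ⟨H, hH, h3, hv⟩ := hΔ.exists_facet {v} (hΔ.singleton_mem v)
    exact ⟨H, hH, h3, hv (by simp)⟩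
  refine h fun u v => ?_
  obtain ⟨H, hH, h3, hu⟩ := hfacet u
  obtain ⟨G, hG, hG3, hv⟩ := hfacet v
  have := hΔ.strongly_connected {H | (H ∈ Δ ∧ H.card = 3) ∧ ∀ w ∈ H, degree Δ w = degree Δ u}
    (fun H h => h.1) ⟨H, ⟨hH, h3⟩, fun w hw => hconst H hH h3 w hw u hu⟩
    (fun H h x hx y hy hyH => by
      have h3' := (card_insert_erase hx hy).trans h.1.2
      refine ⟨⟨hyH, h3'⟩, fun w hw => ?_⟩
      obtain ⟨z, hz⟩ : (H.erase x).Nonempty := by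
        rw [← Finset.card_pos, Finset.card_erase_of_mem hx, h.1.2]
        norm_num
      rw [hconst _ hyH h3' w hw z (Finset.mem_insert_of_mem hz)]
      exact h.2 z (Finset.mem_of_mem_erase hz)) G hG hG3
  exact (this.2 v hv).symm

end IsOrientedSphere

namespace IsGluing

variable {α β γ : Type*} [Fintype α] [Fintype β] [Fintype γ] [DecidableEq γ] [DecidableEq α]
  [DecidableEq β]
  {Δ₁ : Set (Finset α)} {Δ₂ : Set (Finset β)} {Δ : Set (Finset γ)} {f₁ : α ↪ γ} {f₂ : β ↪ γ}
  {F₁ : Finset α} {F₂ : Finset β}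

theorem degree_of_notMem (h : IsGluing Δ₁ Δ₂ Δ f₁ f₂ F₁ F₂) {i : α} (hi : i ∉ F₁) :
    degree Δ (f₁ i) = degree Δ₁ i := by
  rw [degree, degree, ← Finset.card_map f₁]
  congr 1
  ext x
  rw [mem_neighbors, Finset.mem_map]
  constructor
  · rintro ⟨hne, hx⟩
    rcases h.exists_of_pair_mem hx with ⟨i', j, hi', rfl, hij⟩ | ⟨i', j, hi', rfl, -⟩
    · rw [f₁.injective hi'] at hij
      exact ⟨j, mem_neighbors.2 ⟨fun hj => hne (by rw [hj]), hij⟩, rfl⟩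
    · exact absurd (h.mem_of_eq hi'.symm) hi
  · rintro ⟨j, hj, rfl⟩
    rw [mem_neighbors] at hj
    exact ⟨fun he => hj.1 (f₁.injective he), h.pair_mem₁ hj.2⟩

/-- The neighbours common to both sides are the other two vertices of the glued triangle. -/
theorem degree_add_two (h : IsGluing Δ₁ Δ₂ Δ f₁ f₂ F₁ F₂) (h₁ : ∀ S ∈ Δ₁, ∀ T ⊆ S, T ∈ Δ₁)
    (h₂ : ∀ S ∈ Δ₂, ∀ T ⊆ S, T ∈ Δ₂) {i : α} {j : β} (hij : f₁ i = f₂ j) :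
    degree Δ (f₁ i) + 2 = degree Δ₁ i + degree Δ₂ j := by
  have hi : i ∈ F₁ := h.mem_of_eq hij
  have hj : j ∈ F₂ := h.symm.mem_of_eq hij.symm
  have hunion : neighbors Δ (f₁ i) =
      (neighbors Δ₁ i).map f₁ ∪ (neighbors Δ₂ j).map f₂ := by
    ext x
    rw [mem_neighbors, Finset.mem_union, Finset.mem_map, Finset.mem_map]
    constructor
    · rintro ⟨hne, hx⟩
      rcases h.exists_of_pair_mem hx with ⟨i', k, hi', rfl, hik⟩ | ⟨i', k, hi', rfl, hik⟩
      · rw [f₁.injective hi'] at hik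
        exact Or.inl ⟨k, mem_neighbors.2 ⟨fun he => hne (by rw [he]), hik⟩, rfl⟩
      · rw [f₂.injective (hi'.trans hij)] at hik
        exact Or.inr ⟨k, mem_neighbors.2 ⟨fun he => hne (by rw [he, hij]), hik⟩, rfl⟩
    · rintro (⟨k, hk, rfl⟩ | ⟨k, hk, rfl⟩)
      · rw [mem_neighbors] at hk
        exact ⟨fun he => hk.1 (f₁.injective he), h.pair_mem₁ hk.2⟩
      · rw [mem_neighbors] at hk
        rw [hij]
        exact ⟨fun he => hk.1 (f₂.injective he), h.symm.pair_mem₁ hk.2⟩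
  have hinter : (neighbors Δ₁ i).map f₁ ∩ (neighbors Δ₂ j).map f₂ =
      (F₁.erase i).map f₁ := by
    ext x
    rw [Finset.mem_inter]
    constructor
    · rintro ⟨hx₁, hx₂⟩
      obtain ⟨k, hk, rfl⟩ := Finset.mem_map.1 hx₁
      obtain ⟨l, -, hl⟩ := Finset.mem_map.1 hx₂
      rw [mem_neighbors] at hk
      exact Finset.mem_map_of_mem f₁ (Finset.mem_erase.2 ⟨hk.1, h.mem_of_eq hl.symm⟩)
    · intro hx
      obtain ⟨k, hk, rfl⟩ := Finset.mem_map.1 hx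
      rw [Finset.mem_erase] at hk
      have : f₁ k ∈ F₂.map f₂ := h.map_eq ▸ Finset.mem_map_of_mem f₁ hk.2
      obtain ⟨l, hl, hlk⟩ := Finset.mem_map.1 this
      refine ⟨Finset.mem_map_of_mem f₁ (mem_neighbors.2 ⟨hk.1,
        h₁ _ h.mem₁ _ (by simp [Finset.insert_subset_iff, hi, hk.2])⟩), ?_⟩
      rw [← hlk]
      refine Finset.mem_map_of_mem f₂ (mem_neighbors.2 ⟨?_,
        h₂ _ h.mem₂ _ (by simp [Finset.insert_subset_iff, hj, hl])⟩)
      rintro rfl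
      exact hk.1 (f₁.injective (hlk.symm.trans hij.symm))
  have := Finset.card_union_add_card_inter ((neighbors Δ₁ i).map f₁) ((neighbors Δ₂ j).map f₂)
  rw [← hunion, hinter, Finset.card_map, Finset.card_map, Finset.card_map,
    Finset.card_erase_of_mem hi, h.card₁] at this
  exact this

theorem sum_add_sum_base (h : IsGluing Δ₁ Δ₂ Δ f₁ f₂ F₁ F₂) {a : Fin 3 ↪ α}
    (ha : Finset.univ.map a = F₁) (G : γ → ℤ) :
    ∑ x, G x + ∑ k, G (f₁ (a k)) = ∑ i, G (f₁ i) + ∑ j, G (f₂ j) := by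
  have := Finset.sum_union_inter (s₁ := Finset.univ.map f₁) (s₂ := Finset.univ.map f₂) (f := G)
  rw [h.union, h.inter, ← ha, Finset.sum_map, Finset.sum_map, Finset.sum_map, Finset.sum_map] at this
  exact this

theorem sum_eq_of_eqOn {δ : Type*} [Fintype δ] {c : Fin 3 ↪ δ} {p q : δ → ℤ}
    (hpq : ∀ i, i ∉ Finset.univ.map c → p i = q i) :
    ∑ i, p i - ∑ k, p (c k) = ∑ i, q i - ∑ k, q (c k) := by
  classical
  have key : ∀ r : δ → ℤ, ∑ i, r i - ∑ k, r (c k) = ∑ i ∈ (Finset.univ.map c)ᶜ, r i := by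
    intro r
    rw [← Finset.sum_add_sum_compl (Finset.univ.map c) r, Finset.sum_map]
    ring
  rw [key, key]
  exact Finset.sum_congr rfl fun i hi => hpq i (Finset.mem_compl.1 hi)

/-- Expand `(p + q - 2) ^ 2` at the three identified vertices; elsewhere degrees are unchanged. Only
the products `2 * p * q` depend on how the two triangles are matched. -/
theorem degreeSq_eq (h : IsGluing Δ₁ Δ₂ Δ f₁ f₂ F₁ F₂) (h₁ : ∀ S ∈ Δ₁, ∀ T ⊆ S, T ∈ Δ₁)
    (h₂ : ∀ S ∈ Δ₂, ∀ T ⊆ S, T ∈ Δ₂) {a : Fin 3 ↪ α} {b : Fin 3 ↪ β}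
    (ha : Finset.univ.map a = F₁) (hb : Finset.univ.map b = F₂) (hab : ∀ k, f₁ (a k) = f₂ (b k)) :
    degreeSq Δ = degreeSq Δ₁ + degreeSq Δ₂ + ∑ k, (2 * degree Δ₁ (a k) * degree Δ₂ (b k) -
      4 * degree Δ₁ (a k) - 4 * degree Δ₂ (b k) + 4 : ℤ) := by
  have e0 := h.sum_add_sum_base ha fun x => (degree Δ x : ℤ) ^ 2
  have e1 := sum_eq_of_eqOn (c := a) (p := fun i => (degree Δ (f₁ i) : ℤ) ^ 2)
    (q := fun i => (degree Δ₁ i : ℤ) ^ 2) fun i hi => by rw [h.degree_of_notMem (ha ▸ hi)]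
  have e2 := sum_eq_of_eqOn (c := b) (p := fun i => (degree Δ (f₂ i) : ℤ) ^ 2)
    (q := fun i => (degree Δ₂ i : ℤ) ^ 2) fun i hi => by rw [h.symm.degree_of_notMem (hb ▸ hi)]
  simp only [← hab] at e2
  have e3 : ∀ k, (degree Δ (f₁ (a k)) : ℤ) ^ 2 = (degree Δ₁ (a k) : ℤ) ^ 2 +
      (degree Δ₂ (b k) : ℤ) ^ 2 + (2 * degree Δ₁ (a k) * degree Δ₂ (b k) -
      4 * degree Δ₁ (a k) - 4 * degree Δ₂ (b k) + 4 : ℤ) := by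
    intro k
    have := h.degree_add_two h₁ h₂ (hab k)
    have hd : (degree Δ (f₁ (a k)) : ℤ) = degree Δ₁ (a k) + degree Δ₂ (b k) - 2 := by
      have := congrArg (Nat.cast (R := ℤ)) this
      push_cast at this
      linarith
    rw [hd]
    ring
  have e4 := Finset.sum_congr (rfl : (Finset.univ : Finset (Fin 3)) = Finset.univ) fun k _ => e3 k
  rw [Finset.sum_add_distrib, Finset.sum_add_distrib] at e4
  rw [degreeSq, degreeSq, degreeSq]
  linarith

end IsGluing

namespace SimplicialPolytope

theorem Iso.degreeSq_eq {P Q : SimplicialPolytope 3} (h : P.Iso Q) :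
    degreeSq P.boundaryComplex = degreeSq Q.boundaryComplex := by
  obtain ⟨e, he⟩ := h
  refine Fintype.sum_equiv e _ _ fun v => ?_
  congr 2
  rw [degree, degree, ← Finset.card_map e.toEmbedding]
  congr 1
  ext x
  obtain ⟨w, rfl⟩ := e.surjective x
  rw [Finset.mem_map_equiv, e.symm_apply_apply, mem_neighbors, mem_neighbors, he, Finset.map_insert,
    Finset.map_singleton, e.injective.ne_iff]
  rfl

theorem Iso.trans {P Q R : SimplicialPolytope 3} (h₁ : P.Iso Q) (h₂ : Q.Iso R) : P.Iso R := by
  obtain ⟨e, he⟩ := h₁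
  obtain ⟨f, hf⟩ := h₂
  refine ⟨e.trans f, fun S => ?_⟩
  rw [he, hf, Finset.map_map]
  rfl

theorem Iso.refl (P : SimplicialPolytope 3) : P.Iso P :=
  ⟨Equiv.refl _, fun S => by simp⟩

theorem exists_facet_embedding (P : SimplicialPolytope 3) (v : Fin P.n) :
    ∃ a : Fin 3 ↪ Fin P.n, Finset.univ.map a ∈ P.boundaryComplex ∧ a 0 = v := by
  have hΔ := P.isOrientedSphere
  obtain ⟨H, hH, h3, hv⟩ := hΔ.exists_facet_mem v
  obtain ⟨x, hx⟩ : (H.erase v).Nonempty := by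
    rw [← Finset.card_pos, Finset.card_erase_of_mem hv, h3]
    norm_num
  rw [Finset.mem_erase] at hx
  obtain ⟨a, ha, h0, -⟩ := exists_embedding_of_card h3 hv hx.2 hx.1.symm
  exact ⟨a, ha ▸ hH, h0⟩

theorem exists_notMem (P : SimplicialPolytope 3) {H : Finset (Fin P.n)} (h : H.card ≤ 3) :
    ∃ v, v ∉ H := by
  by_contra! hcon
  rw [← Finset.eq_univ_iff_forall] at hcon
  have := P.four_le_n
  rw [hcon, Finset.card_univ, Fintype.card_fin] at h
  omega

instance (P : SimplicialPolytope 3) : Nonempty (Fin P.n) :=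
  ⟨⟨0, by have := P.four_le_n; omega⟩⟩

/-- The degrees of two polytopes can be matched so as to obtain a vertex of larger degree. -/
theorem exists_isConnectedSum_not_regular (A B : SimplicialPolytope 3) :
    ∃ P, IsConnectedSum A B P ∧ ¬ IsDegreeRegular P.boundaryComplex := by
  -- Gluing at a vertex of maximal degree in `A` raises that degree by at least one, while a vertex
  -- of `A` off the facet keeps a degree not above the maximum.
  obtain ⟨u, -, hu⟩ := Finset.exists_max_image Finset.univ (degree A.boundaryComplex)
    Finset.univ_nonempty
  obtain ⟨a, ha, rfl⟩ := A.exists_facet_embedding u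
  obtain ⟨b, hb, -⟩ := B.exists_facet_embedding (Classical.arbitrary _)
  obtain ⟨P, f₁, f₂, h, hab⟩ := exists_isGluing A B a b ha hb
  refine ⟨P, isConnectedSum_iff.2 ⟨_, _, _, _, h⟩, fun hreg => ?_⟩
  obtain ⟨i, hi⟩ := A.exists_notMem (H := Finset.univ.map a) (by simp)
  have h1 := hreg (f₁ i) (f₁ (a 0))
  rw [h.degree_of_notMem hi] at h1
  have h2 := h.degree_add_two A.isOrientedSphere.mono B.isOrientedSphere.mono (hab 0)
  have h3 := hu i (Finset.mem_univ _)
  have h4 := B.isOrientedSphere.three_le_degree (b 0)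
  omega

/-- Glue along facets that carry unequal degrees, then exchange two identifications: the sums of
squares differ by twice the product of the two degree differences. -/
theorem exists_isConnectedSum_degreeSq_ne {A B : SimplicialPolytope 3}
    (hA : ¬ IsDegreeRegular A.boundaryComplex) (hB : ¬ IsDegreeRegular B.boundaryComplex) :
    ∃ P Q, IsConnectedSum A B P ∧ IsConnectedSum A B Q ∧
      degreeSq P.boundaryComplex ≠ degreeSq Q.boundaryComplex := by
  obtain ⟨a, ha, hne₁⟩ := A.isOrientedSphere.exists_facet_of_not_regular hA
  obtain ⟨b, hb, hne₂⟩ := B.isOrientedSphere.exists_facet_of_not_regular hB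
  set b' : Fin 3 ↪ Fin B.n := (Equiv.swap (0 : Fin 3) 1).toEmbedding.trans b with hb'
  have hbb' : Finset.univ.map b' = Finset.univ.map b := by
    rw [hb', ← Finset.map_map, Finset.map_univ_equiv]
  obtain ⟨P, f₁, f₂, hP, hab⟩ := exists_isGluing A B a b ha hb
  obtain ⟨Q, g₁, g₂, hQ, hab'⟩ := exists_isGluing A B a b' ha (hbb' ▸ hb)
  refine ⟨P, Q, isConnectedSum_iff.2 ⟨_, _, _, _, hP⟩, isConnectedSum_iff.2 ⟨_, _, _, _, hQ⟩,
    fun heq => ?_⟩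
  rw [hP.degreeSq_eq A.isOrientedSphere.mono B.isOrientedSphere.mono rfl rfl hab,
    hQ.degreeSq_eq A.isOrientedSphere.mono B.isOrientedSphere.mono rfl rfl hab',
    Fin.sum_univ_three, Fin.sum_univ_three] at heq
  have h0 : b' 0 = b 1 := by simp [hb']
  have h1 : b' 1 = b 0 := by simp [hb']
  have h2 : b' 2 = b 2 := by
    rw [hb']
    exact congrArg b (by decide)
  rw [h0, h1, h2] at heq
  have : ((degree A.boundaryComplex (a 0) : ℤ) - degree A.boundaryComplex (a 1)) *
      ((degree B.boundaryComplex (b 0) : ℤ) - degree B.boundaryComplex (b 1)) = 0 := by linarith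
  rcases mul_eq_zero.1 this with h | h
  · exact hne₁ (by exact_mod_cast sub_eq_zero.1 h)
  · exact hne₂ (by exact_mod_cast sub_eq_zero.1 h)

theorem exists_isIteratedConnectedSum {s : Multiset (SimplicialPolytope 3)} (hs : s ≠ 0) :
    ∃ P, IsIteratedConnectedSum s P := by
  induction s using Multiset.induction with
  | empty => exact absurd rfl hs
  | cons A t ih =>
    by_cases ht : t = 0
    · exact ⟨A, by rw [ht]; exact .single (Iso.refl A)⟩
    · obtain ⟨B, hB⟩ := ih ht
      obtain ⟨P, hP, -⟩ := exists_isConnectedSum_not_regular A B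
      refine ⟨P, ?_⟩
      rw [← Multiset.singleton_add]
      exact .sum (.single (Iso.refl A)) hB hP

theorem exists_isIteratedConnectedSum_not_regular {s : Multiset (SimplicialPolytope 3)}
    (hs : 2 ≤ s.card) :
    ∃ P, IsIteratedConnectedSum s P ∧ ¬ IsDegreeRegular P.boundaryComplex := by
  obtain ⟨A, hA⟩ := Multiset.card_pos_iff_exists_mem.1 (by omega : 0 < s.card)
  obtain ⟨t, rfl⟩ := Multiset.exists_cons_of_mem hA
  rw [Multiset.card_cons] at hs
  obtain ⟨B, hB⟩ := exists_isIteratedConnectedSum (s := t) (by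
    rintro rfl
    simp at hs)
  obtain ⟨P, hP, hne⟩ := exists_isConnectedSum_not_regular A B
  refine ⟨P, ?_, hne⟩
  rw [← Multiset.singleton_add]
  exact .sum (.single (Iso.refl A)) hB hP

/-- If every facet other than `F` meets `F` in two vertices, then there are only four vertices. -/
theorem n_eq_four_of_inter (P : SimplicialPolytope 3) {F : Finset (Fin P.n)}
    (hF : F ∈ P.boundaryComplex) (hF3 : F.card = 3)
    (h : ∀ G ∈ P.boundaryComplex, G.card = 3 → G ≠ F → (G ∩ F).card = 2) : P.n = 4 := by
  have hΔ := P.isOrientedSphere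
  -- A facet through a vertex `w` off `F` consists of `w` and an edge of `F`. Crossing its edges
  -- through `w` reaches the remaining edges of `F`. So every such `w` lies opposite `F` across one
  -- fixed edge, where there is room for only one.
  have key : ∀ w, w ∉ F → ∀ x ∈ F, insert w (F.erase x) ∈ P.boundaryComplex := by
    intro w hw
    obtain ⟨G, hG, hG3, hwG⟩ := hΔ.exists_facet_mem w
    have hform : ∀ G ∈ P.boundaryComplex, G.card = 3 → w ∈ G →
        ∃ x ∈ F, G = insert w (F.erase x) := by
      intro G hG hG3 hwG
      have hGF := h G hG hG3 (fun he => hw (he ▸ hwG))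
      obtain ⟨x, hx⟩ : (F \ G).Nonempty := by
        rw [← Finset.card_pos]
        have := Finset.card_sdiff_add_card_inter F G
        rw [Finset.inter_comm, hGF, hF3] at this
        omega
      rw [Finset.mem_sdiff] at hx
      have e1 : G.erase w = G ∩ F := by
        refine (Finset.eq_of_subset_of_card_le (fun y hy => ?_) ?_).symm
        · rw [Finset.mem_inter] at hy
          exact Finset.mem_erase.2 ⟨fun he => hw (he ▸ hy.2), hy.1⟩
        · rw [Finset.card_erase_of_mem hwG, hG3, hGF]
      have e2 : G ∩ F = F.erase x := by
        refine Finset.eq_of_subset_of_card_le (fun y hy => ?_) ?_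
        · rw [Finset.mem_inter] at hy
          exact Finset.mem_erase.2 ⟨fun he => hx.2 (he ▸ hy.1), hy.2⟩
        · rw [Finset.card_erase_of_mem hx.1, hF3, hGF]
      exact ⟨x, hx.1, by rw [← e2, ← e1, Finset.insert_erase hwG]⟩
    obtain ⟨x, hx, rfl⟩ := hform G hG hG3 hwG
    intro y hy
    by_cases hyx : y = x
    · rw [hyx]
      exact hG
    · have hyG : y ∈ insert w (F.erase x) :=
        Finset.mem_insert_of_mem (Finset.mem_erase.2 ⟨hyx, hy⟩)
      obtain ⟨z, hz, hzG, -⟩ := hΔ.exists_adjacent _ hG hG3 y hyG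
      have hwy : w ≠ y := fun he => hw (he ▸ hy)
      obtain ⟨v, hv, hGv⟩ := hform _ hzG ((card_insert_erase hyG hz).trans hG3)
        (Finset.mem_insert_of_mem (Finset.mem_erase.2 ⟨hwy, Finset.mem_insert_self _ _⟩))
      have hyz : y ≠ z := fun he => hz (he ▸ hyG)
      have hvy : y = v := by
        by_contra hne
        have : y ∈ insert z ((insert w (F.erase x)).erase y) := by
          rw [hGv]
          exact Finset.mem_insert_of_mem (Finset.mem_erase.2 ⟨hne, hy⟩)
        simp [hyz] at this
      rw [hvy, ← hGv]
      exact hzG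
  have hcompl : Fᶜ.card ≤ 1 := by
    rw [Finset.card_le_one]
    intro w hw w' hw'
    rw [Finset.mem_compl] at hw hw'
    obtain ⟨x, hx⟩ := Finset.card_pos.1 (by omega : 0 < F.card)
    obtain ⟨y, -, -, huniq⟩ := hΔ.exists_adjacent F hF hF3 x hx
    exact (huniq w hw (key w hw x hx)).trans (huniq w' hw' (key w' hw' x hx)).symm
  rw [Finset.card_compl, Fintype.card_fin, hF3] at hcompl
  have := P.four_le_n
  omega

theorem mem_boundaryComplex_of_n_eq_four (P : SimplicialPolytope 3) (hn : P.n = 4)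
    (S : Finset (Fin P.n)) : S ∈ P.boundaryComplex ↔ S.card ≤ 3 := by
  refine ⟨fun h => P.card_le_three h, fun h => ?_⟩
  have hΔ := P.isOrientedSphere
  have key : ∀ v, Finset.univ.erase v ∈ P.boundaryComplex := by
    obtain ⟨H, hH, h3, -⟩ := hΔ.exists_facet_mem (Classical.arbitrary _)
    obtain ⟨x, hx⟩ := P.exists_notMem h3.le
    have hHx : ∀ y, y ∉ H → y = x := by
      intro y hy
      by_contra hne
      have h1 := Finset.card_le_univ (insert x (insert y H))
      rw [Finset.card_insert_of_notMem (by simp [hx, Ne.symm hne]),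
        Finset.card_insert_of_notMem hy, h3, Fintype.card_fin, hn] at h1
      omega
    intro v
    by_cases hv : v ∈ H
    · obtain ⟨y, hy, hyH, -⟩ := hΔ.exists_adjacent H hH h3 v hv
      convert hyH using 1
      ext z
      rw [Finset.mem_erase, Finset.mem_insert, Finset.mem_erase, hHx y hy]
      have := hHx z
      grind
    · convert hH using 1
      ext z
      rw [Finset.mem_erase, hHx v hv]
      have := hHx z
      grind
  obtain ⟨v, hv⟩ := P.exists_notMem h
  exact hΔ.mono _ (key v) _ fun y hy =>
    Finset.mem_erase.2 ⟨fun he => hv (he ▸ hy), Finset.mem_univ _⟩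

theorem tetrahedron_iso {Q : SimplicialPolytope 3} (hn : Q.n = 4) : tetrahedron.Iso Q := by
  refine ⟨finCongr hn.symm, fun S => ?_⟩
  rw [mem_boundaryComplex_of_n_eq_four _ rfl, mem_boundaryComplex_of_n_eq_four _ hn,
    Finset.card_map]

theorem IsIteratedConnectedSum.replicate {T : SimplicialPolytope 3}
    {s : Multiset (SimplicialPolytope 3)} {P : SimplicialPolytope 3}
    (h : IsIteratedConnectedSum s P) (hT : ∀ Q ∈ s, T.Iso Q) :
    IsIteratedConnectedSum (Multiset.replicate s.card T) P := by
  induction h with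
  | single h => exact .single ((hT _ (Multiset.mem_singleton_self _)).trans h)
  | sum hA hB hP ihA ihB =>
    rw [Multiset.card_add, Multiset.replicate_add]
    exact .sum (ihA fun Q hQ => hT Q (Multiset.mem_add.2 (Or.inl hQ)))
      (ihB fun Q hQ => hT Q (Multiset.mem_add.2 (Or.inr hQ))) hP

/-- If `B` has more than four vertices and `A` and `B` are degree-regular, then the sum of the
degrees is not the same for all facets of a connected sum. -/
theorem n_eq_four_of_sum_eq {A B X : SimplicialPolytope 3} {f₁ : Fin A.n ↪ Fin X.n}
    {f₂ : Fin B.n ↪ Fin X.n} {F₁ : Finset (Fin A.n)} {F₂ : Finset (Fin B.n)}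
    (h : IsGluing A.boundaryComplex B.boundaryComplex X.boundaryComplex f₁ f₂ F₁ F₂)
    (hA : IsDegreeRegular A.boundaryComplex) (hB : IsDegreeRegular B.boundaryComplex) (σ : ℕ)
    (hσ : ∀ G ∈ X.boundaryComplex, G.card = 3 → ∑ v ∈ G, degree X.boundaryComplex v = σ) :
    B.n = 4 := by
  have hΔ := B.isOrientedSphere
  set p := degree A.boundaryComplex (Classical.arbitrary _) with hp
  set q := degree B.boundaryComplex (Classical.arbitrary _) with hq
  have hp3 : 3 ≤ p := A.isOrientedSphere.three_le_degree _
  -- Both summands being regular, of degrees `p` and `q`, the degree sum of a facet coming from `B`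
  -- records only how many of its vertices lie in `F₂`.
  have hdeg : ∀ j, degree X.boundaryComplex (f₂ j) = q + if j ∈ F₂ then p - 2 else 0 := by
    intro j
    split_ifs with hj
    · have : f₂ j ∈ F₁.map f₁ := h.map_eq ▸ Finset.mem_map_of_mem f₂ hj
      obtain ⟨i, -, hi⟩ := Finset.mem_map.1 this
      have h1 := h.degree_add_two A.isOrientedSphere.mono B.isOrientedSphere.mono hi
      rw [hA i (Classical.arbitrary _), hB j (Classical.arbitrary _), ← hp, ← hq, hi] at h1
      omega
    · rw [h.symm.degree_of_notMem hj, hB j (Classical.arbitrary _), ← hq, add_zero]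
  have hsum : ∀ G ∈ B.boundaryComplex, G.card = 3 → G ≠ F₂ →
      3 * q + (G ∩ F₂).card * (p - 2) = σ := by
    intro G hG hG3 hne
    rw [← hσ (G.map f₂) ((h.mem_iff _).2 (Or.inr ⟨G, hG, hne, rfl⟩))
      (by rw [Finset.card_map, hG3]), Finset.sum_map, Finset.sum_congr rfl fun j _ => hdeg j,
      Finset.sum_add_distrib, Finset.sum_const, hG3, ← Finset.sum_filter, Finset.sum_const,
      Finset.filter_mem_eq_inter]
    simp
  obtain ⟨x, hx⟩ := Finset.card_pos.1 (by rw [h.card₂]; norm_num : 0 < F₂.card)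
  -- A facet adjacent to `F₂` meets it in two vertices. As `p - 2 > 0`, equal degree sums force
  -- every other facet to do the same.
  obtain ⟨y, hy, hyF, -⟩ := hΔ.exists_adjacent F₂ h.mem₂ h.card₂ x hx
  have h2 := hsum _ hyF ((card_insert_erase hx hy).trans h.card₂) fun he =>
    hy (he ▸ Finset.mem_insert_self _ _)
  have hint : insert y (F₂.erase x) ∩ F₂ = F₂.erase x := by
    rw [Finset.insert_inter_of_notMem hy]
    exact Finset.inter_eq_left.2 (Finset.erase_subset _ _)
  rw [hint, Finset.card_erase_of_mem hx, h.card₂] at h2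
  refine B.n_eq_four_of_inter h.mem₂ h.card₂ fun G hG hG3 hne => ?_
  have h1 := hsum G hG hG3 hne
  exact Nat.eq_of_mul_eq_mul_right (by omega : 0 < p - 2) (by omega)

/-- When `C` is regular of degree `d`, attaching it to a facet of `X` contributes `2 * d - 4` times
the degree sum of that facet plus a constant, and `d ≥ 3` makes the factor nonzero. -/
theorem sum_degree_eq {X C : SimplicialPolytope 3} (hC : IsDegreeRegular C.boundaryComplex)
    (hD : ∀ P Q, IsConnectedSum X C P → IsConnectedSum X C Q →
      degreeSq P.boundaryComplex = degreeSq Q.boundaryComplex) {G H : Finset (Fin X.n)}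
    (hG : G ∈ X.boundaryComplex) (hG3 : G.card = 3) (hH : H ∈ X.boundaryComplex)
    (hH3 : H.card = 3) :
    ∑ v ∈ G, degree X.boundaryComplex v = ∑ v ∈ H, degree X.boundaryComplex v := by
  have hemb : ∀ G : Finset (Fin X.n), G.card = 3 →
      ∃ a : Fin 3 ↪ Fin X.n, Finset.univ.map a = G := fun G hG => by
    obtain ⟨u, hu, v, hv, huv⟩ := Finset.one_lt_card.1 (by omega : 1 < G.card)
    obtain ⟨a, ha, -⟩ := exists_embedding_of_card hG hu hv huv
    exact ⟨a, ha⟩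
  obtain ⟨a, rfl⟩ := hemb G hG3
  obtain ⟨a', rfl⟩ := hemb H hH3
  obtain ⟨c, hc, -⟩ := C.exists_facet_embedding (Classical.arbitrary _)
  obtain ⟨P, f₁, f₂, hP, hac⟩ := exists_isGluing X C a c hG hc
  obtain ⟨Q, g₁, g₂, hQ, hac'⟩ := exists_isGluing X C a' c hH hc
  have heq := hD P Q (isConnectedSum_iff.2 ⟨_, _, _, _, hP⟩) (isConnectedSum_iff.2 ⟨_, _, _, _, hQ⟩)
  rw [hP.degreeSq_eq X.isOrientedSphere.mono C.isOrientedSphere.mono rfl rfl hac,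
    hQ.degreeSq_eq X.isOrientedSphere.mono C.isOrientedSphere.mono rfl rfl hac',
    Fin.sum_univ_three, Fin.sum_univ_three, hC (c 1) (c 0), hC (c 2) (c 0)] at heq
  have h3 := C.isOrientedSphere.three_le_degree (c 0)
  rw [Finset.sum_map, Finset.sum_map, Fin.sum_univ_three, Fin.sum_univ_three]
  set d := degree C.boundaryComplex (c 0)
  have hd : ((2 * d - 4 : ℤ)) ≠ 0 := by omega
  have : ((2 * d - 4 : ℤ)) * ((degree X.boundaryComplex (a 0) + degree X.boundaryComplex (a 1) +
      degree X.boundaryComplex (a 2) : ℕ) : ℤ) = (2 * d - 4 : ℤ) *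
      ((degree X.boundaryComplex (a' 0) + degree X.boundaryComplex (a' 1) +
      degree X.boundaryComplex (a' 2) : ℕ) : ℤ) := by
    push_cast
    linarith
  exact_mod_cast mul_left_cancel₀ hd this

/-- If all iterated connected sums of at least three polytopes have the same sum of squared degrees,
then there are exactly three of them, all with four vertices. -/
theorem card_eq_three_and_n_eq_four {s : Multiset (SimplicialPolytope 3)} (hs : 3 ≤ s.card)
    (hD : ∀ P Q, IsIteratedConnectedSum s P → IsIteratedConnectedSum s Q →
      degreeSq P.boundaryComplex = degreeSq Q.boundaryComplex) :
    s.card = 3 ∧ ∀ Q ∈ s, Q.n = 4 := by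
  -- Two or more summands have an irregular sum, so any sum of the complementary summands has to be
  -- regular.
  have hreg : ∀ (t₁ t₂ : Multiset (SimplicialPolytope 3)) (C : SimplicialPolytope 3),
      s = t₁ + t₂ → 2 ≤ t₁.card → IsIteratedConnectedSum t₂ C →
      IsDegreeRegular C.boundaryComplex := by
    intro t₁ t₂ C hst ht₁ hC
    by_contra hne
    obtain ⟨X, hX, hXne⟩ := exists_isIteratedConnectedSum_not_regular ht₁
    obtain ⟨P, Q, hP, hQ, hPQ⟩ := exists_isConnectedSum_degreeSq_ne hXne hne
    exact hPQ (hD P Q (hst ▸ .sum hX hC hP) (hst ▸ .sum hX hC hQ))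
  -- With four or more summands, two can be set apart and the rest still has an irregular sum,
  -- against `hreg`.
  have hcard : s.card = 3 := by
    by_contra hne
    obtain ⟨A, hA⟩ := Multiset.card_pos_iff_exists_mem.1 (by omega : 0 < s.card)
    obtain ⟨t, rfl⟩ := Multiset.exists_cons_of_mem hA
    rw [Multiset.card_cons] at hs hne
    obtain ⟨B, hB⟩ := Multiset.card_pos_iff_exists_mem.1 (by omega : 0 < t.card)
    obtain ⟨t, rfl⟩ := Multiset.exists_cons_of_mem hB
    rw [Multiset.card_cons] at hs hne
    obtain ⟨C, hC, hCne⟩ := exists_isIteratedConnectedSum_not_regular (s := t) (by omega)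
    exact hCne (hreg {A, B} t C (by simp) (by simp) hC)
  refine ⟨hcard, fun B hB => ?_⟩
  have hregular : ∀ Q ∈ s, IsDegreeRegular Q.boundaryComplex := by
    intro Q hQ
    obtain ⟨t, rfl⟩ := Multiset.exists_cons_of_mem hQ
    rw [Multiset.card_cons] at hcard
    exact hreg t {Q} Q (by rw [add_comm, Multiset.singleton_add]) (by omega) (.single (Iso.refl Q))
  obtain ⟨t, rfl⟩ := Multiset.exists_cons_of_mem hB
  rw [Multiset.card_cons] at hcard
  obtain ⟨A, C, rfl⟩ := Multiset.card_eq_two.1 (by omega : t.card = 2)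
  have hs' : B ::ₘ {A, C} = ({A} + {B} : Multiset (SimplicialPolytope 3)) + {C} := by
    rw [Multiset.insert_eq_cons, ← Multiset.singleton_add, ← Multiset.singleton_add,
      ← add_assoc, add_comm ({B} : Multiset _) {A}]
  -- Here only the existence of a connected sum of `A` and `B` matters; `C` serves as a probe on its
  -- facets.
  obtain ⟨X, hX, -⟩ := exists_isConnectedSum_not_regular A B
  have hX' : IsIteratedConnectedSum ({A} + {B}) X :=
    .sum (.single (Iso.refl A)) (.single (Iso.refl B)) hX
  have hDX : ∀ P Q, IsConnectedSum X C P → IsConnectedSum X C Q →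
      degreeSq P.boundaryComplex = degreeSq Q.boundaryComplex := fun P Q hP hQ =>
    hD P Q (hs' ▸ .sum hX' (.single (Iso.refl C)) hP) (hs' ▸ .sum hX' (.single (Iso.refl C)) hQ)
  obtain ⟨f₁, f₂, F₁, F₂, h⟩ := isConnectedSum_iff.1 hX
  obtain ⟨H, hH, hH3, -⟩ := X.isOrientedSphere.exists_facet_mem (Classical.arbitrary _)
  exact n_eq_four_of_sum_eq h (hregular A (by simp)) (hregular B (by simp)) _
    fun G hG hG3 => sum_degree_eq (hregular C (by simp)) hDX hG hG3 hH hH3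

end SimplicialPolytope

end Degree

/-! ### Conclusion. -/

theorem mainTheorem7 (K : Type*) [Field K]
    (s : Multiset (SimplicialPolytope 3)) (hs : 3 ≤ s.card)
    (hirr : ∀ Q ∈ s, SimplicialPolytope.IsIrreducible Q)
    (P : SimplicialPolytope 3) (hP : SimplicialPolytope.IsIteratedConnectedSum s P)
    (hne : ¬ SimplicialPolytope.IsIteratedConnectedSum {tetrahedron, tetrahedron, tetrahedron} P) :
    ¬ SimplicialPolytope.IsRigid K P := by
  intro hrigid
  have hiso : ∀ Q, SimplicialPolytope.IsIteratedConnectedSum s Q → P.Iso Q := fun Q hQ =>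
    hrigid 3 Q (SimplicialPolytope.gradedBetti_eq_of_isIteratedConnectedSum K hP hQ)
  obtain ⟨hcard, hn⟩ := SimplicialPolytope.card_eq_three_and_n_eq_four hs fun Q R hQ hR =>
    (hiso Q hQ).degreeSq_eq.symm.trans (hiso R hR).degreeSq_eq
  -- A polytope with four vertices is a tetrahedron, so the same iterated sum exhibits `P` as a sum
  -- of three tetrahedra, the excluded case.
  have := hP.replicate fun Q hQ => SimplicialPolytope.tetrahedron_iso (hn Q hQ)
  rw [hcard] at this
  exact hne this
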